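/- **Theorem 4.2.** Let $g$ be a nondegenerate symmetric bilinear form on $\mathbb R^n$ ($\perp$ denotes $g$-orthogonality), let $R:[0,1]\to\mathcal L(\mathbb R^n)$ be of class $C^1$ with every $R(t)$ $g$-symmetric, let $P\subseteq\mathbb R^n$ be a subspace on which $g$ is nondegenerate, and let $S:P\to P$ be a $g$-symmetric linear map. Let $\mathbb J$ be the space of solutions $J:[0,1]\to\mathbb R^n$ of $$J''(t)=R(t)[J(t)],\qquad J(0)\in P,\qquad J'(0)+S[J(0)]\in P^\perp ,$$ and put $\mathbb J[t]=\{J(t):J\in\mathbb J\}$. An instant $t\in\,]0,1]$ is called *focal* if some nonzero $J\in\mathbb J$ has $J(t)=0$. For a symmetric bilinear form $B$ let $n_-(B)\in\mathbb N\cup\{\infty\}$ be the supremum of the dimensions of the subspaces on which $B$ is negative definite and let $n_+(B)=n_-(-B)$; put $\mathrm{sgn}(t)=n_+(g|_{\mathbb J[t]^\perp})-n_-(g|_{\mathbb J[t]^\perp})$. For $t\in\,]0,1]$ let $\mathcal H_t$ be the Hilbert space (with the $H^1$ inner product) of absolutely continuous $V:[0,t]\to\mathbb R^n$ with $V'\in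 L^2$, $V(0)\in P$, $V(t)=0$; let $\mathcal H=\mathcal H_1$ and let $\varphi_t:\mathcal H\to\mathcal H_t$ be $\varphi_t(\hat V)(s)=\hat V(s/t)$. Define $$I_t(V,W)=\int_0^t\big[g(V',W')+g(R(s)[V(s)],W(s))\big]\,ds-g(S[V(0)],W(0))\quad(V,W\in\mathcal H_t),$$ $$C_0(\hat V,\hat W)=\int_0^1 g(\hat V',\hat W')\,du\quad(\hat V,\hat W\in\mathcal H).$$ Let $\{\mathcal K_t\}_{t\in]0,1]}$ be an *admissible* family: each $\mathcal K_t$ is a closed subspace of $\mathcal H_t$ and, with $\hat{\mathcal K}_t=\varphi_t^{-1}(\mathcal K_t)$, 1. there is a closed subspace $\hat{\mathcal K}_0\subseteq\mathcal H$ such that $\{\hat{\mathcal K}_t\}_{t\in[0,1]}$ is a $C^1$-family: for every $t_0\in[0,1]$ there are $\varepsilon>0$, a $C^1$ curve $\alpha:\,]t_0-\varepsilon,t_0+\varepsilon[\,\cap[0,1]\to\mathcal L(\mathcal H)$ of isomorphisms and a fixed closed subspace $\overline{\mathcal D}\subseteq\mathcal H$ with $\alpha(t)(\hat{\mathcal K}_t)=\overline{\mathcal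 D}$ for all such $t$; 2. for every $t\in\,]0,1]$, $I_t|_{\mathcal K_t}$ is represented by the sum of a positive self-adjoint isomorphism and a compact self-adjoint operator of $\mathcal K_t$; 3. $C_0|_{\hat{\mathcal K}_0}$ is nondegenerate and is represented by the sum of a positive self-adjoint isomorphism and a compact self-adjoint operator of $\hat{\mathcal K}_0$; 4. for every $t\in\,]0,1]$, the kernel of $I_t|_{\mathcal K_t}$ equals the kernel of $I_t$ in $\mathcal H_t$. Assume that $g$ is nondegenerate on $\mathbb J[t]$ for every $t\in\,]0,1]$. Then there are only finitely many focal instants (so that $\mathrm{sgn}(t)=0$ for all but finitely many $t$), the indices below are finite, and $$n_-(I_1|_{\mathcal K_1})=n_-(C_0|_{\hat{\mathcal K}_0})+\sum_{t\in\,]0,1[}\mathrm{sgn}(t)-n_-(g|_{\mathbb J[1]^\perp}).$$ -/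

import Mathlib

open Set MeasureTheory

noncomputable section

/-! ### Index, signature, forms represented by compact perturbations, `C¹`-families -/

/-- The index `n₋(B)` of a bilinear form: the supremum of the dimensions of the subspaces on which
`B` is negative definite (`⊤` if these dimensions are unbounded). -/
def negIndex {V : Type*} [AddCommGroup V] [Module ℝ V] (B : LinearMap.BilinForm ℝ V) : ℕ∞ :=
  ⨆ (W : Submodule ℝ V) (_ : ∀ w ∈ W, w ≠ 0 → B w w < 0), Cardinal.toENat (Module.rank ℝ W)

/-- The positive type number `n₊(B) = n₋(-B)`. -/
def posIndex {V : Type*} [AddCommGroup V] [Module ℝ V] (B : LinearMap.BilinForm ℝ V) : ℕ∞ :=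
  negIndex (-B)

/-- The signature `n₊(B) - n₋(B)` of a bilinear form on a finite dimensional space (where both
numbers are finite). -/
def signature {V : Type*} [AddCommGroup V] [Module ℝ V] [FiniteDimensional ℝ V]
    (B : LinearMap.BilinForm ℝ V) : ℤ :=
  ((posIndex B).toNat : ℤ) - ((negIndex B).toNat : ℤ)

/-- `B` is represented, with respect to the inner product, by an operator `L + K` with `L` a
positive self-adjoint isomorphism and `K` a compact self-adjoint operator. -/
def IsCompactPerturbationOfPositive {X : Type*} [NormedAddCommGroup X] [InnerProductSpace ℝ X]
    (B : LinearMap.BilinForm ℝ X) : Prop :=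
  ∃ L K : X →L[ℝ] X, L.IsPositive ∧ L.IsInvertible ∧ K.IsSymmetric ∧ IsCompactOperator K ∧
    ∀ x y, B x y = inner ℝ ((L + K) x) y

/-- A `C¹`-family of closed subspaces `D t`, `t ∈ I`: locally in `I` there is a `C¹`-curve `α` of
isomorphisms of `X` with `α t (D t)` equal to a fixed closed subspace. -/
def IsC1Family {X : Type*} [NormedAddCommGroup X] [InnerProductSpace ℝ X]
    (I : Set ℝ) (D : ℝ → Submodule ℝ X) : Prop :=
  (∀ t ∈ I, IsClosed (D t : Set X)) ∧
  ∀ t₀ ∈ I, ∃ ε > 0, ∃ (α : ℝ → X →L[ℝ] X) (D' : Submodule ℝ X),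
    IsClosed (D' : Set X) ∧ ContDiffOn ℝ 1 α (Ioo (t₀ - ε) (t₀ + ε) ∩ I) ∧
    ∀ t ∈ Ioo (t₀ - ε) (t₀ + ε) ∩ I,
      (α t).IsInvertible ∧ (D t).map (α t : X →ₗ[ℝ] X) = D'

/-! ### The space `H¹_P([0,t], ℝⁿ)` -/

/-- `ℝⁿ`. -/
abbrev Rn (n : ℕ) : Type := EuclideanSpace ℝ (Fin n)

theorem ac_ae_differentiableAt {n : ℕ} {t : ℝ} {V : ℝ → Rn n}
    (hV : AbsolutelyContinuousOnInterval V 0 t) :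
    ∀ᵐ s ∂(volume.restrict (Icc 0 t)), DifferentiableAt ℝ V s := by
  rw [ae_restrict_iff' measurableSet_Icc]
  filter_upwards [hV.boundedVariationOn.ae_differentiableAt_of_mem_uIcc] with s hs h
  exact hs (Icc_subset_uIcc h)

theorem deriv_add_ae {n : ℕ} {t : ℝ} {V W : ℝ → Rn n}
    (hV : AbsolutelyContinuousOnInterval V 0 t) (hW : AbsolutelyContinuousOnInterval W 0 t) :
    deriv (V + W) =ᵐ[volume.restrict (Icc 0 t)] deriv V + deriv W := by
  filter_upwards [ac_ae_differentiableAt hV, ac_ae_differentiableAt hW] with s h1 h2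
  exact deriv_add h1 h2

/-- The vector space `H¹_P([0,t], ℝⁿ)` of absolutely continuous maps `V : [0,t] → ℝⁿ` with square
integrable derivative, `V 0 ∈ P` and `V t = 0`. A map defined on `[0,t]` is identified with its
extension by zero to `ℝ`. -/
def h1Submodule {n : ℕ} (P : Submodule ℝ (Rn n)) (t : ℝ) : Submodule ℝ (ℝ → Rn n) where
  carrier := {V | (∀ s ∉ Icc 0 t, V s = 0) ∧ AbsolutelyContinuousOnInterval V 0 t ∧
    MemLp (deriv V) 2 (volume.restrict (Icc 0 t)) ∧ V 0 ∈ P ∧ V t = 0}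
  zero_mem' := by
    refine ⟨fun _ _ => rfl, ?_, ?_, P.zero_mem, rfl⟩
    · exact (contDiff_const (c := (0 : Rn n))).contDiffOn.absolutelyContinuousOnInterval
    · have : deriv (0 : ℝ → Rn n) = 0 := by
        funext s; exact deriv_const s (0 : Rn n)
      rw [this]; exact MemLp.zero
  add_mem' := by
    rintro V W ⟨h1, h2, h3, h4, h5⟩ ⟨k1, k2, k3, k4, k5⟩
    refine ⟨fun s hs => ?_, h2.add k2, ?_, P.add_mem h4 k4, ?_⟩
    · simp [h1 s hs, k1 s hs]
    · exact (memLp_congr_ae (deriv_add_ae h2 k2)).2 (h3.add k3)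
    · simp [h5, k5]
  smul_mem' := by
    rintro c V ⟨h1, h2, h3, h4, h5⟩
    refine ⟨fun s hs => ?_, h2.const_smul c, ?_, P.smul_mem c h4, ?_⟩
    · simp [h1 s hs]
    · have : deriv (c • V) = c • deriv V := by
        funext s; exact deriv_const_smul_field c V
      rw [this]; exact h3.const_smul c
    · simp [h5]

/-- The space `H¹_P([0,t], ℝⁿ)`, kept as a separate type so that it carries the `H¹` topology and
not that of pointwise convergence. -/
def H1P {n : ℕ} (P : Submodule ℝ (Rn n)) (t : ℝ) : Type := h1Submodule P t

namespace H1P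

variable {n : ℕ} {P : Submodule ℝ (Rn n)} {t : ℝ}

instance : AddCommGroup (H1P P t) := inferInstanceAs (AddCommGroup (h1Submodule P t))

instance : Module ℝ (H1P P t) := inferInstanceAs (Module ℝ (h1Submodule P t))

/-- The underlying map. -/
def fn (V : H1P P t) : ℝ → Rn n := V.1

theorem fn_injective : Function.Injective (fn : H1P P t → ℝ → Rn n) := Subtype.val_injective

theorem fn_add (V W : H1P P t) : (V + W).fn = V.fn + W.fn := rfl

theorem fn_smul (c : ℝ) (V : H1P P t) : (c • V).fn = c • V.fn := rfl

theorem fn_zero : (0 : H1P P t).fn = 0 := rfl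

theorem fn_eq_zero (V : H1P P t) {s : ℝ} (hs : s ∉ Icc 0 t) : V.fn s = 0 := V.2.1 s hs

theorem ac (V : H1P P t) : AbsolutelyContinuousOnInterval V.fn 0 t := V.2.2.1

theorem memLp_deriv (V : H1P P t) : MemLp (deriv V.fn) 2 (volume.restrict (Icc 0 t)) := V.2.2.2.1

theorem fn_zero_mem (V : H1P P t) : V.fn 0 ∈ P := V.2.2.2.2.1

theorem fn_end (V : H1P P t) : V.fn t = 0 := V.2.2.2.2.2

theorem continuousOn (V : H1P P t) : ContinuousOn V.fn (Icc 0 t) :=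
  V.ac.continuousOn.mono Icc_subset_uIcc

theorem memLp_fn (V : H1P P t) : MemLp V.fn 2 (volume.restrict (Icc 0 t)) := by
  obtain ⟨C, hC⟩ := V.ac.exists_bound
  refine MemLp.of_bound (V.continuousOn.aestronglyMeasurable measurableSet_Icc) C ?_
  rw [ae_restrict_iff' measurableSet_Icc]
  exact Filter.Eventually.of_forall fun s hs => hC s (Icc_subset_uIcc hs)

theorem deriv_fn_add (V W : H1P P t) :
    deriv (V + W).fn =ᵐ[volume.restrict (Icc 0 t)] deriv V.fn + deriv W.fn :=
  deriv_add_ae V.ac W.ac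

theorem deriv_fn_smul (c : ℝ) (V : H1P P t) : deriv (c • V).fn = c • deriv V.fn := by
  funext s; exact deriv_const_smul_field c V.fn

theorem integrable_bilin (b : LinearMap.BilinForm ℝ (Rn n)) {u v : ℝ → Rn n} {μ : Measure ℝ}
    (hu : MemLp u 2 μ) (hv : MemLp v 2 μ) : Integrable (fun s => b (u s) (v s)) μ :=
  memLp_one_iff_integrable.1
    ((LinearMap.toContinuousBilinearMap b).memLp_of_bilin 1 hu hv)

theorem integrable_inner' {u v : ℝ → Rn n} {μ : Measure ℝ}
    (hu : MemLp u 2 μ) (hv : MemLp v 2 μ) : Integrable (fun s => (inner ℝ (u s) (v s) : ℝ)) μ :=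
  integrable_bilin (innerₗ (Rn n)) hu hv

/-- The `H¹` inner product `∫₀ᵗ ⟨V, W⟩ + ⟨V', W'⟩`. -/
abbrev innerCore (P : Submodule ℝ (Rn n)) (t : ℝ) : InnerProductSpace.Core ℝ (H1P P t) where
  inner V W := (∫ s in Icc 0 t, inner ℝ (V.fn s) (W.fn s)) +
    ∫ s in Icc 0 t, inner ℝ (deriv V.fn s) (deriv W.fn s)
  conj_inner_symm V W := by
    simp [real_inner_comm]
  re_inner_nonneg V := by
    have h1 : 0 ≤ ∫ s in Icc 0 t, inner ℝ (V.fn s) (V.fn s) :=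
      integral_nonneg fun s => real_inner_self_nonneg
    have h2 : 0 ≤ ∫ s in Icc 0 t, inner ℝ (deriv V.fn s) (deriv V.fn s) :=
      integral_nonneg fun s => real_inner_self_nonneg
    simpa using add_nonneg h1 h2
  add_left U V W := by
    have h1 : ∫ s in Icc 0 t, inner ℝ ((U + V).fn s) (W.fn s) =
        (∫ s in Icc 0 t, inner ℝ (U.fn s) (W.fn s)) +
          ∫ s in Icc 0 t, inner ℝ (V.fn s) (W.fn s) := by
      rw [← integral_add (integrable_inner' U.memLp_fn W.memLp_fn)
        (integrable_inner' V.memLp_fn W.memLp_fn)]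
      simp [fn_add, inner_add_left]
    have h2 : ∫ s in Icc 0 t, inner ℝ (deriv (U + V).fn s) (deriv W.fn s) =
        (∫ s in Icc 0 t, inner ℝ (deriv U.fn s) (deriv W.fn s)) +
          ∫ s in Icc 0 t, inner ℝ (deriv V.fn s) (deriv W.fn s) := by
      rw [← integral_add (integrable_inner' U.memLp_deriv W.memLp_deriv)
        (integrable_inner' V.memLp_deriv W.memLp_deriv)]
      refine integral_congr_ae ?_
      filter_upwards [deriv_fn_add U V] with s hs
      simp [hs, inner_add_left]
    rw [h1, h2]; ring
  smul_left V W c := by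
    simp [fn_smul, deriv_const_smul_field, inner_smul_left, integral_const_mul, mul_add]
  definite V hV := by
    have h1 : 0 ≤ ∫ s in Icc 0 t, inner ℝ (V.fn s) (V.fn s) :=
      integral_nonneg fun s => real_inner_self_nonneg
    have h2 : 0 ≤ ∫ s in Icc 0 t, inner ℝ (deriv V.fn s) (deriv V.fn s) :=
      integral_nonneg fun s => real_inner_self_nonneg
    have h3 : ∫ s in Icc 0 t, inner ℝ (V.fn s) (V.fn s) = 0 := by linarith
    apply fn_injective
    rw [fn_zero]
    have h4 := (integral_eq_zero_iff_of_nonneg (fun s => real_inner_self_nonneg)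
      (integrable_inner' V.memLp_fn V.memLp_fn)).1 h3
    have h5 : V.fn =ᵐ[volume.restrict (Icc 0 t)] fun _ => 0 := by
      filter_upwards [h4] with s hs
      exact inner_self_eq_zero.1 hs
    funext s
    by_cases hs : s ∈ Icc 0 t
    · rcases hs.1.trans hs.2 |>.eq_or_lt with h0 | h0
      · have : s = t := le_antisymm hs.2 (h0 ▸ hs.1)
        rw [this, V.fn_end]; rfl
      · exact Measure.eqOn_Icc_of_ae_eq volume h0.ne h5 V.continuousOn continuousOn_const hs
    · exact V.fn_eq_zero hs

instance : NormedAddCommGroup (H1P P t) := (innerCore P t).toNormedAddCommGroup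

instance : InnerProductSpace ℝ (H1P P t) :=
  InnerProductSpace.ofCore (innerCore P t).toCore

theorem inner_def (V W : H1P P t) : inner ℝ V W = (∫ s in Icc 0 t, inner ℝ (V.fn s) (W.fn s)) +
    ∫ s in Icc 0 t, inner ℝ (deriv V.fn s) (deriv W.fn s) := rfl

/-- If `V̂ ∈ H¹_P([0,1], ℝⁿ)` and `t > 0`, then `s ↦ V̂ (s / t)` belongs to `H¹_P([0,t], ℝⁿ)`. -/
theorem rescale_mem {f : ℝ → Rn n} (hf : f ∈ h1Submodule P 1) (ht : 0 < t) :
    (fun s => f (s / t)) ∈ h1Submodule P t := by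
  obtain ⟨h1, h2, h3, h4, h5⟩ := hf
  refine ⟨fun s hs => h1 _ ?_, ?_, ?_, by simpa using h4, by simpa [ht.ne'] using h5⟩
  · contrapose! hs
    rw [mem_Icc, div_le_one ht] at hs
    exact ⟨by simpa [ht.ne'] using mul_nonneg hs.1 ht.le, hs.2⟩
  · rw [absolutelyContinuousOnInterval_iff] at h2 ⊢
    intro ε hε
    obtain ⟨δ, hδ, h⟩ := h2 ε hε
    refine ⟨δ * t, mul_pos hδ ht, fun E hE hlt => ?_⟩
    refine h (E.1, fun i => ((E.2 i).1 / t, (E.2 i).2 / t)) ⟨fun i hi => ?_, ?_⟩ ?_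
    · have key (x : ℝ) (hx : x ∈ uIcc 0 t) : x / t ∈ uIcc (0 : ℝ) 1 := by
        rw [uIcc_of_le ht.le] at hx
        rw [uIcc_of_le zero_le_one]
        exact ⟨div_nonneg hx.1 ht.le, (div_le_one ht).2 hx.2⟩
      exact ⟨key _ (hE.1 i hi).1, key _ (hE.1 i hi).2⟩
    · intro i hi j hj hij
      have := hE.2 hi hj hij
      simp only [Function.onFun] at this ⊢
      rw [Set.disjoint_left] at this ⊢
      intro x hx hx'
      have key (a b : ℝ) (h : x ∈ uIoc (a / t) (b / t)) : x * t ∈ uIoc a b := by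
        rw [mem_uIoc] at h ⊢
        rwa [div_lt_iff₀ ht, le_div_iff₀ ht, div_lt_iff₀ ht, le_div_iff₀ ht] at h
      exact this (key _ _ hx) (key _ _ hx')
    · have : ∀ a b : ℝ, dist (a / t) (b / t) = dist a b / t := fun a b => by
        rw [Real.dist_eq, Real.dist_eq, ← sub_div, abs_div, abs_of_pos ht]
      simp only [this]
      rw [← Finset.sum_div, div_lt_iff₀ ht]
      exact hlt
  · have hd : deriv (fun s => f (s / t)) = fun s => t⁻¹ • deriv f (t⁻¹ * s) := by
      funext s
      rw [← deriv_comp_mul_left]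
      congr 1
      funext r
      rw [div_eq_inv_mul]
    have hm : AEStronglyMeasurable (deriv f) (volume.restrict (Icc 0 1)) := h3.1
    rw [memLp_two_iff_integrable_sq_norm hm] at h3
    rw [memLp_two_iff_integrable_sq_norm (aestronglyMeasurable_deriv _ _), hd]
    have h6 : IntervalIntegrable (fun s => ‖deriv f s‖ ^ 2) volume 0 1 := by
      rw [intervalIntegrable_iff_integrableOn_Icc_of_le zero_le_one]; exact h3
    have h7 := h6.comp_mul_left (c := t⁻¹)
    simp only [zero_mul, div_inv_eq_mul, one_mul] at h7
    rw [intervalIntegrable_iff_integrableOn_Icc_of_le ht.le] at h7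
    have h8 := h7.const_mul (t⁻¹ ^ 2)
    refine h8.congr (Filter.Eventually.of_forall fun s => ?_)
    simp [norm_smul, mul_pow]

/-- The map `φ_t : H¹_P([0,1], ℝⁿ) → H¹_P([0,t], ℝⁿ)`, `φ_t V̂ s = V̂ (s / t)`. -/
def phi (P : Submodule ℝ (Rn n)) (t : Ioc (0 : ℝ) 1) : H1P P 1 →ₗ[ℝ] H1P P t where
  toFun V := ⟨fun s => V.fn (s / t), rescale_mem V.2 t.2.1⟩
  map_add' _ _ := rfl
  map_smul' _ _ := rfl

end H1P

/-! ### Morse--Sturm data -/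

/-- The data `(g, R, P, S)` of a Morse--Sturm problem `J'' = R J`, `J 0 ∈ P`,
`J' 0 + S (J 0) ∈ P^⊥` on `[0,1]`. -/
structure MorseSturmData (n : ℕ) where
  /-- A nondegenerate symmetric bilinear form on `ℝⁿ`. -/
  g : LinearMap.BilinForm ℝ (Rn n)
  g_symm : ∀ x y, g x y = g y x
  g_nondeg : g.Nondegenerate
  /-- A continuous curve of `g`-symmetric operators; only its values on `[0,1]` matter. -/
  R : ℝ → Rn n →L[ℝ] Rn n
  R_cont : ContinuousOn R (Icc 0 1)
  R_symm : ∀ t ∈ Icc (0 : ℝ) 1, ∀ x y, g (R t x) y = g x (R t y)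
  /-- A subspace on which `g` is nondegenerate. -/
  P : Submodule ℝ (Rn n)
  P_nondeg : (g.restrict P).Nondegenerate
  /-- A `g`-symmetric endomorphism of `P`. -/
  S : P →ₗ[ℝ] P
  S_symm : ∀ x y : P, g (S x) y = g x (S y)

namespace MorseSturmData

variable {n : ℕ} (D : MorseSturmData n)

/-- `J` is (on `[0,1]`) a `(P,S)`-solution, with derivative `J'`. -/
def IsSolution (J J' : ℝ → Rn n) : Prop :=
  (∀ t ∈ Icc (0 : ℝ) 1, HasDerivWithinAt J (J' t) (Icc 0 1) t) ∧
  (∀ t ∈ Icc (0 : ℝ) 1, HasDerivWithinAt J' (D.R t (J t)) (Icc 0 1) t) ∧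
  ∃ h : J 0 ∈ D.P, J' 0 + D.S ⟨J 0, h⟩ ∈ D.g.orthogonal D.P

/-- `𝕁[t]`, the space of the values at `t` of the `(P,S)`-solutions. -/
def jSpace (t : ℝ) : Submodule ℝ (Rn n) where
  carrier := {x | ∃ J J', D.IsSolution J J' ∧ J t = x}
  zero_mem' := by
    refine ⟨0, 0, ⟨fun t _ => ?_, fun t _ => ?_, D.P.zero_mem, ?_⟩, rfl⟩
    · exact hasDerivWithinAt_const t _ (0 : Rn n)
    · simp only [Pi.zero_apply, map_zero]
      exact hasDerivWithinAt_const t _ (0 : Rn n)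
    · have : (⟨(0 : ℝ → Rn n) 0, D.P.zero_mem⟩ : D.P) = 0 := rfl
      rw [this]; simp
  add_mem' := by
    rintro _ _ ⟨J, J', ⟨h1, h2, h3, h4⟩, rfl⟩ ⟨K, K', ⟨k1, k2, k3, k4⟩, rfl⟩
    refine ⟨J + K, J' + K', ⟨fun t ht => (h1 t ht).add (k1 t ht), fun t ht => ?_,
      D.P.add_mem h3 k3, ?_⟩, rfl⟩
    · simpa using (h2 t ht).add (k2 t ht)
    · have : (⟨(J + K) 0, D.P.add_mem h3 k3⟩ : D.P) = ⟨J 0, h3⟩ + ⟨K 0, k3⟩ := rfl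
      rw [this, map_add]
      have := Submodule.add_mem _ h4 k4
      convert this using 1
      simp only [Pi.add_apply, Submodule.coe_add]; abel
  smul_mem' := by
    rintro c _ ⟨J, J', ⟨h1, h2, h3, h4⟩, rfl⟩
    refine ⟨c • J, c • J', ⟨fun t ht => (h1 t ht).const_smul c, fun t ht => ?_,
      D.P.smul_mem c h3, ?_⟩, rfl⟩
    · simpa using (h2 t ht).const_smul c
    · have : (⟨(c • J) 0, D.P.smul_mem c h3⟩ : D.P) = c • ⟨J 0, h3⟩ := rfl
      rw [this, map_smul]
      have := Submodule.smul_mem _ c h4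
      convert this using 1
      simp

/-- `𝕁[t]^⊥`, the orthogonal of `𝕁[t]` with respect to `g`. -/
def jPerp (t : ℝ) : Submodule ℝ (Rn n) := D.g.orthogonal (D.jSpace t)

/-- `t` is a `(P,S)`-focal instant: `J t = 0` for some nonzero `(P,S)`-solution `J`. -/
def IsFocal (t : ℝ) : Prop :=
  t ∈ Ioc (0 : ℝ) 1 ∧ ∃ J J', D.IsSolution J J' ∧ (∃ s ∈ Icc (0 : ℝ) 1, J s ≠ 0) ∧ J t = 0

/-- The signature `sgn(t)`: the signature of the restriction of `g` to `𝕁[t]^⊥`. -/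
def sgn (t : ℝ) : ℤ := signature (D.g.restrict (D.jPerp t))

/-! ### The index forms -/

/-- The Hilbert space `𝓗_t = H¹_P([0,t], ℝⁿ)`. -/
abbrev Hs (t : ℝ) : Type := H1P D.P t

theorem integrable_kinetic {t : ℝ} (V W : D.Hs t) :
    IntegrableOn (fun s => D.g (deriv V.fn s) (deriv W.fn s)) (Icc 0 t) :=
  H1P.integrable_bilin D.g V.memLp_deriv W.memLp_deriv

theorem memLp_R {t : ℝ} (ht : t ≤ 1) (V : D.Hs t) :
    MemLp (fun s => D.R s (V.fn s)) 2 (volume.restrict (Icc 0 t)) := by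
  have hc : ContinuousOn (fun s => D.R s (V.fn s)) (Icc 0 t) :=
    (D.R_cont.mono (Icc_subset_Icc_right ht)).clm_apply V.continuousOn
  obtain ⟨C, hC⟩ := isCompact_Icc.exists_bound_of_continuousOn hc
  refine MemLp.of_bound (hc.aestronglyMeasurable measurableSet_Icc) C ?_
  rw [ae_restrict_iff' measurableSet_Icc]
  exact Filter.Eventually.of_forall hC

theorem integrable_potential {t : ℝ} (ht : t ≤ 1) (V W : D.Hs t) :
    IntegrableOn (fun s => D.g (D.R s (V.fn s)) (W.fn s)) (Icc 0 t) :=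
  H1P.integrable_bilin D.g (D.memLp_R ht V) W.memLp_fn

/-- The bilinear form `∫₀ᵗ g(V', W')` on `𝓗_t`. -/
def kinetic (t : ℝ) : LinearMap.BilinForm ℝ (D.Hs t) :=
  LinearMap.mk₂ ℝ (fun V W => ∫ s in Icc 0 t, D.g (deriv V.fn s) (deriv W.fn s))
    (fun U V W => by
      rw [← integral_add (D.integrable_kinetic U W) (D.integrable_kinetic V W)]
      refine integral_congr_ae ?_
      filter_upwards [H1P.deriv_fn_add U V] with s hs
      simp [hs])
    (fun c V W => by
      rw [smul_eq_mul, ← integral_const_mul]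
      simp [H1P.deriv_fn_smul])
    (fun V U W => by
      rw [← integral_add (D.integrable_kinetic V U) (D.integrable_kinetic V W)]
      refine integral_congr_ae ?_
      filter_upwards [H1P.deriv_fn_add U W] with s hs
      simp [hs])
    (fun c V W => by
      rw [smul_eq_mul, ← integral_const_mul]
      simp [H1P.deriv_fn_smul])

/-- The bilinear form `∫₀ᵗ g(R V, W)` on `𝓗_t`. -/
def potential (t : ℝ) (ht : t ≤ 1) : LinearMap.BilinForm ℝ (D.Hs t) :=
  LinearMap.mk₂ ℝ (fun V W => ∫ s in Icc 0 t, D.g (D.R s (V.fn s)) (W.fn s))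
    (fun U V W => by
      rw [← integral_add (D.integrable_potential ht U W) (D.integrable_potential ht V W)]
      simp [H1P.fn_add])
    (fun c V W => by
      rw [smul_eq_mul, ← integral_const_mul]
      simp [H1P.fn_smul])
    (fun V U W => by
      rw [← integral_add (D.integrable_potential ht V U) (D.integrable_potential ht V W)]
      simp [H1P.fn_add])
    (fun c V W => by
      rw [smul_eq_mul, ← integral_const_mul]
      simp [H1P.fn_smul])

/-- The initial value `V 0 ∈ P` of `V ∈ 𝓗_t`. -/
def initial (t : ℝ) : D.Hs t →ₗ[ℝ] D.P where
  toFun V := ⟨V.fn 0, V.fn_zero_mem⟩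
  map_add' _ _ := rfl
  map_smul' _ _ := rfl

/-- The bilinear form `g(S (V 0), W 0)` on `𝓗_t`. -/
def boundary (t : ℝ) : LinearMap.BilinForm ℝ (D.Hs t) :=
  (D.g.restrict D.P).comp (D.S ∘ₗ D.initial t) (D.initial t)

/-- The index form `I_t` on `𝓗_t`. -/
def indexForm (t : Ioc (0 : ℝ) 1) : LinearMap.BilinForm ℝ (D.Hs t) :=
  D.kinetic t + D.potential t t.2.2 - D.boundary t

theorem indexForm_apply (t : Ioc (0 : ℝ) 1) (V W : D.Hs t) :
    D.indexForm t V W =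
      (∫ s in (0 : ℝ)..t, (D.g (deriv V.fn s) (deriv W.fn s) + D.g (D.R s (V.fn s)) (W.fn s))) -
        D.g (D.S ⟨V.fn 0, V.fn_zero_mem⟩) (W.fn 0) := by
  rw [intervalIntegral.integral_of_le t.2.1.le, ← integral_Icc_eq_integral_Ioc,
    integral_add (D.integrable_kinetic V W) (D.integrable_potential t.2.2 V W)]
  rfl

/-- The form `C₀(V̂, Ŵ) = ∫₀¹ g(V̂', Ŵ')` on `𝓗 = 𝓗_1`. -/
def C0 : LinearMap.BilinForm ℝ (D.Hs 1) := D.kinetic 1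

/-! ### Admissible families -/

/-- The family `K̂_t = φ_t⁻¹(K_t)`, `t ∈ ]0,1]`, extended by `K̂_0` at `t = 0`. -/
def hatFamily (K : ∀ t : Ioc (0 : ℝ) 1, Submodule ℝ (D.Hs t)) (K0 : Submodule ℝ (D.Hs 1))
    (t : ℝ) : Submodule ℝ (D.Hs 1) :=
  open Classical in
  if h : t ∈ Ioc (0 : ℝ) 1 then (K ⟨t, h⟩).comap (H1P.phi D.P ⟨t, h⟩) else K0

/-- `K_t ⊆ 𝓗_t`, `t ∈ ]0,1]`, is an admissible family of closed subspaces for the Morse--Sturm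
problem, with extension `K̂_0` of the family `K̂_t` to `t = 0`. -/
structure IsAdmissible (K : ∀ t : Ioc (0 : ℝ) 1, Submodule ℝ (D.Hs t))
    (K0 : Submodule ℝ (D.Hs 1)) : Prop where
  isClosed : ∀ t : Ioc (0 : ℝ) 1, IsClosed (K t : Set (D.Hs t))
  isC1Family : IsC1Family (Icc 0 1) (D.hatFamily K K0)
  compactPerturbation : ∀ t : Ioc (0 : ℝ) 1,
    IsCompactPerturbationOfPositive ((D.indexForm t).restrict (K t))
  C0_nondegenerate : (D.C0.restrict K0).Nondegenerate
  C0_compactPerturbation : IsCompactPerturbationOfPositive (D.C0.restrict K0)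
  /-- The kernel of `I_t` on `K_t` is the kernel of `I_t` on `𝓗_t`. -/
  kernel_eq : ∀ t : Ioc (0 : ℝ) 1,
    (LinearMap.ker ((D.indexForm t).restrict (K t))).map (K t).subtype =
    LinearMap.ker (D.indexForm t)

end MorseSturmData

end

/-!
The proof follows the index of one form on one Hilbert space as the right end point `t` varies.
Through `φ_t` the form `t I_t` becomes a bounded form `C t` on `𝓗 = 𝓗_1`,
`C t (V, W) = ∫₀¹ g(V', W') + t² ∫₀¹ g(R (t u) V, W) - t g(S (V 0), W 0)`,
which makes sense for `t = 0`, where it is `C₀`, and is differentiable in `t` for the operator norm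
(`hasDerivAt_rescaledForm`; `R` is first replaced by a `C¹` extension to `ℝ`). The theorem is thus a
statement on the index `f t` of `C t` on `K̂_t`, a `C¹`-family of subspaces.

**Jumps.** The abstract result is `exists_index_jump`. Suppose that `C t₀`, restricted to `K̂_{t₀}`,
splits into a finite dimensional coercive negative part, a finite dimensional kernel `N` and a
coercive positive part; that `N` lies in the kernel of `C t₀` on the whole space; and that the
derivative `C'` of `C` at `t₀` is nondegenerate on `N`. A first order expansion then shows that, to
the right of `t₀`, the form `C t` is negative on a space of dimension `f t₀ + n₋(C'|N)` and positive
on a complement, and the same with `n₊(C'|N)` to the left. Hence the index jumps by these amounts,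
and `C t` is nondegenerate on `K̂_t` for `t ≠ t₀` near `t₀`. Moving the subspaces by the
isomorphisms of the `C¹`-family does not change the derivative on `N`, because `N` is in the full
kernel.

**Identification of the jump.** By the lemma of du Bois-Reymond, the kernel of `C t` on `𝓗` consists
of the curves `u ↦ J (t u)`, with `J` a `(P,S)`-solution such that `J t = 0`
(`exists_isSolution_of_mem_ker`). As the initial conditions are Lagrangian, `𝕁[t]^⊥` is the space of
the derivatives `J' t` of these solutions (`mem_jPerp_iff`). Conservation of energy, up to the term
in `R'`, gives `C' (V, W) = -t g(J' t, K' t)` on the kernel (`rescaledFormDeriv_eq`). Therefore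
`n₋(C'|N) = n₊(g|𝕁[t]^⊥)` and `n₊(C'|N) = n₋(g|𝕁[t]^⊥)`, and nondegeneracy of `g` on `𝕁[t]` is what
the abstract result requires.

**Conclusion.** At `t = 0` the kernel is trivial and there is no jump. Focal instants do not
accumulate in `[0,1]`, hence are finite in number, and `f` is obtained from `f 0` by adding the
jumps (`eq_add_finsum_jumps`); at `t = 1` only the jump from the left, `n₋(g|𝕁[1]^⊥)`, counts.
-/

noncomputable section

/-! ### Negative index and splittings of bilinear forms -/

section Algebra

variable {V : Type*} [AddCommGroup V] [Module ℝ V]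

theorem LinearMap.BilinForm.apply_add_self {B : LinearMap.BilinForm ℝ V} (h : ∀ x y, B x y = B y x)
    (x y : V) : B (x + y) (x + y) = B x x + 2 * B x y + B y y := by
  simp only [map_add, LinearMap.add_apply]
  rw [h y x]; ring

/-- If `K = A + Y` with `B` negative definite on the finite dimensional space `A` and positive
semidefinite on `Y`, then `n₋(B|_K) = dim A`. -/
theorem negIndex_restrict_eq_finrank {B : LinearMap.BilinForm ℝ V} {K A Y : Submodule ℝ V}
    [FiniteDimensional ℝ A] (hA : ∀ a ∈ A, a ≠ 0 → B a a < 0) (hY : ∀ y ∈ Y, 0 ≤ B y y)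
    (h : A ⊔ Y = K) : negIndex (B.restrict K) = (Module.finrank ℝ A : ℕ∞) := by
  have hAK : A ≤ K := h ▸ le_sup_left
  have hYK : Y ≤ K := h ▸ le_sup_right
  apply le_antisymm
  · refine iSup₂_le fun W hW => ?_
    set Y' : Submodule ℝ K := Y.comap K.subtype
    have hdisj : Disjoint W Y' := by
      rw [Submodule.disjoint_def]
      intro w hw hy
      by_contra h0
      have h1 := hW w hw h0
      have h2 := hY w hy
      rw [LinearMap.BilinForm.restrict_apply] at h1
      simp only [LinearMap.domRestrict_apply] at h1
      linarith
    -- `W` embeds into `K ⧸ Y`, onto which `A` projects surjectively.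
    have hinj : Function.Injective (Y'.mkQ ∘ₗ W.subtype) := by
      rw [← LinearMap.ker_eq_bot, LinearMap.ker_comp, Submodule.ker_mkQ]
      rw [eq_bot_iff]
      intro w hw
      exact (Submodule.mem_bot ℝ).2 (Subtype.ext ((Submodule.disjoint_def.1 hdisj) w w.2 hw))
    have hsurj : Function.Surjective (Y'.mkQ ∘ₗ Submodule.inclusion hAK) := by
      intro q
      obtain ⟨x, rfl⟩ := Y'.mkQ_surjective q
      obtain ⟨a, ha, y, hy, hxy⟩ := Submodule.mem_sup.1 (h.symm ▸ x.2 : (x : V) ∈ A ⊔ Y)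
      refine ⟨⟨a, ha⟩, ?_⟩
      simp only [LinearMap.comp_apply, Submodule.mkQ_apply]
      rw [Submodule.Quotient.eq]
      change a - (x : V) ∈ Y
      rw [← hxy]; simpa using hy
    have h3 := LinearMap.rank_le_of_injective _ hinj
    have h4 := LinearMap.rank_le_of_surjective _ hsurj
    refine (Cardinal.toENat.monotone' (h3.trans h4)).trans_eq ?_
    rw [← Module.finrank_eq_rank ℝ A]
    exact Cardinal.toENat_nat _
  · have h1 : ∀ w ∈ A.comap K.subtype, w ≠ 0 → (B.restrict K) w w < 0 := by
      intro w hw h0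
      exact hA w hw (by simpa using h0)
    refine le_trans (le_of_eq ?_) (le_iSup₂_of_le _ h1 le_rfl)
    have e := (Submodule.comapSubtypeEquivOfLe hAK).rank_eq
    rw [e, ← Module.finrank_eq_rank ℝ A]
    simp

theorem negIndex_le_of_injective {V' : Type*} [AddCommGroup V'] [Module ℝ V']
    {B : LinearMap.BilinForm ℝ V} {B' : LinearMap.BilinForm ℝ V'} (e : V →ₗ[ℝ] V')
    (he : Function.Injective e) {c : ℝ} (hc : 0 < c) (h : ∀ x, B' (e x) (e x) = c * B x x) :
    negIndex B ≤ negIndex B' := by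
  refine iSup₂_le fun W hW => le_iSup₂_of_le (W.map e) ?_ ?_
  · rintro _ ⟨w, hw, rfl⟩ h0
    rw [h]
    exact mul_neg_of_pos_of_neg hc (hW w hw (by rintro rfl; exact h0 (map_zero _)))
  · have := (Submodule.equivMapOfInjective e he W).lift_rank_eq
    have h2 := congrArg Cardinal.toENat this
    simpa using h2.le

/-- The index is invariant under linear isomorphisms and positive rescaling. -/
theorem negIndex_eq_of_linearEquiv {V' : Type*} [AddCommGroup V'] [Module ℝ V']
    {B : LinearMap.BilinForm ℝ V} {B' : LinearMap.BilinForm ℝ V'} (e : V ≃ₗ[ℝ] V')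
    {c : ℝ} (hc : 0 < c) (h : ∀ x, B' (e x) (e x) = c * B x x) : negIndex B = negIndex B' := by
  apply le_antisymm
  · exact negIndex_le_of_injective (e : V →ₗ[ℝ] V') e.injective hc h
  · refine negIndex_le_of_injective (c := c⁻¹) (e.symm : V' →ₗ[ℝ] V) e.symm.injective
      (inv_pos.2 hc) fun x => ?_
    have := h (e.symm x)
    rw [e.apply_symm_apply] at this
    rw [this]
    simp only [LinearEquiv.coe_coe]
    field_simp

/-- Sylvester's law of inertia in the form of a splitting: a symmetric bilinear form on a finite
dimensional space has complementary negative definite, null and positive definite parts. -/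
theorem exists_sylvester_splitting [FiniteDimensional ℝ V] (B : LinearMap.BilinForm ℝ V)
    (hB : ∀ x y, B x y = B y x) :
    ∃ A C : Submodule ℝ V, (∀ x ∈ A, x ≠ 0 → B x x < 0) ∧ (∀ x ∈ C, x ≠ 0 → 0 < B x x) ∧
      A ⊔ LinearMap.ker B ⊔ C = ⊤ := by
  obtain ⟨w, ⟨f⟩⟩ := QuadraticForm.equivalent_signType_weighted_sum_squared B.toQuadraticMap
  have hf : ∀ x, B x x = ∑ i, (w i : ℝ) * (f x i * f x i) := fun x => by
    have := f.map_app x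
    rw [QuadraticMap.weightedSumSquares_apply] at this
    simpa using this.symm
  have hf2 : ∀ x y, B x y = ∑ i, (w i : ℝ) * (f x i * f y i) := fun x y => by
    have h1 := LinearMap.BilinForm.apply_add_self hB x y
    have e : f (x + y) = f x + f y := map_add f.toLinearEquiv x y
    rw [hf (x + y), hf x, hf y, e] at h1
    have h2 : ∑ i, (w i : ℝ) * ((f x + f y) i * (f x + f y) i) =
        ∑ i, (w i : ℝ) * (f x i * f x i) + 2 * ∑ i, (w i : ℝ) * (f x i * f y i) +
          ∑ i, (w i : ℝ) * (f y i * f y i) := by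
      rw [Finset.mul_sum, ← Finset.sum_add_distrib, ← Finset.sum_add_distrib]
      refine Finset.sum_congr rfl fun i _ => ?_
      simp only [Pi.add_apply]; ring
    linarith
  -- `E s` is spanned by the diagonal directions of sign `s`.
  let E : SignType → Submodule ℝ V := fun s =>
    { carrier := {x | ∀ i, w i ≠ s → f x i = 0}
      zero_mem' := fun i _ => congrFun (map_zero f.toLinearEquiv) i
      add_mem' := fun {x y} hx hy i hi => by
        have e : f (x + y) = f x + f y := map_add f.toLinearEquiv x y
        rw [e, Pi.add_apply, hx i hi, hy i hi, add_zero]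
      smul_mem' := fun c x hx i hi => by
        have e : f (c • x) = c • f x := map_smul f.toLinearEquiv c x
        rw [e, Pi.smul_apply, hx i hi, smul_zero] }
  have hE : ∀ s, ∀ x ∈ E s, B x x = (s : ℝ) * ∑ i, f x i * f x i := fun s x hx => by
    rw [hf, Finset.mul_sum]
    refine Finset.sum_congr rfl fun i _ => ?_
    by_cases h : w i = s
    · rw [h]
    · rw [hx i h]; ring
  have hpos : ∀ x, x ≠ 0 → 0 < ∑ i, f x i * f x i := fun x hx => by
    have h0 : f x ≠ 0 := fun h => hx (f.toLinearEquiv.injective (h.trans (map_zero _).symm))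
    obtain ⟨i, hi⟩ := Function.ne_iff.1 h0
    exact Finset.sum_pos' (fun i _ => mul_self_nonneg _) ⟨i, Finset.mem_univ i,
      mul_self_pos.2 hi⟩
  have hz : E 0 ≤ LinearMap.ker B := fun x hx => by
    rw [LinearMap.mem_ker]
    ext y
    rw [hf2, LinearMap.zero_apply]
    refine Finset.sum_eq_zero fun i _ => ?_
    by_cases h : w i = 0
    · rw [h]; simp
    · rw [hx i h]; ring
  refine ⟨E (-1), E 1, fun x hx h0 => ?_, fun x hx h0 => ?_, ?_⟩
  · rw [hE _ x hx]; simpa using hpos x h0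
  · rw [hE _ x hx]; simpa using hpos x h0
  · rw [eq_top_iff]
    intro x _
    let p : SignType → V := fun s => f.toLinearEquiv.symm fun i => if w i = s then f x i else 0
    have hp : ∀ s, p s ∈ E s := fun s i hi => by
      change f.toLinearEquiv (f.toLinearEquiv.symm _) i = 0
      rw [LinearEquiv.apply_symm_apply, if_neg hi]
    have hx : x = p (-1) + p 0 + p 1 := by
      apply f.toLinearEquiv.injective
      simp only [p, map_add, LinearEquiv.apply_symm_apply]
      ext i
      change f x i = _
      simp only [Pi.add_apply]
      cases h : w i <;> simp
    rw [hx]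
    exact Submodule.add_mem_sup (Submodule.add_mem_sup (hp _) (hz (hp _))) (hp _)

end Algebra

section Coercive

variable {X : Type*} [NormedAddCommGroup X] [NormedSpace ℝ X]

/-- A continuous form which is positive definite on a finite dimensional subspace is coercive
there, by compactness of the unit sphere. -/
theorem exists_coercive_of_finiteDimensional (B : X →L[ℝ] X →L[ℝ] ℝ) (A : Submodule ℝ X)
    [FiniteDimensional ℝ A] (hA : ∀ x ∈ A, x ≠ 0 → 0 < B x x) :
    ∃ c > 0, ∀ x ∈ A, c * ‖x‖ ^ 2 ≤ B x x := by
  by_cases hne : (Metric.sphere (0 : A) 1).Nonempty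
  · have hc : IsCompact (Metric.sphere (0 : A) 1) := isCompact_sphere _ _
    obtain ⟨x, hx, hmin⟩ := hc.exists_isMinOn hne (f := fun x : A => B x x)
      (by fun_prop)
    have hx1 : ‖x‖ = 1 := by simpa using hx
    refine ⟨B x x, hA x x.2 (fun h => ?_), fun y hy => ?_⟩
    · have : x = 0 := by simpa using h
      simp [this] at hx1
    · by_cases hy0 : y = 0
      · simp [hy0]
      have hy1 : ‖y‖ ≠ 0 := norm_ne_zero_iff.2 hy0
      have := isMinOn_iff.1 hmin (‖y‖⁻¹ • (⟨y, hy⟩ : A)) (by simp [norm_smul, hy1])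
      simp only [Submodule.coe_smul, map_smul, smul_apply, smul_eq_mul] at this
      have h2 := mul_le_mul_of_nonneg_right this (sq_nonneg ‖y‖)
      refine h2.trans (le_of_eq ?_)
      field_simp
  · refine ⟨1, one_pos, fun y hy => ?_⟩
    by_cases hy0 : y = 0
    · simp [hy0]
    have hy1 : ‖y‖ ≠ 0 := norm_ne_zero_iff.2 hy0
    exact absurd ⟨‖y‖⁻¹ • (⟨y, hy⟩ : A), by simp [norm_smul, hy1]⟩ hne

end Coercive

/-! ### Splittings of compact perturbations of positive isomorphisms -/

/-- A Morse splitting of a form: the space is the sum of a finite dimensional subspace on which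
the form is negative and coercive, of its kernel, which is finite dimensional, and of a subspace on
which the form is positive and coercive. -/
def HasMorseSplitting {X : Type*} [NormedAddCommGroup X] [NormedSpace ℝ X]
    (B : LinearMap.BilinForm ℝ X) : Prop :=
  ∃ A C : Submodule ℝ X, ∃ c > 0, FiniteDimensional ℝ A ∧ FiniteDimensional ℝ (LinearMap.ker B) ∧
    (∀ x ∈ A, B x x ≤ -(c * ‖x‖ ^ 2)) ∧ (∀ x ∈ C, c * ‖x‖ ^ 2 ≤ B x x) ∧
    A ⊔ LinearMap.ker B ⊔ C = ⊤

/-- A Morse splitting is carried along by a bounded surjective linear map which multiplies the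
form by a positive constant. -/
theorem HasMorseSplitting.of_surjective {X Y : Type*} [NormedAddCommGroup X] [NormedSpace ℝ X]
    [NormedAddCommGroup Y] [NormedSpace ℝ Y] {B : LinearMap.BilinForm ℝ X}
    {B' : LinearMap.BilinForm ℝ Y} (hB : HasMorseSplitting B) (e : X →ₗ[ℝ] Y)
    (he : Function.Surjective e) {M : ℝ} (hM : ∀ x, ‖e x‖ ≤ M * ‖x‖) {r : ℝ} (hr : 0 < r)
    (h : ∀ x y, B' (e x) (e y) = r * B x y) : HasMorseSplitting B' := by
  obtain ⟨A, C, c, hc, hA, hN, hAc, hCc, htop⟩ := hB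
  have hker : LinearMap.ker B' = (LinearMap.ker B).map e := by
    ext y
    constructor
    · intro hy
      obtain ⟨x, rfl⟩ := he y
      refine ⟨x, ?_, rfl⟩
      rw [SetLike.mem_coe, LinearMap.mem_ker]
      ext z
      have := LinearMap.congr_fun (LinearMap.mem_ker.1 hy) (e z)
      rw [h, LinearMap.zero_apply] at this
      simpa [hr.ne'] using this
    · rintro ⟨x, hx, rfl⟩
      rw [LinearMap.mem_ker]
      ext y
      obtain ⟨z, rfl⟩ := he y
      rw [h, LinearMap.mem_ker.1 hx]; simp
  -- the constant `c r / M²`, with `M` replaced by `|M| + 1` to have it nonzero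
  have hM1 : 0 < |M| + 1 := by positivity
  have hbd : ∀ x, r * c / (|M| + 1) ^ 2 * ‖e x‖ ^ 2 ≤ r * (c * ‖x‖ ^ 2) := fun x => by
    have h1 : ‖e x‖ ≤ (|M| + 1) * ‖x‖ :=
      (hM x).trans (mul_le_mul_of_nonneg_right (by linarith [le_abs_self M]) (norm_nonneg _))
    have h2 : ‖e x‖ ^ 2 ≤ ((|M| + 1) * ‖x‖) ^ 2 := by gcongr
    calc r * c / (|M| + 1) ^ 2 * ‖e x‖ ^ 2 ≤ r * c / (|M| + 1) ^ 2 * ((|M| + 1) * ‖x‖) ^ 2 := by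
          gcongr
      _ = r * (c * ‖x‖ ^ 2) := by field_simp
  refine ⟨A.map e, C.map e, r * c / (|M| + 1) ^ 2, by positivity, inferInstance, ?_, ?_, ?_, ?_⟩
  · rw [hker]; infer_instance
  · rintro _ ⟨x, hx, rfl⟩
    rw [h]
    have := mul_le_mul_of_nonneg_left (hAc x hx) hr.le
    linarith [hbd x]
  · rintro _ ⟨x, hx, rfl⟩
    rw [h]
    have := mul_le_mul_of_nonneg_left (hCc x hx) hr.le
    linarith [hbd x]
  · rw [hker, ← Submodule.map_sup, ← Submodule.map_sup, htop, Submodule.map_top,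
      LinearMap.range_eq_top.2 he]

variable {X : Type*} [NormedAddCommGroup X] [InnerProductSpace ℝ X]

/-- A positive invertible operator is coercive, by the Cauchy–Schwarz inequality for its form. -/
theorem ContinuousLinearMap.IsPositive.exists_coercive {L : X →L[ℝ] X} (hL : L.IsPositive)
    (hi : L.IsInvertible) : ∃ c > 0, ∀ x, c * ‖x‖ ^ 2 ≤ inner ℝ (L x) x := by
  obtain ⟨M, rfl⟩ := hi
  set N : X →L[ℝ] X := (M.symm : X →L[ℝ] X)
  refine ⟨(‖N‖ + 1)⁻¹, by positivity, fun x => ?_⟩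
  have hpos : ∀ y, 0 ≤ (inner ℝ (M y) y : ℝ) := fun y => by
    simpa using hL.inner_nonneg_left y
  have hcs := LinearMap.BilinForm.apply_sq_le_of_symm
    (B := (innerₗ X).comp ((M : X →L[ℝ] X) : X →ₗ[ℝ] X)) (by simpa using hpos)
    ⟨fun a b => by simpa [real_inner_comm] using (hL.isSymmetric a b)⟩ x (N x)
  have h1 : M (N x) = x := M.apply_symm_apply x
  have h2 : (inner ℝ (M x) (N x) : ℝ) = ‖x‖ ^ 2 := by
    have := hL.isSymmetric x (N x)
    simp only [ContinuousLinearMap.coe_coe, ContinuousLinearEquiv.coe_coe] at this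
    rw [this, h1, real_inner_self_eq_norm_sq]
  simp only [LinearMap.comp_apply, innerₗ_apply_apply, ContinuousLinearMap.coe_coe,
    ContinuousLinearEquiv.coe_coe] at hcs
  rw [h1, h2] at hcs
  have h3 : (inner ℝ x (N x) : ℝ) ≤ (‖N‖ + 1) * ‖x‖ ^ 2 := by
    have := (real_inner_le_norm x (N x)).trans
      (mul_le_mul_of_nonneg_left (N.le_opNorm x) (norm_nonneg x))
    nlinarith [sq_nonneg ‖x‖]
  by_cases hx : x = 0
  · simp [hx]
  have hx2 : 0 < ‖x‖ ^ 2 := by positivity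
  have h4 : ‖x‖ ^ 2 * ‖x‖ ^ 2 ≤ (inner ℝ (M x) x * (‖N‖ + 1)) * ‖x‖ ^ 2 := by
    have := mul_le_mul_of_nonneg_left h3 (hpos x)
    nlinarith
  have h5 := le_of_mul_le_mul_right h4 hx2
  rw [inv_mul_le_iff₀ (by positivity)]
  simpa [mul_comm] using h5

/-- A compact operator is small on a subspace of finite codimension: on the orthogonal of a finite
`ε`-net of the image of the unit ball. -/
theorem IsCompactOperator.exists_abs_inner_le {K : X →L[ℝ] X} (hK : IsCompactOperator K)
    {ε : ℝ} (hε : 0 < ε) :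
    ∃ Y : Submodule ℝ X, FiniteDimensional ℝ Y ∧ ∀ z ∈ Yᗮ, |inner ℝ (K z) z| ≤ ε * ‖z‖ ^ 2 := by
  have hc := hK.isCompact_closure_image_closedBall (𝕜₁ := ℝ) 1
  obtain ⟨s, -, hs, hcov⟩ := hc.finite_cover_balls hε
  refine ⟨Submodule.span ℝ s, FiniteDimensional.span_of_finite ℝ hs, fun z hz => ?_⟩
  by_cases h0 : z = 0
  · simp [h0]
  have hz0 : ‖z‖ ≠ 0 := norm_ne_zero_iff.2 h0
  set u := ‖z‖⁻¹ • z
  have hu : ‖u‖ = 1 := by simp [u, norm_smul, hz0]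
  have hzu : z = ‖z‖ • u := by simp [u, smul_smul, hz0]
  have hKu : K u ∈ ⋃ x ∈ s, Metric.ball x ε :=
    hcov (subset_closure ⟨u, by simp [hu], rfl⟩)
  obtain ⟨y, hy, hyu⟩ := mem_iUnion₂.1 hKu
  have hyz : (inner ℝ y u : ℝ) = 0 := by
    have : (inner ℝ y z : ℝ) = 0 := hz y (Submodule.subset_span hy)
    simp [u, inner_smul_right, this]
  have h1 : |(inner ℝ (K u) u : ℝ)| ≤ ε := by
    have h2 : (inner ℝ (K u) u : ℝ) = inner ℝ (K u - y) u := by rw [inner_sub_left, hyz, sub_zero]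
    rw [h2]
    refine (abs_real_inner_le_norm _ _).trans ?_
    rw [hu, mul_one, ← dist_eq_norm]
    exact (Metric.mem_ball.1 hyu).le
  calc |(inner ℝ (K z) z : ℝ)| = ‖z‖ ^ 2 * |(inner ℝ (K u) u : ℝ)| := by
        conv_lhs => rw [hzu]
        rw [map_smul, inner_smul_left, inner_smul_right, ← mul_assoc, abs_mul]
        congr 1
        simp [sq]
    _ ≤ ‖z‖ ^ 2 * ε := by gcongr
    _ = ε * ‖z‖ ^ 2 := mul_comm _ _

/-- If a symmetric bounded form is coercive on a closed subspace `Z`, then the whole space is the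
sum of `Z` and of its orthogonal with respect to the form (Lax–Milgram). -/
theorem exists_sub_mem_orthogonal_of_coercive [CompleteSpace X] (B : X →L[ℝ] X →L[ℝ] ℝ)
    {Z : Submodule ℝ X} (hZ : IsClosed (Z : Set X)) {c : ℝ} (hc : 0 < c)
    (hco : ∀ z ∈ Z, c * ‖z‖ ^ 2 ≤ B z z) (x : X) : ∃ z ∈ Z, ∀ z' ∈ Z, B (x - z) z' = 0 := by
  have : CompleteSpace Z := hZ.completeSpace_coe
  have hcz : IsCoercive (B.bilinearComp Z.subtypeL Z.subtypeL) :=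
    ⟨c, hc, fun u => by simpa [sq, mul_assoc] using hco u u.2⟩
  set e := hcz.continuousLinearEquivOfBilin
  refine ⟨e.symm ((InnerProductSpace.toDual ℝ Z).symm ((B x).comp Z.subtypeL)),
    Subtype.coe_prop _, fun z' hz' => ?_⟩
  set w := (InnerProductSpace.toDual ℝ Z).symm ((B x).comp Z.subtypeL)
  have h1 := hcz.continuousLinearEquivOfBilin_apply (e.symm w) ⟨z', hz'⟩
  rw [ContinuousLinearEquiv.apply_symm_apply] at h1
  rw [InnerProductSpace.toDual_symm_apply] at h1
  simp only [ContinuousLinearMap.comp_apply, Submodule.subtypeL_apply,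
    ContinuousLinearMap.bilinearComp_apply] at h1
  rw [map_sub, sub_apply, h1, sub_self]

theorem IsCompactPerturbationOfPositive.symm {B : LinearMap.BilinForm ℝ X}
    (hB : IsCompactPerturbationOfPositive B) (x y : X) : B x y = B y x := by
  obtain ⟨L, K, hL, -, hK, -, h⟩ := hB
  have h1 := hL.isSymmetric x y
  have h2 := hK x y
  simp only [ContinuousLinearMap.coe_coe] at h1 h2
  rw [h, h, add_apply, add_apply, inner_add_left, inner_add_left, h1, h2,
    real_inner_comm (L y) x, real_inner_comm (K y) x]

/-- Up to a coercive subspace of finite codimension, on which the compact part is small, a compact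
perturbation of a positive isomorphism lives on a finite dimensional space, where Sylvester's law of
inertia applies. -/
theorem IsCompactPerturbationOfPositive.hasMorseSplitting [CompleteSpace X]
    {B : LinearMap.BilinForm ℝ X} (hB : IsCompactPerturbationOfPositive B) :
    HasMorseSplitting B := by
  have hsymm := hB.symm
  obtain ⟨L, K, hL, hLi, -, hKc, h⟩ := hB
  obtain ⟨c, hc, hLc⟩ := hL.exists_coercive hLi
  obtain ⟨Y, hY, hYK⟩ := hKc.exists_abs_inner_le (half_pos hc)
  let Bc : X →L[ℝ] X →L[ℝ] ℝ := B.mkContinuous₂ ‖L + K‖ fun x y => by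
    rw [h]
    exact (norm_inner_le_norm _ _).trans
      (mul_le_mul_of_nonneg_right ((L + K).le_opNorm x) (norm_nonneg _))
  have hBc : ∀ x y, Bc x y = B x y := fun _ _ => rfl
  have hco : ∀ z ∈ Yᗮ, c / 2 * ‖z‖ ^ 2 ≤ B z z := fun z hz => by
    rw [h, add_apply, inner_add_left]
    have := (abs_le.1 (hYK z hz)).1
    linarith [hLc z]
  -- the orthogonal with respect to `B` of the coercive subspace `Yᗮ`; it has finite dimension
  -- because it meets `Yᗮ` trivially
  let F : Submodule ℝ X :=
    { carrier := {x | ∀ z ∈ Yᗮ, B x z = 0}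
      zero_mem' := fun z _ => by simp
      add_mem' := fun {a b} ha hb z hz => by simp [ha z hz, hb z hz]
      smul_mem' := fun r a ha z hz => by simp [ha z hz] }
  have hF : FiniteDimensional ℝ F := by
    refine FiniteDimensional.of_injective
      ((Y.orthogonalProjectionOnto : X →ₗ[ℝ] Y) ∘ₗ F.subtype) ?_
    rw [← LinearMap.ker_eq_bot, eq_bot_iff]
    intro x hx
    have hx' : (x : X) ∈ Yᗮ := by
      rw [← Submodule.ker_orthogonalProjectionOnto]; exact hx
    have h1 := hco x hx'
    rw [x.2 x hx'] at h1
    have h2 : ‖(x : X)‖ ^ 2 ≤ 0 := by nlinarith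
    have h3 : (x : X) = 0 := by simpa using le_antisymm h2 (sq_nonneg _)
    simpa using h3
  obtain ⟨A, C, hA, hC, htop⟩ := exists_sylvester_splitting (B.restrict F)
    (fun x y => hsymm x y)
  have hdec : ∀ x, ∃ z ∈ Yᗮ, x - z ∈ F := fun x =>
    exists_sub_mem_orthogonal_of_coercive Bc Y.isClosed_orthogonal (half_pos hc) hco x
  have hkF : LinearMap.ker B ≤ F := fun x hx z _ => by
    rw [LinearMap.mem_ker.1 hx, LinearMap.zero_apply]
  have hkerF : (LinearMap.ker (B.restrict F)).map F.subtype ≤ LinearMap.ker B := by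
    rintro _ ⟨x, hx, rfl⟩
    rw [LinearMap.mem_ker]
    ext y
    obtain ⟨z, hz, hyz⟩ := hdec y
    have h1 : B x (y - z) = 0 := LinearMap.congr_fun (LinearMap.mem_ker.1 hx) ⟨y - z, hyz⟩
    have h2 : B x z = 0 := x.2 z hz
    rw [map_sub, h2, sub_zero] at h1
    simpa using h1
  obtain ⟨a, ha, hAa⟩ := exists_coercive_of_finiteDimensional (-Bc) (A.map F.subtype) (by
    rintro _ ⟨x, hx, rfl⟩ h0
    have := hA x hx (by rintro rfl; exact h0 (map_zero _))
    simpa [hBc] using this)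
  obtain ⟨d, hd, hCd⟩ := exists_coercive_of_finiteDimensional Bc (C.map F.subtype) (by
    rintro _ ⟨x, hx, rfl⟩ h0
    have := hC x hx (by rintro rfl; exact h0 (map_zero _))
    simpa [hBc] using this)
  refine ⟨A.map F.subtype, Yᗮ ⊔ C.map F.subtype, min a (min (c / 2) d / 2), by positivity,
    inferInstance, Submodule.finiteDimensional_of_le hkF, fun x hx => ?_, fun x hx => ?_, ?_⟩
  · have h1 := hAa x hx
    have h2 := mul_le_mul_of_nonneg_right (min_le_left a (min (c / 2) d / 2)) (sq_nonneg ‖x‖)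
    simp only [neg_apply, hBc] at h1
    linarith
  · obtain ⟨z, hz, w, hw, rfl⟩ := Submodule.mem_sup.1 hx
    have hwF : B w z = 0 := by
      obtain ⟨w', -, rfl⟩ := hw
      exact w'.2 z hz
    rw [LinearMap.BilinForm.apply_add_self hsymm, hsymm z w, hwF]
    have h1 := hco z hz
    have h2 := hCd w hw
    rw [hBc] at h2
    set m := min (c / 2) d
    have h3 := mul_le_mul_of_nonneg_right (min_le_left (c / 2) d) (sq_nonneg ‖z‖)
    have h4 := mul_le_mul_of_nonneg_right (min_le_right (c / 2) d) (sq_nonneg ‖w‖)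
    have h5 := mul_le_mul_of_nonneg_right (min_le_right a (m / 2)) (sq_nonneg ‖z + w‖)
    have h6 : ‖z + w‖ ^ 2 ≤ 2 * (‖z‖ ^ 2 + ‖w‖ ^ 2) := by
      have h7 : ‖z + w‖ ^ 2 ≤ (‖z‖ + ‖w‖) ^ 2 := by gcongr; exact norm_add_le z w
      nlinarith [sq_nonneg (‖z‖ - ‖w‖)]
    have hm : 0 < m := by positivity
    have h8 := mul_le_mul_of_nonneg_left h6 (half_pos hm).le
    linarith
  · rw [eq_top_iff]
    intro x _
    obtain ⟨z, hz, hxz⟩ := hdec x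
    have h1 : (⟨x - z, hxz⟩ : F) ∈ A ⊔ LinearMap.ker (B.restrict F) ⊔ C := htop ▸ trivial
    have h2 : x - z ∈ (A ⊔ LinearMap.ker (B.restrict F) ⊔ C).map F.subtype := ⟨_, h1, rfl⟩
    rw [Submodule.map_sup, Submodule.map_sup] at h2
    have h3 := add_mem (Submodule.mem_sup_left hz : z ∈ Yᗮ ⊔ _)
      (Submodule.mem_sup_right (sup_le_sup_right (sup_le_sup_left hkerF _) _ h2))
    rw [add_sub_cancel] at h3
    convert h3 using 1
    rw [← sup_assoc, sup_right_comm, sup_comm Yᗮ]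

/-! ### Jump of the index along a differentiable family of forms on a `C¹`-family of subspaces -/

section Perturbation

/-- The scalar estimate behind `eventually_neg_on_sup`: the mixed term `2 b m q` is absorbed by
`a m² + c h q²` as soon as `h` is small. -/
theorem young_perturbation_neg {a b c h m q : ℝ} (hc : 0 < c)
    (hh : 0 < h) (hsmall : h * (b + 2 * b ^ 2 / c + c / 4) < a) (hmq : m ≠ 0 ∨ q ≠ 0) :
    -(a * m ^ 2) + h * (b * m ^ 2 + 2 * (b * m * q) - c * q ^ 2) +
      c / 4 * h * (m ^ 2 + q ^ 2) < 0 := by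
  -- Young's inequality for the mixed term
  have e1 : 2 * (b * m * q) ≤ 2 * b ^ 2 / c * m ^ 2 + c / 2 * q ^ 2 := by
    have e2 : 0 ≤ (2 * b * m - c * q) ^ 2 / (2 * c) := by positivity
    have e3 : (2 * b * m - c * q) ^ 2 / (2 * c) =
        2 * b ^ 2 / c * m ^ 2 + c / 2 * q ^ 2 - 2 * (b * m * q) := by
      field_simp; ring
    linarith
  have e4 := mul_le_mul_of_nonneg_left e1 hh.le
  have e5 : -(a * m ^ 2) + h * (b * m ^ 2 + 2 * (b * m * q) - c * q ^ 2) +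
      c / 4 * h * (m ^ 2 + q ^ 2) ≤
      -((a - h * (b + 2 * b ^ 2 / c + c / 4)) * m ^ 2 + h * (c / 4) * q ^ 2) := by
    linear_combination e4
  have e6 : 0 < a - h * (b + 2 * b ^ 2 / c + c / 4) := by linarith
  rcases hmq with h5 | h5
  · have : 0 < m ^ 2 := by positivity
    have : 0 < (a - h * (b + 2 * b ^ 2 / c + c / 4)) * m ^ 2 + h * (c / 4) * q ^ 2 := by positivity
    linarith
  · have : 0 < q ^ 2 := by positivity
    have : 0 < (a - h * (b + 2 * b ^ 2 / c + c / 4)) * m ^ 2 + h * (c / 4) * q ^ 2 := by positivity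
    linarith

variable {X : Type*} [NormedAddCommGroup X] [NormedSpace ℝ X]

/-- First order perturbation: if `B t₀` is negative on `M` and vanishes on `Q`, where the derivative
of `B`, taken in the direction `σ`, is negative, then on that side of `t₀` the form `B t` is
negative definite on `M + Q`. -/
theorem eventually_neg_on_sup {B : ℝ → X →L[ℝ] X →L[ℝ] ℝ} {B' : X →L[ℝ] X →L[ℝ] ℝ} {I : Set ℝ}
    {t₀ : ℝ} (hB : HasDerivWithinAt B B' I t₀) {M Q : Submodule ℝ X} {a c σ : ℝ}
    (ha : 0 < a) (hc : 0 < c) (hσ : σ ^ 2 = 1)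
    (hM : ∀ m ∈ M, B t₀ m m ≤ -(a * ‖m‖ ^ 2))
    (hQl : ∀ q ∈ Q, ∀ x, B t₀ q x = 0) (hQr : ∀ q ∈ Q, ∀ x, B t₀ x q = 0)
    (hQ : ∀ q ∈ Q, σ * B' q q ≤ -(c * ‖q‖ ^ 2)) :
    ∀ᶠ t in nhdsWithin t₀ I, 0 < σ * (t - t₀) → ∀ x ∈ M ⊔ Q, x ≠ 0 → B t x x < 0 := by
  have h1 := ((hasDerivWithinAt_iff_isLittleO (𝕜 := ℝ) (F := X →L[ℝ] X →L[ℝ] ℝ)).1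
    hB).def (show 0 < c / 8 by positivity)
  set b := ‖B'‖
  set e := b + 2 * b ^ 2 / c + c / 4
  have hb : 0 ≤ b := norm_nonneg B'
  have he : 0 < e := by positivity
  have h2 : ∀ᶠ t in nhdsWithin t₀ I, |t - t₀| < a / e := by
    refine mem_nhdsWithin_of_mem_nhds ?_
    filter_upwards [Metric.ball_mem_nhds t₀ (show 0 < a / e by positivity)] with t ht
    exact ht
  have hσ1 : |σ| = 1 := by
    rcases mul_self_eq_one_iff.1 ((sq σ).symm.trans hσ) with h | h <;> simp [h]
  filter_upwards [h1, h2] with t h1 h2 h3 x hx hx0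
  obtain ⟨m, hm, q, hq, rfl⟩ := Submodule.mem_sup.1 hx
  set h := σ * (t - t₀) with hh
  have hth : t - t₀ = σ * h := by rw [hh, ← mul_assoc, ← sq, hσ, one_mul]
  have habs : |t - t₀| = h := by rw [hth, abs_mul, hσ1, one_mul, abs_of_pos h3]
  rw [Real.norm_eq_abs, habs] at h1
  rw [habs, lt_div_iff₀ he] at h2
  set E := B t - B t₀ - (t - t₀) • B' with hE
  have hBt : B t (m + q) (m + q) = B t₀ m m + h * (σ * B' (m + q) (m + q)) + E (m + q) (m + q) := by
    have e1 : B t₀ (m + q) (m + q) = B t₀ m m := by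
      simp [hQl q hq, hQr q hq]
    have e2 : E (m + q) (m + q) = B t (m + q) (m + q) - B t₀ (m + q) (m + q) -
        (t - t₀) * B' (m + q) (m + q) := by
      simp only [hE, sub_apply, smul_apply, smul_eq_mul]
    rw [e2, e1, hth]; ring
  have hEb : E (m + q) (m + q) ≤ c / 4 * h * (‖m‖ ^ 2 + ‖q‖ ^ 2) := by
    have e1 := (le_abs_self _).trans (E.le_opNorm₂ (m + q) (m + q))
    have e2 : ‖E‖ * ‖m + q‖ * ‖m + q‖ ≤ c / 8 * h * (‖m‖ + ‖q‖) * (‖m‖ + ‖q‖) := by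
      gcongr <;> exact norm_add_le _ _
    have e3 := mul_nonneg (show 0 ≤ c / 8 * h by positivity) (sq_nonneg (‖m‖ - ‖q‖))
    refine (e1.trans e2).trans ?_
    linear_combination e3
  have hB'b : σ * B' (m + q) (m + q) ≤
      b * ‖m‖ ^ 2 + 2 * (b * ‖m‖ * ‖q‖) - c * ‖q‖ ^ 2 := by
    have key : ∀ x y : X, σ * B' x y ≤ b * ‖x‖ * ‖y‖ := fun x y => by
      refine (le_abs_self _).trans ?_
      rw [abs_mul, hσ1, one_mul]
      exact B'.le_opNorm₂ x y
    have e1 : σ * B' (m + q) (m + q) =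
        σ * B' m m + σ * B' m q + σ * B' q m + σ * B' q q := by
      simp only [map_add, add_apply]; ring
    rw [e1]
    linear_combination key m m + key m q + key q m + hQ q hq
  have hmq : ‖m‖ ≠ 0 ∨ ‖q‖ ≠ 0 := by
    by_contra! hcon
    exact hx0 (by rw [norm_eq_zero.1 hcon.1, norm_eq_zero.1 hcon.2, add_zero])
  have e8 := mul_le_mul_of_nonneg_left hB'b h3.le
  have e9 := hM m hm
  have e10 := young_perturbation_neg hc h3 h2 hmq
  rw [hBt]
  linarith

theorem hasDerivWithinAt_bilinearComp {C : ℝ → X →L[ℝ] X →L[ℝ] ℝ} {C' : X →L[ℝ] X →L[ℝ] ℝ}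
    {γ : ℝ → X →L[ℝ] X} {γ' : X →L[ℝ] X} {I : Set ℝ} {t₀ : ℝ} (hC : HasDerivWithinAt C C' I t₀)
    (hγ : HasDerivWithinAt γ γ' I t₀) :
    HasDerivWithinAt (fun t => (C t).bilinearComp (γ t) (γ t))
      (C'.bilinearComp (γ t₀) (γ t₀) + (C t₀).bilinearComp γ' (γ t₀) +
        (C t₀).bilinearComp (γ t₀) γ') I t₀ := by
  let L : (X →L[ℝ] X →L[ℝ] ℝ) →L[ℝ] (X →L[ℝ] X →L[ℝ] ℝ) :=
    (ContinuousLinearMap.flipₗᵢ ℝ X X ℝ).toContinuousLinearEquiv.toContinuousLinearMap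
  have hfl : ∀ g : X →L[ℝ] X →L[ℝ] ℝ,
      HasFDerivAt (fun g : X →L[ℝ] X →L[ℝ] ℝ => g.flip) L g := fun g =>
    ContinuousLinearMap.hasFDerivAt (E := X →L[ℝ] X →L[ℝ] ℝ) (F := X →L[ℝ] X →L[ℝ] ℝ) L
  have hflip : ∀ {f : ℝ → X →L[ℝ] X →L[ℝ] ℝ} {f' : X →L[ℝ] X →L[ℝ] ℝ},
      HasDerivWithinAt f f' I t₀ → HasDerivWithinAt (fun t => (f t).flip) f'.flip I t₀ :=
    fun {f f'} hf =>
      HasFDerivAt.comp_hasDerivWithinAt (E := X →L[ℝ] X →L[ℝ] ℝ)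
        (F := X →L[ℝ] X →L[ℝ] ℝ) t₀ (hfl (f t₀)) hf
  have h := hflip ((hflip (hC.clm_comp hγ)).clm_comp hγ)
  convert h using 1
  all_goals
    ext x y
    simp

end Perturbation

/-- If a symmetric form, pulled back by an injective map `γ`, is negative definite on `A` and
positive definite on `C`, then on `γ(A + C)` it is nondegenerate of index `dim A`. -/
theorem negIndex_map_eq_finrank {V : Type*} [AddCommGroup V] [Module ℝ V]
    {B : LinearMap.BilinForm ℝ V} (hB : ∀ x y, B x y = B y x) {γ : V →ₗ[ℝ] V}
    (hγ : Function.Injective γ) {A C : Submodule ℝ V} [FiniteDimensional ℝ A]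
    (hA : ∀ x ∈ A, x ≠ 0 → B (γ x) (γ x) < 0) (hC : ∀ x ∈ C, x ≠ 0 → 0 < B (γ x) (γ x)) :
    negIndex (B.restrict ((A ⊔ C).map γ)) = (Module.finrank ℝ A : ℕ∞) ∧
      ∀ v ∈ (A ⊔ C).map γ, (∀ w ∈ (A ⊔ C).map γ, B v w = 0) → v = 0 := by
  constructor
  · rw [Submodule.map_sup, (Submodule.equivMapOfInjective γ hγ A).finrank_eq]
    refine negIndex_restrict_eq_finrank (A := A.map γ) (Y := C.map γ) ?_ ?_ rfl
    · rintro _ ⟨x, hx, rfl⟩ h0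
      exact hA x hx (by rintro rfl; exact h0 (map_zero _))
    · rintro _ ⟨x, hx, rfl⟩
      by_cases h0 : x = 0
      · simp [h0]
      · exact (hC x hx h0).le
  · rintro _ ⟨x, hx, rfl⟩ h
    obtain ⟨a, ha, c, hc, rfl⟩ := Submodule.mem_sup.1 hx
    have h1 := h (γ a) ⟨a, Submodule.mem_sup_left ha, rfl⟩
    have h2 := h (γ c) ⟨c, Submodule.mem_sup_right hc, rfl⟩
    simp only [map_add, LinearMap.add_apply] at h1 h2
    rw [hB (γ c) (γ a)] at h1
    have ha0 : a = 0 := by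
      by_contra h0
      have := hA a ha h0
      by_cases h3 : c = 0
      · simp only [h3, map_zero] at h1; linarith
      · linarith [hC c hc h3]
    have hc0 : c = 0 := by
      by_contra h0
      have := hC c hc h0
      rw [ha0, map_zero, map_zero, LinearMap.zero_apply] at h2
      linarith
    rw [ha0, hc0, add_zero, map_zero]

section Jump

variable {X : Type*} [NormedAddCommGroup X] [InnerProductSpace ℝ X] [CompleteSpace X]

/-- Local trivialization of a `C¹`-family of subspaces by isomorphisms of the ambient space which
are differentiable at `t₀` and equal to the identity there. -/
theorem IsC1Family.exists_trivialization {I : Set ℝ} {K : ℝ → Submodule ℝ X}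
    (hK : IsC1Family I K) {t₀ : ℝ} (ht₀ : t₀ ∈ I) :
    ∃ (γ : ℝ → X →L[ℝ] X) (γ' : X →L[ℝ] X), HasDerivWithinAt γ γ' I t₀ ∧
      γ t₀ = ContinuousLinearMap.id ℝ X ∧ ∀ᶠ t in nhdsWithin t₀ I,
        Function.Injective (γ t) ∧ (K t₀).map (γ t : X →ₗ[ℝ] X) = K t := by
  obtain ⟨ε, hε, α, D', -, hα, h⟩ := hK.2 t₀ ht₀
  have hmem : t₀ ∈ Ioo (t₀ - ε) (t₀ + ε) ∩ I := ⟨⟨by linarith, by linarith⟩, ht₀⟩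
  have hnhds : nhdsWithin t₀ (Ioo (t₀ - ε) (t₀ + ε) ∩ I) = nhdsWithin t₀ I := by
    exact nhdsWithin_inter_of_mem (mem_nhdsWithin_of_mem_nhds (Ioo_mem_nhds hmem.1.1 hmem.1.2))
  have hd := ((hα.differentiableOn (by norm_num)) t₀ hmem).hasDerivWithinAt
  obtain ⟨e, he⟩ := (h t₀ hmem).1
  have hinv : HasFDerivAt ContinuousLinearMap.inverse
      (fderiv ℝ ContinuousLinearMap.inverse (α t₀)) (α t₀) := by
    rw [← he]
    exact ((contDiffAt_map_inverse (n := 1) e).differentiableAt (by norm_num)).hasFDerivAt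
  have hcomp := (hinv.comp_hasDerivWithinAt t₀ hd).clm_comp
    (hasDerivWithinAt_const t₀ (Ioo (t₀ - ε) (t₀ + ε) ∩ I) (α t₀))
  have hder : ∃ γ', HasDerivWithinAt
      (fun t => (ContinuousLinearMap.inverse (α t)).comp (α t₀)) γ' I t₀ := by
    exact ⟨_, hcomp.mono_of_mem_nhdsWithin (hnhds ▸ self_mem_nhdsWithin)⟩
  obtain ⟨γ', hγ'⟩ := hder
  refine ⟨fun t => (ContinuousLinearMap.inverse (α t)).comp (α t₀), γ', hγ', ?_, ?_⟩
  · ext x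
    simp [← he]
  · rw [← hnhds]
    filter_upwards [self_mem_nhdsWithin] with t ht
    obtain ⟨et, het⟩ := (h t ht).1
    have hval : ∀ x, (ContinuousLinearMap.inverse (α t)).comp (α t₀) x = et.symm (e x) := by
      intro x; simp [← he, ← het]
    constructor
    · intro x y hxy
      rw [hval, hval] at hxy
      exact e.injective (et.symm.injective hxy)
    · have h1 := (h t ht).2
      rw [← (h t₀ hmem).2] at h1
      ext y
      constructor
      · rintro ⟨x, hx, rfl⟩
        have h2 : α t₀ x ∈ (K t).map (α t : X →ₗ[ℝ] X) := by rw [h1]; exact ⟨x, hx, rfl⟩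
        obtain ⟨z, hz, hzx⟩ := h2
        change (ContinuousLinearMap.inverse (α t)).comp (α t₀) x ∈ K t
        rw [hval]
        have h3 : et z = e x := by
          rw [← he, ← het] at hzx; exact hzx
        rw [← h3, et.symm_apply_apply]; exact hz
      · intro hy
        have h2 : α t y ∈ (K t₀).map (α t₀ : X →ₗ[ℝ] X) := by rw [← h1]; exact ⟨y, hy, rfl⟩
        obtain ⟨z, hz, hzx⟩ := h2
        refine ⟨z, hz, ?_⟩
        change (ContinuousLinearMap.inverse (α t)).comp (α t₀) z = y
        rw [hval]
        have h3 : e z = et y := by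
          rw [← he, ← het] at hzx; exact hzx
        rw [h3, et.symm_apply_apply]

/-- Jump of the index: let `C t` be a family of bounded symmetric forms, differentiable at `t₀`,
and `K t` a `C¹`-family of closed subspaces such that `C t₀` has a Morse splitting on `K t₀` and the
kernel `N` of its restriction to `K t₀` lies in the kernel of `C t₀`. If the derivative of `C` is
nondegenerate on `N`, then near `t₀` the index of `C t` on `K t` exceeds that at `t₀` by the
coindex of the derivative on the left, by the index of the derivative on the right, and
`C t` is nondegenerate on `K t` for `t ≠ t₀`. -/
theorem exists_index_jump {C : ℝ → X →L[ℝ] X →L[ℝ] ℝ} {C' : X →L[ℝ] X →L[ℝ] ℝ} {I : Set ℝ}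
    {t₀ : ℝ} (ht₀ : t₀ ∈ I) (hC : HasDerivWithinAt C C' I t₀)
    (hsymm : ∀ t ∈ I, ∀ x y, C t x y = C t y x) (hsymm' : ∀ x y, C' x y = C' y x)
    {K : ℝ → Submodule ℝ X} (hK : IsC1Family I K)
    (hsplit : HasMorseSplitting ((C t₀).toBilinForm.restrict (K t₀)))
    {N : Submodule ℝ X} (hN : ∀ v, v ∈ N ↔ v ∈ K t₀ ∧ ∀ w ∈ K t₀, C t₀ v w = 0)
    (hker : ∀ v ∈ N, ∀ w, C t₀ v w = 0)
    (hnd : ∀ v ∈ N, (∀ w ∈ N, C' v w = 0) → v = 0) :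
    ∃ i p q : ℕ, negIndex ((C t₀).toBilinForm.restrict (K t₀)) = i ∧
      negIndex (C'.toBilinForm.restrict N) = p ∧ posIndex (C'.toBilinForm.restrict N) = q ∧
      (∀ᶠ t in nhdsWithin t₀ I, t₀ < t →
        negIndex ((C t).toBilinForm.restrict (K t)) = (i + p : ℕ)) ∧
      (∀ᶠ t in nhdsWithin t₀ I, t < t₀ →
        negIndex ((C t).toBilinForm.restrict (K t)) = (i + q : ℕ)) ∧
      ∀ᶠ t in nhdsWithin t₀ I, t ≠ t₀ → ∀ v ∈ K t, (∀ w ∈ K t, C t v w = 0) → v = 0 := by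
  obtain ⟨A₀, P₀, c, hc, hA₀fin, hkerfin, hA₀, hP₀, htop⟩ := hsplit
  obtain ⟨γ, γ', hγ, hγ0, hγK⟩ := hK.exists_trivialization ht₀
  set A : Submodule ℝ X := A₀.map (K t₀).subtype
  set P : Submodule ℝ X := P₀.map (K t₀).subtype
  have hNK : N = (LinearMap.ker ((C t₀).toBilinForm.restrict (K t₀))).map (K t₀).subtype := by
    ext v
    rw [hN]
    constructor
    · rintro ⟨hv, h⟩
      refine ⟨⟨v, hv⟩, ?_, rfl⟩
      rw [SetLike.mem_coe, LinearMap.mem_ker]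
      ext w
      exact h w w.2
    · rintro ⟨x, hx, rfl⟩
      exact ⟨x.2, fun w hw => LinearMap.congr_fun (LinearMap.mem_ker.1 hx) ⟨w, hw⟩⟩
  have hsum : A ⊔ N ⊔ P = K t₀ := by
    rw [hNK, ← Submodule.map_sup, ← Submodule.map_sup, htop, Submodule.map_top,
      Submodule.range_subtype]
  have hNfin : FiniteDimensional ℝ N := by rw [hNK]; infer_instance
  have hA : ∀ x ∈ A, C t₀ x x ≤ -(c * ‖x‖ ^ 2) := by
    rintro _ ⟨x, hx, rfl⟩; exact hA₀ x hx
  have hP : ∀ x ∈ P, c * ‖x‖ ^ 2 ≤ C t₀ x x := by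
    rintro _ ⟨x, hx, rfl⟩; exact hP₀ x hx
  -- the splitting of the kernel by the derivative
  obtain ⟨a₀, p₀, ha₀, hp₀, htopN⟩ := exists_sylvester_splitting (C'.toBilinForm.restrict N)
    (fun x y => hsymm' x y)
  have hkerN : LinearMap.ker (C'.toBilinForm.restrict N) = ⊥ := by
    rw [eq_bot_iff]
    intro v hv
    have := hnd v v.2 fun w hw => LinearMap.congr_fun (LinearMap.mem_ker.1 hv) ⟨w, hw⟩
    simpa using this
  rw [hkerN, sup_bot_eq] at htopN
  set Na : Submodule ℝ X := a₀.map N.subtype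
  set Np : Submodule ℝ X := p₀.map N.subtype
  have hNaN : Na ≤ N := Submodule.map_subtype_le N a₀
  have hNpN : Np ≤ N := Submodule.map_subtype_le N p₀
  have hNsum : Na ⊔ Np = N := by
    rw [← Submodule.map_sup, htopN, Submodule.map_top, Submodule.range_subtype]
  have hNa0 : ∀ x ∈ Na, x ≠ 0 → C' x x < 0 := by
    rintro _ ⟨x, hx, rfl⟩ h0
    exact ha₀ x hx (by rintro rfl; exact h0 (map_zero _))
  have hNp0 : ∀ x ∈ Np, x ≠ 0 → 0 < C' x x := by
    rintro _ ⟨x, hx, rfl⟩ h0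
    exact hp₀ x hx (by rintro rfl; exact h0 (map_zero _))
  obtain ⟨ca, hca, hNa⟩ := exists_coercive_of_finiteDimensional (-C') Na
    (fun x hx h0 => by simpa using hNa0 x hx h0)
  obtain ⟨cp, hcp, hNp⟩ := exists_coercive_of_finiteDimensional C' Np hNp0
  -- the forms pulled back to `K t₀`
  set B : ℝ → X →L[ℝ] X →L[ℝ] ℝ := fun t => (C t).bilinearComp (γ t) (γ t) with hBdef
  have hBd := hasDerivWithinAt_bilinearComp hC hγ
  set B' : X →L[ℝ] X →L[ℝ] ℝ := C'.bilinearComp (γ t₀) (γ t₀) + (C t₀).bilinearComp γ' (γ t₀) +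
        (C t₀).bilinearComp (γ t₀) γ' with hB'def
  have hBn : HasDerivWithinAt (-B) (-B') I t₀ :=
    HasDerivWithinAt.neg (𝕜 := ℝ) (F := X →L[ℝ] X →L[ℝ] ℝ) hBd
  have hB0 : B t₀ = C t₀ := by ext x y; simp [hBdef, hγ0]
  -- the terms in `γ'` vanish since `N` lies in the kernel of `C t₀` on the whole space
  have hB'N : ∀ x ∈ N, B' x x = C' x x := fun x hx => by
    simp [hB'def, hγ0, hker x hx, hsymm t₀ ht₀ (γ' x) x]
  have hl : ∀ q ∈ N, ∀ x, B t₀ q x = 0 := fun q hq x => by rw [hB0]; exact hker q hq x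
  have hr : ∀ q ∈ N, ∀ x, B t₀ x q = 0 := fun q hq x => by
    rw [hB0, hsymm t₀ ht₀]; exact hker q hq x
  have one : (1 : ℝ) ^ 2 = 1 := by norm_num
  have mone : (-1 : ℝ) ^ 2 = 1 := by norm_num
  have negA : ∀ m ∈ A, B t₀ m m ≤ -(c * ‖m‖ ^ 2) := fun m hm => by rw [hB0]; exact hA m hm
  have negP : ∀ m ∈ P, (-B) t₀ m m ≤ -(c * ‖m‖ ^ 2) := fun m hm => by
    simpa [hB0] using hP m hm
  -- to the right of `t₀` the form is negative on `A + Na` and positive on `P + Np`; to the left the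
  -- roles of `Na` and `Np` are exchanged
  have er1 := eventually_neg_on_sup hBd hc hca one negA (fun q hq => hl q (hNaN hq))
    (fun q hq => hr q (hNaN hq)) (fun q hq => by
      have := hNa q hq
      rw [one_mul, hB'N q (hNaN hq)]
      simp only [neg_apply] at this; linarith)
  have er2 := eventually_neg_on_sup hBn hc hcp one negP
    (fun q hq x => by simp [hl q (hNpN hq)]) (fun q hq x => by simp [hr q (hNpN hq)])
    (fun q hq => by
      have := hNp q hq
      simp only [neg_apply, one_mul, hB'N q (hNpN hq)]; linarith)
  have el1 := eventually_neg_on_sup hBd hc hcp mone negA (fun q hq => hl q (hNpN hq))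
    (fun q hq => hr q (hNpN hq)) (fun q hq => by
      have := hNp q hq
      rw [hB'N q (hNpN hq)]; linarith)
  have el2 := eventually_neg_on_sup hBn hc hca mone negP
    (fun q hq x => by simp [hl q (hNaN hq)]) (fun q hq x => by simp [hr q (hNaN hq)])
    (fun q hq => by
      have := hNa q hq
      simp only [neg_apply, hB'N q (hNaN hq)] at this ⊢; linarith)
  have hdisj : ∀ Q ≤ N, Disjoint A Q := fun Q hQ => by
    rw [Submodule.disjoint_def]
    intro x hxA hxQ
    have h1 := hA x hxA
    rw [hker x (hQ hxQ)] at h1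
    have h2 : ‖x‖ ^ 2 ≤ 0 := by nlinarith
    simpa using le_antisymm h2 (sq_nonneg _)
  have hfin1 : FiniteDimensional ℝ A := inferInstance
  have hfinrank : ∀ Q ≤ N, FiniteDimensional ℝ Q →
      Module.finrank ℝ (A ⊔ Q : Submodule ℝ X) = Module.finrank ℝ A + Module.finrank ℝ Q :=
    fun Q hQ _ => by
      have := Submodule.finrank_sup_add_finrank_inf_eq A Q
      rwa [(hdisj Q hQ).eq_bot, finrank_bot, add_zero] at this
  have hsumr : (A ⊔ Na) ⊔ (P ⊔ Np) = K t₀ := by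
    rw [← hsum, ← hNsum]; ac_rfl
  have hsuml : (A ⊔ Np) ⊔ (P ⊔ Na) = K t₀ := by
    rw [← hsum, ← hNsum]; ac_rfl
  have right : ∀ᶠ t in nhdsWithin t₀ I, t₀ < t →
      negIndex ((C t).toBilinForm.restrict (K t)) =
        (Module.finrank ℝ A + Module.finrank ℝ Na : ℕ) ∧
      ∀ v ∈ K t, (∀ w ∈ K t, C t v w = 0) → v = 0 := by
    filter_upwards [er1, er2, hγK, self_mem_nhdsWithin] with t h1 h2 h3 h4 h5
    have h := negIndex_map_eq_finrank (B := (C t).toBilinForm) (hsymm t h4) h3.1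
      (γ := (γ t : X →ₗ[ℝ] X)) (A := A ⊔ Na) (C := P ⊔ Np)
      (h1 (by linarith)) (fun x hx h0 => neg_lt_zero.1 (h2 (by linarith) x hx h0))
    rw [hsumr, h3.2, hfinrank Na hNaN inferInstance] at h
    exact h
  have left : ∀ᶠ t in nhdsWithin t₀ I, t < t₀ →
      negIndex ((C t).toBilinForm.restrict (K t)) =
        (Module.finrank ℝ A + Module.finrank ℝ Np : ℕ) ∧
      ∀ v ∈ K t, (∀ w ∈ K t, C t v w = 0) → v = 0 := by
    filter_upwards [el1, el2, hγK, self_mem_nhdsWithin] with t h1 h2 h3 h4 h5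
    have h := negIndex_map_eq_finrank (B := (C t).toBilinForm) (hsymm t h4) h3.1
      (γ := (γ t : X →ₗ[ℝ] X)) (A := A ⊔ Np) (C := P ⊔ Na)
      (h1 (by linarith)) (fun x hx h0 => neg_lt_zero.1 (h2 (by linarith) x hx h0))
    rw [hsuml, h3.2, hfinrank Np hNpN inferInstance] at h
    exact h
  refine ⟨Module.finrank ℝ A, Module.finrank ℝ Na, Module.finrank ℝ Np, ?_, ?_, ?_, ?_, ?_, ?_⟩
  · refine negIndex_restrict_eq_finrank (Y := N ⊔ P) (fun x hx h0 => ?_) (fun y hy => ?_)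
      (by rw [← sup_assoc, hsum])
    · have h1 := hA x hx
      have h2 : 0 < ‖x‖ := norm_pos_iff.2 h0
      have h3 : 0 < c * ‖x‖ ^ 2 := by positivity
      exact lt_of_le_of_lt h1 (by linarith)
    · obtain ⟨u, hu, w, hw, rfl⟩ := Submodule.mem_sup.1 hy
      have h1 : C t₀ w w ≥ 0 := le_trans (by positivity) (hP w hw)
      have h2 : C t₀ w u = 0 := by rw [hsymm t₀ ht₀]; exact hker u hu w
      have h3 : C t₀ (u + w) (u + w) = C t₀ w w := by
        simp [hker u hu, h2]
      exact h1.trans_eq h3.symm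
  · refine negIndex_restrict_eq_finrank (Y := Np) hNa0 (fun y hy => ?_) hNsum
    by_cases h0 : y = 0
    · simp [h0]
    · exact (hNp0 y hy h0).le
  · have : -(C'.toBilinForm.restrict N) = (-C'.toBilinForm).restrict N := rfl
    rw [posIndex, this]
    refine negIndex_restrict_eq_finrank (Y := Na) (fun x hx h0 => ?_) (fun y hy => ?_)
      (by rw [sup_comm, hNsum])
    · simpa using hNp0 x hx h0
    · by_cases h0 : y = 0
      · simp [h0]
      · simpa using (hNa0 y hy h0).le
  · filter_upwards [right] with t h1 h2 using (h1 h2).1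
  · filter_upwards [left] with t h1 h2 using (h1 h2).1
  · filter_upwards [left, right] with t h1 h2 h3
    rcases lt_or_gt_of_ne h3 with h4 | h4
    · exact (h1 h4).2
    · exact (h2 h4).2

end Jump

/-! ### Linear differential equations on `[0,1]` -/

section LinearODE

variable {E : Type*} [NormedAddCommGroup E] [NormedSpace ℝ E] {A : ℝ → E →L[ℝ] E}

/-- Two solutions of a linear equation which agree at one instant agree on `[0,1]`. -/
theorem linear_ode_unique (hA : ContinuousOn A (Icc 0 1)) {y z : ℝ → E}
    (hy : ∀ t ∈ Icc (0 : ℝ) 1, HasDerivWithinAt y (A t (y t)) (Icc 0 1) t)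
    (hz : ∀ t ∈ Icc (0 : ℝ) 1, HasDerivWithinAt z (A t (z t)) (Icc 0 1) t)
    {s : ℝ} (hs : s ∈ Icc (0 : ℝ) 1) (h : y s = z s) : EqOn y z (Icc 0 1) := by
  obtain ⟨M, hM⟩ := isCompact_Icc.exists_bound_of_continuousOn hA
  have hlip : ∀ t ∈ Icc (0 : ℝ) 1, LipschitzOnWith M.toNNReal (fun x => A t x) univ :=
    fun t ht => ((A t).lipschitz.weaken (by
      rw [← NNReal.coe_le_coe, coe_nnnorm]
      exact (hM t ht).trans (Real.le_coe_toNNReal M))).lipschitzOnWith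
  have hyc : ContinuousOn y (Icc 0 1) := fun t ht => (hy t ht).continuousWithinAt
  have hzc : ContinuousOn z (Icc 0 1) := fun t ht => (hz t ht).continuousWithinAt
  rw [← Icc_union_Icc_eq_Icc hs.1 hs.2]
  have hl : Icc 0 s ⊆ Icc (0 : ℝ) 1 := Icc_subset_Icc_right hs.2
  have hr : Icc s 1 ⊆ Icc (0 : ℝ) 1 := Icc_subset_Icc_left hs.1
  have nl : ∀ t ∈ Ioc 0 s, Icc (0 : ℝ) 1 ∈ nhdsWithin t (Iic t) := fun t ht =>
    Filter.mem_of_superset (Icc_mem_nhdsLE ht.1) (Icc_subset_Icc_right (ht.2.trans hs.2))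
  have nr : ∀ t ∈ Ico s 1, Icc (0 : ℝ) 1 ∈ nhdsWithin t (Ici t) := fun t ht =>
    Filter.mem_of_superset (Icc_mem_nhdsGE ht.2) (Icc_subset_Icc_left (hs.1.trans ht.1))
  refine EqOn.union ?_ ?_
  · exact ODE_solution_unique_of_mem_Icc_left (v := fun t x => A t x) (s := fun _ => univ)
      (fun t ht => hlip t (hl (Ioc_subset_Icc_self ht))) (hyc.mono hl)
      (fun t ht => (hy t (hl (Ioc_subset_Icc_self ht))).mono_of_mem_nhdsWithin (nl t ht))
      (fun _ _ => trivial) (hzc.mono hl)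
      (fun t ht => (hz t (hl (Ioc_subset_Icc_self ht))).mono_of_mem_nhdsWithin (nl t ht))
      (fun _ _ => trivial) h
  · exact ODE_solution_unique_of_mem_Icc_right (v := fun t x => A t x) (s := fun _ => univ)
      (fun t ht => hlip t (hr (Ico_subset_Icc_self ht))) (hyc.mono hr)
      (fun t ht => (hy t (hr (Ico_subset_Icc_self ht))).mono_of_mem_nhdsWithin (nr t ht))
      (fun _ _ => trivial) (hzc.mono hr)
      (fun t ht => (hz t (hr (Ico_subset_Icc_self ht))).mono_of_mem_nhdsWithin (nr t ht))
      (fun _ _ => trivial) h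

/-- Global existence for a linear equation: the vector field is cut off outside a ball which, by
Grönwall's inequality, the solution of the truncated equation does not leave. -/
theorem exists_linear_ode_solution_zero [FiniteDimensional ℝ E] (hA : ContinuousOn A (Icc 0 1))
    (x : E) : ∃ y : ℝ → E, y 0 = x ∧
      ∀ t ∈ Icc (0 : ℝ) 1, HasDerivWithinAt y (A t (y t)) (Icc 0 1) t := by
  have : CompleteSpace E := FiniteDimensional.complete ℝ E
  obtain ⟨M₀, hM₀⟩ := isCompact_Icc.exists_bound_of_continuousOn hA
  set M : NNReal := M₀.toNNReal
  have hM : ∀ t ∈ Icc (0 : ℝ) 1, ‖A t‖ ≤ M := fun t ht =>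
    (hM₀ t ht).trans (Real.le_coe_toNNReal M₀)
  set r : ℝ := ‖x‖ * Real.exp M + 1
  have hr : 0 < r := by positivity
  let φ : ContDiffBump (0 : E) := ⟨r, 2 * r, hr, by linarith⟩
  set ρ : E → E := fun x => φ x • x
  have hρc : ContDiff ℝ 1 ρ := φ.contDiff.smul contDiff_id
  have hρs : HasCompactSupport ρ := φ.hasCompactSupport.smul_right
  obtain ⟨k, hk⟩ := hρc.lipschitzWith_of_hasCompactSupport hρs (by norm_num)
  obtain ⟨b, hb⟩ := hρs.exists_bound_of_continuous hρc.continuous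
  set b' : NNReal := b.toNNReal
  have hb' : ∀ x, ‖ρ x‖ ≤ b' := fun x => (hb x).trans (Real.le_coe_toNNReal b)
  have hpl : IsPicardLindelof (fun t x => A t (ρ x)) (tmin := 0) (tmax := 1)
      ⟨0, left_mem_Icc.2 zero_le_one⟩ x (M * b') 0 (M * b') (M * k) := by
    refine ⟨fun t ht => ?_, fun z _ => ?_, fun t ht z _ => ?_, ?_⟩
    · refine LipschitzWith.lipschitzOnWith (LipschitzWith.comp ((A t).lipschitz.weaken ?_) hk)
      rw [← NNReal.coe_le_coe, coe_nnnorm]; exact hM t ht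
    · exact hA.clm_apply continuousOn_const
    · rw [NNReal.coe_mul]
      exact ((A t).le_opNorm _).trans (mul_le_mul (hM t ht) (hb' z) (norm_nonneg _) M.2)
    · simp
  obtain ⟨y, hy0, hy⟩ := hpl.exists_eq_forall_mem_Icc_hasDerivWithinAt₀
  refine ⟨y, hy0, fun t ht => ?_⟩
  have hρle : ∀ z, ‖ρ z‖ ≤ ‖z‖ := fun z => by
    simp only [ρ, norm_smul, Real.norm_eq_abs, abs_of_nonneg φ.nonneg]
    exact mul_le_of_le_one_left (norm_nonneg z) φ.le_one
  have hg := norm_le_gronwallBound_of_norm_deriv_right_le (f := y) (f' := fun t => A t (ρ (y t)))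
    (δ := ‖x‖) (K := M) (ε := 0) (a := 0) (b := 1)
    (fun t ht => (hy t ht).continuousWithinAt)
    (fun t ht => (hy t (Ico_subset_Icc_self ht)).mono_of_mem_nhdsWithin
      (Filter.mem_of_superset (Icc_mem_nhdsGE ht.2) (Icc_subset_Icc_left ht.1)))
    (by rw [← hy0]) (fun t ht => by
      rw [add_zero]
      exact ((A t).le_opNorm _).trans (mul_le_mul (hM t (Ico_subset_Icc_self ht)) (hρle _)
        (norm_nonneg _) M.2)) t ht
  rw [gronwallBound_ε0, sub_zero] at hg
  have h1 : ‖y t‖ ≤ r := by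
    have h2 : Real.exp (M * t) ≤ Real.exp M :=
      Real.exp_le_exp.2 (mul_le_of_le_one_right M.2 ht.2)
    have h3 := mul_le_mul_of_nonneg_left h2 (norm_nonneg x)
    linarith
  have h2 : ρ (y t) = y t := by
    have : φ (y t) = 1 := φ.one_of_mem_closedBall (by simpa using h1)
    simp only [ρ, this, one_smul]
  have h3 := hy t ht
  rwa [h2] at h3

/-- Existence with prescribed value at any instant `s`: the evolution from `0` to `s` is an
injective, hence surjective, endomorphism. -/
theorem exists_linear_ode_solution [FiniteDimensional ℝ E] (hA : ContinuousOn A (Icc 0 1))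
    {s : ℝ} (hs : s ∈ Icc (0 : ℝ) 1) (x : E) : ∃ y : ℝ → E, y s = x ∧
      ∀ t ∈ Icc (0 : ℝ) 1, HasDerivWithinAt y (A t (y t)) (Icc 0 1) t := by
  have h01 : (0 : ℝ) ∈ Icc (0 : ℝ) 1 := left_mem_Icc.2 zero_le_one
  choose Y hY0 hY using exists_linear_ode_solution_zero hA
  let Φ : E →ₗ[ℝ] E :=
    { toFun := fun x => Y x s
      map_add' := fun a b => by
        refine linear_ode_unique hA (hY (a + b)) (z := Y a + Y b) (fun t ht => ?_) h01
          (by simp [hY0]) hs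
        simpa using (hY a t ht).add (hY b t ht)
      map_smul' := fun c a => by
        refine linear_ode_unique hA (hY (c • a)) (z := c • Y a) (fun t ht => ?_) h01
          (by simp [hY0]) hs
        simpa using (hY a t ht).const_smul c }
  have hinj : Function.Injective Φ := fun a b hab => by
    have := linear_ode_unique hA (hY a) (hY b) hs hab h01
    rwa [hY0, hY0] at this
  obtain ⟨a, ha⟩ := (LinearMap.injective_iff_surjective.1 hinj) x
  exact ⟨Y a, ha, hY a⟩

end LinearODE

/-! ### Solutions of the Morse–Sturm equation -/

namespace MorseSturmData

variable {n : ℕ} (D : MorseSturmData n)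

/-- `J` solves `J'' = R J` on `[0,1]`, with derivative `J'`; no initial condition is imposed. -/
def IsJacobi (J J' : ℝ → Rn n) : Prop :=
  (∀ t ∈ Icc (0 : ℝ) 1, HasDerivWithinAt J (J' t) (Icc 0 1) t) ∧
    ∀ t ∈ Icc (0 : ℝ) 1, HasDerivWithinAt J' (D.R t (J t)) (Icc 0 1) t

variable {D}

theorem IsSolution.isJacobi {J J' : ℝ → Rn n} (h : D.IsSolution J J') : D.IsJacobi J J' :=
  ⟨h.1, h.2.1⟩

variable (D)

/-- The coefficient of the first order system in `(J, J')` equivalent to `J'' = R J`. -/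
def systemCoeff (t : ℝ) : Rn n × Rn n →L[ℝ] Rn n × Rn n :=
  (ContinuousLinearMap.snd ℝ (Rn n) (Rn n)).prod
    ((D.R t).comp (ContinuousLinearMap.fst ℝ (Rn n) (Rn n)))

theorem continuousOn_systemCoeff : ContinuousOn D.systemCoeff (Icc 0 1) := by
  have h : ContinuousOn
      (fun t => (D.R t).comp (ContinuousLinearMap.fst ℝ (Rn n) (Rn n))) (Icc 0 1) :=
    D.R_cont.clm_comp continuousOn_const
  exact (ContinuousLinearMap.prodₗᵢ (𝕜 := ℝ) (E := Rn n × Rn n) (F := Rn n) (G := Rn n)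
    ℝ).continuous.comp_continuousOn (continuousOn_const.prodMk h)

theorem IsJacobi.system {D : MorseSturmData n} {J J' : ℝ → Rn n} (h : D.IsJacobi J J') :
    ∀ t ∈ Icc (0 : ℝ) 1, HasDerivWithinAt (fun t => (J t, J' t))
      (D.systemCoeff t (J t, J' t)) (Icc 0 1) t :=
  fun t ht => (h.1 t ht).prodMk (h.2 t ht)

theorem exists_isJacobi {s : ℝ} (hs : s ∈ Icc (0 : ℝ) 1) (x ξ : Rn n) :
    ∃ J J', D.IsJacobi J J' ∧ J s = x ∧ J' s = ξ := by
  obtain ⟨y, hys, hy⟩ := exists_linear_ode_solution D.continuousOn_systemCoeff hs (x, ξ)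
  refine ⟨fun t => (y t).1, fun t => (y t).2, ⟨fun t ht => ?_, fun t ht => ?_⟩,
    congrArg Prod.fst hys, congrArg Prod.snd hys⟩
  · exact (ContinuousLinearMap.fst ℝ (Rn n) (Rn n)).hasFDerivAt.comp_hasDerivWithinAt t (hy t ht)
  · exact (ContinuousLinearMap.snd ℝ (Rn n) (Rn n)).hasFDerivAt.comp_hasDerivWithinAt t (hy t ht)

variable {D}

theorem IsJacobi.unique {J J' K K' : ℝ → Rn n} (hJ : D.IsJacobi J J') (hK : D.IsJacobi K K')
    {s : ℝ} (hs : s ∈ Icc (0 : ℝ) 1) (h : J s = K s) (h' : J' s = K' s) {t : ℝ}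
    (ht : t ∈ Icc (0 : ℝ) 1) : J t = K t ∧ J' t = K' t := by
  have := linear_ode_unique D.continuousOn_systemCoeff hJ.system hK.system hs
    (by simp only [h, h']) ht
  simpa using this

theorem IsJacobi.zero : D.IsJacobi 0 0 :=
  ⟨fun t _ => hasDerivWithinAt_const t _ (0 : Rn n), fun t _ => by
    simp only [Pi.zero_apply, map_zero]
    exact hasDerivWithinAt_const t _ (0 : Rn n)⟩

theorem hasDerivWithinAt_bilin (b : LinearMap.BilinForm ℝ (Rn n)) {u v : ℝ → Rn n} {u' v' : Rn n}
    {s : Set ℝ} {t : ℝ} (hu : HasDerivWithinAt u u' s t) (hv : HasDerivWithinAt v v' s t) :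
    HasDerivWithinAt (fun t => b (u t) (v t)) (b (u t) v' + b u' (v t)) s t :=
  ContinuousLinearMap.hasDerivWithinAt_of_bilinear (B := LinearMap.toContinuousBilinearMap b) hu hv

/-- The `g`-symplectic product of two solutions of `J'' = R J` is constant. -/
theorem IsJacobi.wronskian_eq {J J' K K' : ℝ → Rn n} (hJ : D.IsJacobi J J')
    (hK : D.IsJacobi K K') {t : ℝ} (ht : t ∈ Icc (0 : ℝ) 1) :
    D.g (J' t) (K t) - D.g (J t) (K' t) = D.g (J' 0) (K 0) - D.g (J 0) (K' 0) := by
  have hd : ∀ t ∈ Icc (0 : ℝ) 1, HasDerivWithinAt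
      (fun t => D.g (J' t) (K t) - D.g (J t) (K' t)) 0 (Icc 0 1) t := fun t ht => by
    have h1 := (hasDerivWithinAt_bilin D.g (hJ.2 t ht) (hK.1 t ht)).sub
      (hasDerivWithinAt_bilin D.g (hJ.1 t ht) (hK.2 t ht))
    refine h1.congr_deriv ?_
    rw [D.R_symm t ht]; ring
  exact constant_of_has_deriv_right_zero (fun t ht => (hd t ht).continuousWithinAt)
    (fun t ht => (hd t (Ico_subset_Icc_self ht)).mono_of_mem_nhdsWithin
      (Filter.mem_of_superset (Icc_mem_nhdsGE ht.2) (Icc_subset_Icc_left ht.1))) t ht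

theorem isRefl_g : D.g.IsRefl := fun x y h => by rw [D.g_symm]; exact h

/-- `𝕁[t]^⊥` consists of the derivatives at `t` of the `(P,S)`-solutions vanishing at `t`, since the
initial conditions define a Lagrangian subspace. -/
theorem mem_jPerp_iff {t : ℝ} (ht : t ∈ Icc (0 : ℝ) 1) {ξ : Rn n} :
    ξ ∈ D.jPerp t ↔ ∃ J J', D.IsSolution J J' ∧ J t = 0 ∧ J' t = ξ := by
  constructor
  · intro hξ
    obtain ⟨J, J', hJ, hJt, hJ't⟩ := D.exists_isJacobi ht 0 ξ
    -- the initial data of `J` is symplectically orthogonal to all admissible initial data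
    have key : ∀ x ξ' : Rn n, ∀ hx : x ∈ D.P, ξ' + D.S ⟨x, hx⟩ ∈ D.g.orthogonal D.P →
        D.g (J' 0) x = D.g (J 0) ξ' := fun x ξ' hx hξ' => by
      obtain ⟨K, K', hK, hK0, hK'0⟩ := D.exists_isJacobi (left_mem_Icc.2 zero_le_one) x ξ'
      have hKs : D.IsSolution K K' := ⟨hK.1, hK.2, by rw [hK0]; exact hx, by
        simp only [hK0, hK'0]; exact hξ'⟩
      have h1 := hJ.wronskian_eq hK ht
      have h2 : D.g (K t) ξ = 0 := hξ _ ⟨K, K', hKs, rfl⟩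
      rw [hJt, hJ't, D.g_symm ξ, h2, map_zero, LinearMap.zero_apply, hK0, hK'0] at h1
      linarith
    have hJ0 : J 0 ∈ D.P := by
      rw [← LinearMap.BilinForm.orthogonal_orthogonal D.g_nondeg isRefl_g D.P]
      intro ξ' hξ'
      have h1 := key 0 ξ' D.P.zero_mem (by
        rw [show (⟨0, D.P.zero_mem⟩ : D.P) = 0 from rfl, map_zero, Submodule.coe_zero, add_zero]
        exact hξ')
      rw [map_zero] at h1
      rw [D.g_symm]
      exact h1.symm
    refine ⟨J, J', ⟨hJ.1, hJ.2, hJ0, fun x hx => ?_⟩, hJt, hJ't⟩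
    have h1 := key x (-(D.S ⟨x, hx⟩ : Rn n)) hx (by
      rw [neg_add_cancel]; exact Submodule.zero_mem _)
    have h2 := D.S_symm ⟨J 0, hJ0⟩ ⟨x, hx⟩
    rw [D.g_symm, map_add, LinearMap.add_apply, h1, h2, map_neg]
    simp
  · rintro ⟨J, J', hJ, hJt, rfl⟩
    rintro _ ⟨K, K', hK, rfl⟩
    obtain ⟨hJ0, hJ0'⟩ := hJ.2.2
    obtain ⟨hK0, hK0'⟩ := hK.2.2
    have h1 := hJ.isJacobi.wronskian_eq hK.isJacobi ht
    have h2 : D.g (K 0) (J' 0 + D.S ⟨J 0, hJ0⟩) = 0 := hJ0' _ hK0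
    have h3 : D.g (J 0) (K' 0 + D.S ⟨K 0, hK0⟩) = 0 := hK0' _ hJ0
    have h4 := D.S_symm ⟨J 0, hJ0⟩ ⟨K 0, hK0⟩
    simp only at h4
    rw [map_add] at h2 h3
    rw [hJt, map_zero, LinearMap.zero_apply, D.g_symm (J' 0), D.g_symm (J' t)] at h1
    rw [D.g_symm] at h4
    linarith

theorem isFocal_iff_jPerp_ne_bot {t : ℝ} : D.IsFocal t ↔ t ∈ Ioc (0 : ℝ) 1 ∧ D.jPerp t ≠ ⊥ := by
  constructor
  · rintro ⟨ht, J, J', hJ, ⟨s, hs, hJs⟩, hJt⟩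
    refine ⟨ht, fun hbot => hJs ?_⟩
    have h1 : J' t ∈ D.jPerp t := (mem_jPerp_iff ⟨ht.1.le, ht.2⟩).2 ⟨J, J', hJ, hJt, rfl⟩
    rw [hbot, Submodule.mem_bot] at h1
    exact (hJ.isJacobi.unique IsJacobi.zero ⟨ht.1.le, ht.2⟩ hJt h1 hs).1
  · rintro ⟨ht, h⟩
    obtain ⟨ξ, hξ, h0⟩ := Submodule.exists_mem_ne_zero_of_ne_bot h
    obtain ⟨J, J', hJ, hJt, rfl⟩ := (mem_jPerp_iff ⟨ht.1.le, ht.2⟩).1 hξ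
    refine ⟨ht, J, J', hJ, ?_, hJt⟩
    by_contra! hcon
    refine h0 ?_
    have htI : t ∈ Icc (0 : ℝ) 1 := ⟨ht.1.le, ht.2⟩
    have h1 : HasDerivWithinAt J 0 (Icc 0 1) t :=
      (hasDerivWithinAt_const t _ (0 : Rn n)).congr_of_mem (fun s hs => hcon s hs) htI
    exact (uniqueDiffOn_Icc zero_lt_one t htI).eq_deriv _ (hJ.1 t htI) h1

/-- `g` is nondegenerate on `𝕁[t]^⊥` as soon as it is on `𝕁[t]`. -/
theorem eq_zero_of_mem_jPerp {t : ℝ} (h : (D.g.restrict (D.jSpace t)).Nondegenerate) {ξ : Rn n}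
    (hξ : ξ ∈ D.jPerp t) (h0 : ∀ η ∈ D.jPerp t, D.g ξ η = 0) : ξ = 0 := by
  have h1 := LinearMap.BilinForm.isCompl_orthogonal_of_restrict_nondegenerate isRefl_g h
  have h2 : ξ ∈ D.jSpace t := by
    rw [← LinearMap.BilinForm.orthogonal_orthogonal D.g_nondeg isRefl_g (D.jSpace t)]
    intro η hη
    rw [D.g_symm]
    exact h0 η hη
  exact (Submodule.disjoint_def.1 h1.disjoint) ξ h2 hξ

end MorseSturmData

/-! ### Absolutely continuous curves and their derivatives -/

section AbsolutelyContinuous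

variable {E : Type*} [NormedAddCommGroup E]

theorem AbsolutelyContinuousOnInterval.of_dist_le {F : Type*} [PseudoMetricSpace F]
    {f : ℝ → E} {g : ℝ → F} {a b : ℝ}
    (hg : AbsolutelyContinuousOnInterval g a b)
    (h : ∀ x ∈ uIcc a b, ∀ y ∈ uIcc a b, dist (f x) (f y) ≤ dist (g x) (g y)) :
    AbsolutelyContinuousOnInterval f a b := by
  rw [absolutelyContinuousOnInterval_iff] at hg ⊢
  intro ε hε
  obtain ⟨δ, hδ, hg⟩ := hg ε hε
  refine ⟨δ, hδ, fun E hE hlt => lt_of_le_of_lt (Finset.sum_le_sum fun i hi => ?_) (hg E hE hlt)⟩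
  exact h _ (hE.1 i hi).1 _ (hE.1 i hi).2

/-- The Cauchy–Schwarz inequality for the integral of a norm over `[0,t]`. -/
theorem sq_integral_norm_le {f : ℝ → E} {t : ℝ} (ht : 0 ≤ t)
    (hf : MemLp f 2 (volume.restrict (Icc 0 t))) :
    (∫ s in Icc 0 t, ‖f s‖) ^ 2 ≤ t * ∫ s in Icc 0 t, ‖f s‖ ^ 2 := by
  have h1 : Integrable (fun s => ‖f s‖) (volume.restrict (Icc 0 t)) :=
    (hf.integrable one_le_two).norm
  have h2 : Integrable (fun s => ‖f s‖ ^ 2) (volume.restrict (Icc 0 t)) :=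
    (memLp_two_iff_integrable_sq_norm hf.1).1 hf
  set a := ∫ s in Icc 0 t, ‖f s‖
  rcases ht.eq_or_lt with rfl | ht
  · simp [a]
  -- the variance of `‖f‖` is nonnegative
  have h3 : 0 ≤ ∫ s in Icc 0 t, (‖f s‖ - a / t) ^ 2 := integral_nonneg fun s => sq_nonneg _
  have h4 : ∫ s in Icc 0 t, (‖f s‖ - a / t) ^ 2 =
      (∫ s in Icc 0 t, ‖f s‖ ^ 2) - 2 * (a / t) * a + (a / t) ^ 2 * t := by
    have e : ∀ s, (‖f s‖ - a / t) ^ 2 = ‖f s‖ ^ 2 - 2 * (a / t) * ‖f s‖ + (a / t) ^ 2 :=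
      fun s => by ring
    simp only [e]
    have h5 : Integrable (fun s => 2 * (a / t) * ‖f s‖) (volume.restrict (Icc 0 t)) :=
      h1.const_mul _
    have h6 : Integrable (fun s => ‖f s‖ ^ 2 - 2 * (a / t) * ‖f s‖) (volume.restrict (Icc 0 t)) :=
      h2.sub h5
    rw [integral_add h6 (integrable_const _), integral_sub h2 h5, integral_const_mul]
    simp [ht.le, mul_comm, a]
  rw [h4] at h3
  have h5 : 2 * (a / t) * a - (a / t) ^ 2 * t = a ^ 2 / t := by field_simp; ring
  have h6 : a ^ 2 / t ≤ ∫ s in Icc 0 t, ‖f s‖ ^ 2 := by linarith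
  rwa [div_le_iff₀ ht, mul_comm] at h6

variable [NormedSpace ℝ E]

theorem IntervalIntegrable.absolutelyContinuousOnInterval_integral {f : ℝ → E} {a b c : ℝ}
    (h : IntervalIntegrable f volume a b) (hc : c ∈ uIcc a b) :
    AbsolutelyContinuousOnInterval (fun x => ∫ v in c..x, f v) a b := by
  refine (h.norm.absolutelyContinuousOnInterval_intervalIntegral hc).of_dist_le
    fun x hx y hy => ?_
  have hcx : IntervalIntegrable f volume c x := h.mono_set (uIcc_subset_uIcc hc hx)
  have hcy : IntervalIntegrable f volume c y := h.mono_set (uIcc_subset_uIcc hc hy)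
  rw [dist_eq_norm, dist_eq_norm, intervalIntegral.integral_interval_sub_left hcx hcy,
    intervalIntegral.integral_interval_sub_left hcx.norm hcy.norm]
  exact intervalIntegral.norm_integral_le_abs_integral_norm

/-- Fundamental theorem of calculus for vector valued absolutely continuous curves. -/
theorem AbsolutelyContinuousOnInterval.integral_deriv_eq [CompleteSpace E] {f : ℝ → E}
    {a b : ℝ} (hf : AbsolutelyContinuousOnInterval f a b)
    (hd : ∀ᵐ x, x ∈ uIcc a b → DifferentiableAt ℝ f x)
    (hi : IntervalIntegrable (deriv f) volume a b) {x y : ℝ} (hx : x ∈ uIcc a b)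
    (hy : y ∈ uIcc a b) : ∫ v in x..y, deriv f v = f y - f x := by
  have h1 := hf.sub (hi.absolutelyContinuousOnInterval_integral (c := x) hx)
  obtain ⟨C, hC⟩ := h1.const_of_ae_hasDerivAt_zero (by
    filter_upwards [hd, hi.ae_hasDerivAt_integral] with z h2 h3 hz
    have := (h2 hz).hasDerivAt.sub (h3 hz x hx)
    rwa [sub_self] at this)
  have h2 := hC y hy
  have h3 := hC x hx
  simp only [Pi.sub_apply, intervalIntegral.integral_same, sub_zero] at h2 h3
  rw [← h2] at h3
  rw [h3]; abel

end AbsolutelyContinuous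

/-! ### The Hilbert space `H¹_P([0,t], ℝⁿ)` -/

namespace H1P

variable {n : ℕ} {P : Submodule ℝ (Rn n)} {t : ℝ}

theorem intervalIntegrable_of_memLp {f : ℝ → Rn n} (ht : 0 ≤ t)
    (hf : MemLp f 2 (volume.restrict (Icc 0 t))) : IntervalIntegrable f volume 0 t :=
  (intervalIntegrable_iff_integrableOn_Icc_of_le ht).2 (hf.integrable one_le_two)

theorem integral_deriv_fn (V : H1P P t) {x y : ℝ} (hx : x ∈ Icc 0 t) (hy : y ∈ Icc 0 t) :
    ∫ s in x..y, deriv V.fn s = V.fn y - V.fn x := by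
  have ht : 0 ≤ t := hx.1.trans hx.2
  rw [← uIcc_of_le ht] at hx hy
  exact V.ac.integral_deriv_eq V.ac.boundedVariationOn.ae_differentiableAt_of_mem_uIcc
    (intervalIntegrable_of_memLp ht V.memLp_deriv) hx hy

theorem fn_eq_neg_integral (V : H1P P t) {s : ℝ} (hs : s ∈ Icc 0 t) :
    V.fn s = -∫ r in s..t, deriv V.fn r := by
  rw [V.integral_deriv_fn hs (right_mem_Icc.2 (hs.1.trans hs.2)), V.fn_end]; simp

theorem norm_sq_eq (V : H1P P t) : ‖V‖ ^ 2 =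
    (∫ s in Icc 0 t, ‖V.fn s‖ ^ 2) + ∫ s in Icc 0 t, ‖deriv V.fn s‖ ^ 2 := by
  rw [← real_inner_self_eq_norm_sq, inner_def]
  simp only [real_inner_self_eq_norm_sq]

theorem integral_deriv_sq_le (V : H1P P t) : ∫ s in Icc 0 t, ‖deriv V.fn s‖ ^ 2 ≤ ‖V‖ ^ 2 := by
  rw [norm_sq_eq]
  have : 0 ≤ ∫ s in Icc 0 t, ‖V.fn s‖ ^ 2 := integral_nonneg fun s => sq_nonneg _
  linarith

theorem norm_fn_sq_le (V : H1P P t) {s : ℝ} (hs : s ∈ Icc 0 t) :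
    ‖V.fn s‖ ^ 2 ≤ t * ∫ s in Icc 0 t, ‖deriv V.fn s‖ ^ 2 := by
  have ht : 0 ≤ t := hs.1.trans hs.2
  refine le_trans ?_ (sq_integral_norm_le ht V.memLp_deriv)
  gcongr
  rw [V.fn_eq_neg_integral hs, norm_neg]
  refine (intervalIntegral.norm_integral_le_integral_norm hs.2).trans ?_
  rw [intervalIntegral.integral_of_le hs.2]
  refine setIntegral_mono_set (V.memLp_deriv.integrable one_le_two).norm
    (Filter.Eventually.of_forall fun _ => norm_nonneg _) ?_
  exact (Ioc_subset_Icc_self.trans (Icc_subset_Icc_left hs.1)).eventuallyLE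

theorem norm_fn_le (V : H1P P t) (ht : t ≤ 1) {s : ℝ} (hs : s ∈ Icc 0 t) : ‖V.fn s‖ ≤ ‖V‖ := by
  refine abs_le_of_sq_le_sq' ?_ (norm_nonneg _) |>.2
  refine (V.norm_fn_sq_le hs).trans (le_trans ?_ V.integral_deriv_sq_le)
  exact mul_le_of_le_one_left (integral_nonneg fun s => sq_nonneg _) ht

theorem norm_sq_le (V : H1P P t) (ht : 0 ≤ t) :
    ‖V‖ ^ 2 ≤ (t ^ 2 + 1) * ∫ s in Icc 0 t, ‖deriv V.fn s‖ ^ 2 := by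
  rw [norm_sq_eq]
  set a := ∫ s in Icc 0 t, ‖deriv V.fn s‖ ^ 2
  have h1 : ∫ s in Icc 0 t, ‖V.fn s‖ ^ 2 ≤ ∫ s in Icc 0 t, t * a := by
    refine setIntegral_mono_on ((memLp_two_iff_integrable_sq_norm V.memLp_fn.1).1 V.memLp_fn)
      (integrableOn_const (by simp)) measurableSet_Icc fun s hs => V.norm_fn_sq_le hs
  have h2 : ∫ s in Icc 0 t, t * a = t ^ 2 * a := by
    simp [ht]; ring
  linarith

/-- The primitive, vanishing at `t`, of a square integrable curve. -/
def primitive (f : ℝ → Rn n) (t : ℝ) : ℝ → Rn n :=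
  (Icc 0 t).indicator fun s => -∫ r in s..t, f r

theorem deriv_primitive_ae {f : ℝ → Rn n} (ht : 0 ≤ t)
    (hf : MemLp f 2 (volume.restrict (Icc 0 t))) :
    deriv (primitive f t) =ᵐ[volume.restrict (Icc 0 t)] f := by
  have hi := intervalIntegrable_of_memLp ht hf
  rw [Filter.EventuallyEq, ae_restrict_iff' measurableSet_Icc]
  filter_upwards [hi.ae_hasDerivAt_integral, Measure.ae_ne volume 0, Measure.ae_ne volume t]
    with s h1 h2 h3 hs
  have hs' : s ∈ Ioo 0 t := ⟨lt_of_le_of_ne hs.1 (Ne.symm h2), lt_of_le_of_ne hs.2 h3⟩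
  have hsu : s ∈ uIcc 0 t := by rwa [uIcc_of_le ht]
  refine HasDerivAt.deriv ((h1 hsu t right_mem_uIcc).congr_of_eventuallyEq ?_)
  filter_upwards [Icc_mem_nhds hs'.1 hs'.2] with r hr
  rw [primitive, indicator_of_mem hr, intervalIntegral.integral_symm, neg_neg]

theorem primitive_mem {f : ℝ → Rn n} (ht : 0 ≤ t)
    (hf : MemLp f 2 (volume.restrict (Icc 0 t))) (hP : ∫ s in (0 : ℝ)..t, f s ∈ P) :
    primitive f t ∈ h1Submodule P t := by
  have hi := intervalIntegrable_of_memLp ht hf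
  have hval : ∀ s ∈ Icc 0 t, primitive f t s = ∫ r in t..s, f r := fun s hs => by
    rw [primitive, indicator_of_mem hs, intervalIntegral.integral_symm, neg_neg]
  refine ⟨fun s hs => indicator_of_notMem hs _, ?_, ?_, ?_, ?_⟩
  · refine (hi.absolutelyContinuousOnInterval_integral (c := t) right_mem_uIcc).of_dist_le
      fun x hx y hy => ?_
    rw [uIcc_of_le ht] at hx hy
    rw [hval x hx, hval y hy]
  · exact (memLp_congr_ae (deriv_primitive_ae ht hf)).2 hf
  · rw [hval 0 (left_mem_Icc.2 ht), intervalIntegral.integral_symm]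
    exact P.neg_mem hP
  · rw [hval t (right_mem_Icc.2 ht), intervalIntegral.integral_same]

/-- The element of `H¹_P([0,t], ℝⁿ)` with given square integrable derivative. -/
def ofDeriv {f : ℝ → Rn n} (ht : 0 ≤ t) (hf : MemLp f 2 (volume.restrict (Icc 0 t)))
    (hP : ∫ s in (0 : ℝ)..t, f s ∈ P) : H1P P t :=
  ⟨primitive f t, primitive_mem ht hf hP⟩

theorem ofDeriv_fn {f : ℝ → Rn n} (ht : 0 ≤ t) (hf : MemLp f 2 (volume.restrict (Icc 0 t)))
    (hP : ∫ s in (0 : ℝ)..t, f s ∈ P) {s : ℝ} (hs : s ∈ Icc 0 t) :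
    (ofDeriv ht hf hP).fn s = -∫ r in s..t, f r := by
  change primitive f t s = _
  rw [primitive, indicator_of_mem hs]

theorem deriv_ofDeriv_ae {f : ℝ → Rn n} (ht : 0 ≤ t)
    (hf : MemLp f 2 (volume.restrict (Icc 0 t))) (hP : ∫ s in (0 : ℝ)..t, f s ∈ P) :
    deriv (ofDeriv ht hf hP).fn =ᵐ[volume.restrict (Icc 0 t)] f :=
  deriv_primitive_ae ht hf

theorem ext_fn {V W : H1P P t} (h : ∀ s ∈ Icc 0 t, V.fn s = W.fn s) : V = W := by
  apply fn_injective
  funext s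
  by_cases hs : s ∈ Icc 0 t
  · exact h s hs
  · rw [V.fn_eq_zero hs, W.fn_eq_zero hs]

/-- The derivative, as a map into `L²`. -/
def toL2 (P : Submodule ℝ (Rn n)) (t : ℝ) :
    H1P P t →ₗ[ℝ] Lp (Rn n) 2 (volume.restrict (Icc 0 t)) where
  toFun V := V.memLp_deriv.toLp
  map_add' V W := by
    rw [← MemLp.toLp_add, MemLp.toLp_eq_toLp_iff]
    exact deriv_fn_add V W
  map_smul' c V := by
    rw [RingHom.id_apply, ← MemLp.toLp_const_smul, MemLp.toLp_eq_toLp_iff, deriv_fn_smul]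

theorem norm_toL2_sq (V : H1P P t) : ‖toL2 P t V‖ ^ 2 = ∫ s in Icc 0 t, ‖deriv V.fn s‖ ^ 2 := by
  rw [← real_inner_self_eq_norm_sq, L2.inner_def]
  refine integral_congr_ae ?_
  filter_upwards [V.memLp_deriv.coeFn_toLp] with s hs
  rw [← real_inner_self_eq_norm_sq]
  change inner ℝ (V.memLp_deriv.toLp _ s) (V.memLp_deriv.toLp _ s) = _
  rw [hs]

theorem range_toL2 (ht : 0 ≤ t) : range (toL2 P t) =
    {f | ∫ s in Icc 0 t, f s ∈ P} := by
  ext f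
  constructor
  · rintro ⟨V, rfl⟩
    have h1 : ∫ s in Icc 0 t, toL2 P t V s = ∫ s in Icc 0 t, deriv V.fn s :=
      integral_congr_ae V.memLp_deriv.coeFn_toLp
    rw [mem_ofPred_eq, h1, integral_Icc_eq_integral_Ioc, ← intervalIntegral.integral_of_le ht]
    have h2 := V.fn_eq_neg_integral (left_mem_Icc.2 ht)
    rw [← neg_eq_iff_eq_neg] at h2
    rw [← h2]
    exact P.neg_mem V.fn_zero_mem
  · intro hf
    have hP : ∫ s in (0 : ℝ)..t, f s ∈ P := by
      rw [intervalIntegral.integral_of_le ht, ← integral_Icc_eq_integral_Ioc]; exact hf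
    refine ⟨ofDeriv ht (Lp.memLp f) hP, ?_⟩
    apply Lp.ext
    exact (ofDeriv ht (Lp.memLp f) hP).memLp_deriv.coeFn_toLp.trans
      (deriv_ofDeriv_ae ht (Lp.memLp f) hP)

theorem isClosed_range_toL2 (ht : 0 ≤ t) : IsClosed (range (toL2 P t)) := by
  have h : {f : Lp (Rn n) 2 (volume.restrict (Icc 0 t)) | ∫ s in Icc 0 t, f s ∈ P} =
      ⋂ c ∈ Pᗮ, {f | inner ℝ (indicatorConstLp 2 (μ := volume.restrict (Icc 0 t))
        MeasurableSet.univ (by simp) c) f = 0} := by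
    ext f
    simp only [mem_ofPred_eq, mem_iInter, L2.inner_indicatorConstLp_eq_inner_setIntegral,
      Measure.restrict_univ]
    rw [← Submodule.mem_orthogonal, Submodule.orthogonal_orthogonal]
  rw [range_toL2 ht, h]
  exact isClosed_biInter fun c _ => isClosed_eq (by fun_prop) continuous_const

/-- Taking derivatives identifies `H¹_P([0,t], ℝⁿ)` with a closed subspace of `L²`. -/
theorem completeSpace (ht : 0 ≤ t) : CompleteSpace (H1P P t) := by
  have hu : UniformContinuous (toL2 P t) :=
    (AddMonoidHomClass.lipschitz_of_bound (toL2 P t) 1 fun V => by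
      rw [one_mul]
      refine abs_le_of_sq_le_sq' ?_ (norm_nonneg _) |>.2
      rw [norm_toL2_sq]
      exact V.integral_deriv_sq_le).uniformContinuous
  have ha : AntilipschitzWith (Real.sqrt (t ^ 2 + 1)).toNNReal (toL2 P t) :=
    AddMonoidHomClass.antilipschitz_of_bound (toL2 P t) fun V => by
      rw [Real.coe_toNNReal _ (Real.sqrt_nonneg _)]
      refine abs_le_of_sq_le_sq' ?_ (by positivity) |>.2
      rw [mul_pow, Real.sq_sqrt (by positivity), norm_toL2_sq]
      exact V.norm_sq_le ht
  exact (ha.isUniformInducing hu).completeSpace (isClosed_range_toL2 ht).isComplete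

instance : CompleteSpace (H1P P 1) := completeSpace zero_le_one

/-! ### Rescaling -/

theorem integral_rescale {F : Type*} [NormedAddCommGroup F] [NormedSpace ℝ F] (f : ℝ → F)
    (ht : 0 < t) : ∫ s in Icc 0 t, f (s / t) = t • ∫ s in Icc (0 : ℝ) 1, f s := by
  rw [integral_Icc_eq_integral_Ioc, ← intervalIntegral.integral_of_le ht.le,
    intervalIntegral.integral_comp_div f ht.ne', zero_div, div_self ht.ne',
    intervalIntegral.integral_of_le zero_le_one, ← integral_Icc_eq_integral_Ioc]

theorem phi_fn (t : Ioc (0 : ℝ) 1) (V : H1P P 1) (s : ℝ) : (phi P t V).fn s = V.fn (s / t) := rfl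

theorem deriv_phi_fn (t : Ioc (0 : ℝ) 1) (V : H1P P 1) (s : ℝ) :
    deriv (phi P t V).fn s = (t : ℝ)⁻¹ • deriv V.fn (s / t) := by
  have : (phi P t V).fn = fun s => V.fn ((t : ℝ)⁻¹ * s) := by
    funext r; rw [phi_fn, div_eq_inv_mul]
  rw [this, deriv_comp_mul_left, div_eq_inv_mul]

theorem phi_surjective (t : Ioc (0 : ℝ) 1) : Function.Surjective (phi P t) := by
  intro V
  have ht : 0 < (t : ℝ) := t.2.1
  have hm : MemLp (fun u => (t : ℝ) • deriv V.fn (t * u)) 2 (volume.restrict (Icc 0 1)) := by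
    have hmeas : AEStronglyMeasurable (fun u => (t : ℝ) • deriv V.fn (t * u))
        (volume.restrict (Icc 0 1)) :=
      (((stronglyMeasurable_deriv V.fn).comp_measurable
        (measurable_const_mul (t : ℝ))).const_smul (t : ℝ)).aestronglyMeasurable
    rw [memLp_two_iff_integrable_sq_norm hmeas]
    have h3 := (memLp_two_iff_integrable_sq_norm V.memLp_deriv.1).1 V.memLp_deriv
    have h6 : IntervalIntegrable (fun s => ‖deriv V.fn s‖ ^ 2) volume 0 t := by
      rw [intervalIntegrable_iff_integrableOn_Icc_of_le ht.le]; exact h3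
    have h7 := h6.comp_mul_left (c := t)
    rw [zero_div, div_self ht.ne', intervalIntegrable_iff_integrableOn_Icc_of_le zero_le_one] at h7
    refine (h7.const_mul ((t : ℝ) ^ 2)).congr (Filter.Eventually.of_forall fun s => ?_)
    simp [norm_smul, mul_pow]
  have hint : ∀ u ∈ Icc (0 : ℝ) 1, -∫ r in u..1, (t : ℝ) • deriv V.fn (t * r) = V.fn (t * u) := by
    intro u hu
    have htu : (t : ℝ) * u ∈ Icc (0 : ℝ) t :=
      ⟨mul_nonneg ht.le hu.1, mul_le_of_le_one_right ht.le hu.2⟩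
    rw [intervalIntegral.integral_smul,
      intervalIntegral.integral_comp_mul_left (fun r => deriv V.fn r) ht.ne', smul_smul,
      mul_inv_cancel₀ ht.ne', one_smul, mul_one, ← V.fn_eq_neg_integral htu]
  have hP : ∫ r in (0 : ℝ)..1, (t : ℝ) • deriv V.fn (t * r) ∈ P := by
    have := hint 0 (left_mem_Icc.2 zero_le_one)
    rw [mul_zero, neg_eq_iff_eq_neg] at this
    rw [this]
    exact P.neg_mem V.fn_zero_mem
  refine ⟨ofDeriv zero_le_one hm hP, ext_fn fun s hs => ?_⟩
  have hst : s / t ∈ Icc (0 : ℝ) 1 := ⟨div_nonneg hs.1 ht.le, (div_le_one ht).2 hs.2⟩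
  rw [phi_fn, ofDeriv_fn zero_le_one hm hP hst, hint _ hst, mul_div_cancel₀ _ ht.ne']

theorem norm_sq_le_phi (t : Ioc (0 : ℝ) 1) (V : H1P P 1) :
    ‖V‖ ^ 2 ≤ (t : ℝ)⁻¹ * ‖phi P t V‖ ^ 2 := by
  have ht : 0 < (t : ℝ) := t.2.1
  have h1 := integral_rescale (fun s => ‖V.fn s‖ ^ 2) ht
  have h2 := integral_rescale (fun s => ‖(t : ℝ)⁻¹ • deriv V.fn s‖ ^ 2) ht
  rw [norm_sq_eq V, norm_sq_eq (phi P t V)]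
  simp only [phi_fn, deriv_phi_fn]
  rw [h1, h2]
  simp only [norm_smul, mul_pow, integral_const_mul, smul_eq_mul, norm_inv, Real.norm_eq_abs,
    abs_of_pos ht]
  set a := ∫ s in Icc (0 : ℝ) 1, ‖V.fn s‖ ^ 2
  set b := ∫ s in Icc (0 : ℝ) 1, ‖deriv V.fn s‖ ^ 2
  have hb : 0 ≤ b := integral_nonneg fun s => sq_nonneg _
  have h3 : (t : ℝ)⁻¹ * (t * a + t * ((t : ℝ)⁻¹ ^ 2 * b)) = a + (t : ℝ)⁻¹ ^ 2 * b := by field_simp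
  rw [h3]
  have h4 : 1 ≤ (t : ℝ)⁻¹ ^ 2 := one_le_pow₀ ((one_le_inv₀ ht).2 t.2.2)
  nlinarith

theorem phi_injective (t : Ioc (0 : ℝ) 1) : Function.Injective (phi P t) := by
  rw [← LinearMap.ker_eq_bot, eq_bot_iff]
  intro V hV
  have h := norm_sq_le_phi t V
  rw [LinearMap.mem_ker.1 hV, norm_zero] at h
  simpa using h

end H1P

/-! ### Continuous bilinear forms on `H¹_P([0,1], ℝⁿ)` -/

section Forms

/-- The additive group underlying the normed group `H¹_P([0,t], ℝⁿ)`. It is by definition the given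
additive group, but spaces of bounded forms are only found to be normed along this path. -/
abbrev H1P.addCommGroupOfNormed {n : ℕ} (P : Submodule ℝ (Rn n)) (t : ℝ) : AddCommGroup (H1P P t) :=
  NormedAddCommGroup.toAddCommGroup

/-- The module structure of `H¹_P([0,t], ℝⁿ)` as a normed space. -/
abbrev H1P.moduleOfNormed {n : ℕ} (P : Submodule ℝ (Rn n)) (t : ℝ) :
    @Module ℝ (H1P P t) _ (H1P.addCommGroupOfNormed P t).toAddCommMonoid :=
  NormedSpace.toModule

attribute [local instance] H1P.addCommGroupOfNormed H1P.moduleOfNormed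

theorem LinearMap.BilinForm.norm_le_of_le_sq_add_sq {X : Type*} [NormedAddCommGroup X]
    [NormedSpace ℝ X] (B : LinearMap.BilinForm ℝ X) {C : ℝ}
    (h : ∀ x y, |B x y| ≤ C * (‖x‖ ^ 2 + ‖y‖ ^ 2)) (x y : X) : ‖B x y‖ ≤ 2 * C * ‖x‖ * ‖y‖ := by
  rcases eq_or_ne x 0 with rfl | hx
  · simp
  rcases eq_or_ne y 0 with rfl | hy
  · simp
  have hx' : 0 < ‖x‖ := norm_pos_iff.2 hx
  have hy' : 0 < ‖y‖ := norm_pos_iff.2 hy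
  have h1 := h (‖x‖⁻¹ • x) (‖y‖⁻¹ • y)
  rw [map_smul, map_smul, LinearMap.smul_apply, smul_eq_mul, smul_eq_mul, norm_smul, norm_smul,
    norm_inv, norm_inv, norm_norm, norm_norm, inv_mul_cancel₀ hx'.ne', inv_mul_cancel₀ hy'.ne',
    abs_mul, abs_mul, abs_inv, abs_inv, abs_norm, abs_norm] at h1
  rw [← mul_assoc, ← mul_inv, inv_mul_le_iff₀ (by positivity)] at h1
  rw [Real.norm_eq_abs]
  linarith

namespace H1P

variable {n : ℕ} {P : Submodule ℝ (Rn n)}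

theorem abs_bilin_le (g : LinearMap.BilinForm ℝ (Rn n)) (x y : Rn n) :
    |g x y| ≤ ‖LinearMap.toContinuousBilinearMap g‖ * ‖x‖ * ‖y‖ :=
  (LinearMap.toContinuousBilinearMap g).le_opNorm₂ x y

theorem memLp_clm {A : C(Icc (0 : ℝ) 1, Rn n →L[ℝ] Rn n)} (V : H1P P 1) :
    MemLp (fun u => IccExtend zero_le_one A u (V.fn u)) 2 (volume.restrict (Icc 0 1)) := by
  have hc : ContinuousOn (fun u => IccExtend zero_le_one A u (V.fn u)) (Icc 0 1) :=
    A.continuous.Icc_extend'.continuousOn.clm_apply V.continuousOn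
  obtain ⟨C, hC⟩ := isCompact_Icc.exists_bound_of_continuousOn hc
  refine MemLp.of_bound (hc.aestronglyMeasurable measurableSet_Icc) C ?_
  rw [ae_restrict_iff' measurableSet_Icc]
  exact Filter.Eventually.of_forall hC

theorem integrable_potential (g : LinearMap.BilinForm ℝ (Rn n))
    (A : C(Icc (0 : ℝ) 1, Rn n →L[ℝ] Rn n)) (V W : H1P P 1) :
    Integrable (fun u => g (IccExtend zero_le_one A u (V.fn u)) (W.fn u))
      (volume.restrict (Icc 0 1)) :=
  integrable_bilin g (memLp_clm V) W.memLp_fn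

theorem abs_potential_le (g : LinearMap.BilinForm ℝ (Rn n))
    (A : C(Icc (0 : ℝ) 1, Rn n →L[ℝ] Rn n)) (V W : H1P P 1) :
    ‖∫ u in Icc 0 1, g (IccExtend zero_le_one A u (V.fn u)) (W.fn u)‖ ≤
      ‖LinearMap.toContinuousBilinearMap g‖ * ‖A‖ * ‖V‖ * ‖W‖ := by
  have h : ∀ u ∈ Icc (0 : ℝ) 1, ‖g (IccExtend zero_le_one A u (V.fn u)) (W.fn u)‖ ≤
      ‖LinearMap.toContinuousBilinearMap g‖ * ‖A‖ * ‖V‖ * ‖W‖ := fun u hu => by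
    refine (abs_bilin_le g _ _).trans ?_
    have h1 : ‖IccExtend zero_le_one A u (V.fn u)‖ ≤ ‖A‖ * ‖V‖ := by
      refine (ContinuousLinearMap.le_opNorm _ _).trans ?_
      exact mul_le_mul (A.norm_coe_le_norm _) (V.norm_fn_le le_rfl hu) (norm_nonneg (V.fn u))
        (norm_nonneg A)
    have h2 := W.norm_fn_le le_rfl hu
    calc _ ≤ ‖LinearMap.toContinuousBilinearMap g‖ * (‖A‖ * ‖V‖) * ‖W‖ := by gcongr
      _ = _ := by ring
  simpa using norm_setIntegral_le_of_norm_le_const (μ := volume) (s := Icc (0 : ℝ) 1)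
    (by simp) h

/-- The form `∫₀¹ g(A V, W)` on `H¹_P([0,1], ℝⁿ)` for a continuous curve `A` of operators. -/
def potentialForm (P : Submodule ℝ (Rn n)) (g : LinearMap.BilinForm ℝ (Rn n))
    (A : C(Icc (0 : ℝ) 1, Rn n →L[ℝ] Rn n)) : H1P P 1 →L[ℝ] H1P P 1 →L[ℝ] ℝ :=
  LinearMap.mkContinuous₂ (LinearMap.mk₂ ℝ
    (fun V W => ∫ u in Icc 0 1, g (IccExtend zero_le_one A u (V.fn u)) (W.fn u))
    (fun U V W => by
      rw [← integral_add (integrable_potential g A U W) (integrable_potential g A V W)]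
      simp [fn_add])
    (fun c V W => by
      rw [smul_eq_mul, ← integral_const_mul]
      simp [fn_smul])
    (fun V U W => by
      rw [← integral_add (integrable_potential g A V U) (integrable_potential g A V W)]
      simp [fn_add])
    (fun c V W => by
      rw [smul_eq_mul, ← integral_const_mul]
      simp [fn_smul])) (‖LinearMap.toContinuousBilinearMap g‖ * ‖A‖) (abs_potential_le g A)

theorem potentialForm_apply (g : LinearMap.BilinForm ℝ (Rn n))
    (A : C(Icc (0 : ℝ) 1, Rn n →L[ℝ] Rn n)) (V W : H1P P 1) :
    potentialForm P g A V W =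
      ∫ u in Icc 0 1, g (IccExtend zero_le_one A u (V.fn u)) (W.fn u) := rfl

/-- `potentialForm`, as a continuous linear function of the curve of operators. -/
def potentialCLM (P : Submodule ℝ (Rn n)) (g : LinearMap.BilinForm ℝ (Rn n)) :
    C(Icc (0 : ℝ) 1, Rn n →L[ℝ] Rn n) →L[ℝ] H1P P 1 →L[ℝ] H1P P 1 →L[ℝ] ℝ :=
  LinearMap.mkContinuous
    { toFun := potentialForm P g
      map_add' := fun A B => by
        ext V W
        rw [add_apply, add_apply, potentialForm_apply, potentialForm_apply, potentialForm_apply,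
          ← integral_add (integrable_potential g A V W) (integrable_potential g B V W)]
        simp [IccExtend]
      map_smul' := fun c A => by
        ext V W
        rw [RingHom.id_apply, smul_apply, smul_apply, potentialForm_apply, potentialForm_apply,
          smul_eq_mul, ← integral_const_mul]
        simp [IccExtend] } ‖LinearMap.toContinuousBilinearMap g‖ fun A =>
    ContinuousLinearMap.opNorm_le_bound₂ _ (by positivity) (abs_potential_le g A)

theorem potentialCLM_apply (g : LinearMap.BilinForm ℝ (Rn n))
    (A : C(Icc (0 : ℝ) 1, Rn n →L[ℝ] Rn n)) (V W : H1P P 1) :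
    potentialCLM P g A V W =
      ∫ u in Icc 0 1, g (IccExtend zero_le_one A u (V.fn u)) (W.fn u) := rfl

end H1P

/-! ### Rescaling a `C¹` curve -/

section Rescale

theorem ContinuousLinearMap.hasDerivAt_comp {E F : Type*} [NormedAddCommGroup E]
    [NormedSpace ℝ E] [NormedAddCommGroup F] [NormedSpace ℝ F] (L : E →L[ℝ] F) {c : ℝ → E} {c' : E}
    {t : ℝ} (h : HasDerivAt c c' t) : HasDerivAt (fun t => L (c t)) (L c') t :=
  L.hasFDerivAt.comp_hasDerivAt t h

variable {F : Type*} [NormedAddCommGroup F] [NormedSpace ℝ F]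

theorem hasDerivAt_quadratic (k b : F) {p : ℝ → F} {p' : F} {t : ℝ} (h : HasDerivAt p p' t) :
    HasDerivAt (fun t => k + t ^ 2 • p t - t • b) (t ^ 2 • p' + (2 * t) • p t - b) t := by
  have h2 : HasDerivAt (fun t : ℝ => t ^ 2) (2 * t) t := by
    simpa using hasDerivAt_pow 2 t
  have h4 := (hasDerivAt_id t).smul_const b
  rw [one_smul] at h4
  exact ((h2.smul h).const_add k).sub h4

/-- The restriction to `[0,1]` of `u ↦ f (t u)`. -/
def rescaledCurve {f : ℝ → F} (hf : Continuous f) (t : ℝ) : C(Icc (0 : ℝ) 1, F) :=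
  ⟨fun u => f (t * u), by fun_prop⟩

/-- The restriction to `[0,1]` of `u ↦ u f (t u)`. -/
def rescaledDeriv {f : ℝ → F} (hf : Continuous f) (t : ℝ) : C(Icc (0 : ℝ) 1, F) :=
  ⟨fun u => (u : ℝ) • f (t * u), by fun_prop⟩

theorem hasDerivAt_rescaledCurve [CompleteSpace F] {f f' : ℝ → F} (hf' : Continuous f')
    (h : ∀ t, HasDerivAt f (f' t) t) (hf : Continuous f) (t : ℝ) :
    HasDerivAt (rescaledCurve hf) (rescaledDeriv hf' t) t := by
  have hc : Continuous (rescaledDeriv hf') :=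
    ContinuousMap.continuous_of_continuous_uncurry _ (by
      change Continuous fun p : ℝ × Icc (0 : ℝ) 1 => (p.2 : ℝ) • f' (p.1 * p.2)
      fun_prop)
  -- the curve is an integral in the Banach space of continuous curves, by evaluation at each `u`
  have he : rescaledCurve hf = fun t =>
      rescaledCurve hf 0 + ∫ s in (0 : ℝ)..t, rescaledDeriv hf' s := by
    funext t
    ext u
    have h1 : (∫ s in (0 : ℝ)..t, rescaledDeriv hf' s) u =
        ∫ s in (0 : ℝ)..t, rescaledDeriv hf' s u :=
      ((ContinuousMap.evalCLM ℝ u : C(Icc (0 : ℝ) 1, F) →L[ℝ] F).intervalIntegral_comp_comm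
        (hc.intervalIntegrable 0 t)).symm
    have h2 : ∫ s in (0 : ℝ)..t, rescaledDeriv hf' s u = f (t * u) - f (0 * u) :=
      intervalIntegral.integral_eq_sub_of_hasDerivAt (f := fun s => f (s * u)) (fun s _ => by
          have := (h (s * u)).scomp s ((hasDerivAt_id s).mul_const (u : ℝ))
          simpa [rescaledDeriv, Function.comp_def] using this)
        (Continuous.intervalIntegrable (by
          change Continuous fun s : ℝ => (u : ℝ) • f' (s * u); fun_prop) _ _)
    rw [ContinuousMap.add_apply, h1, h2]
    simp [rescaledCurve]
  rw [he]
  exact (hc.integral_hasStrictDerivAt 0 t).hasDerivAt.const_add _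

/-- A curve which is `C¹` on `[0,1]` agrees there with a curve which is `C¹` on `ℝ`. -/
theorem exists_extension_of_contDiffOn [CompleteSpace F] {f : ℝ → F}
    (hf : ContDiffOn ℝ 1 f (Icc 0 1)) : ∃ f₁ f₁' : ℝ → F, Continuous f₁' ∧
      (∀ t, HasDerivAt f₁ (f₁' t) t) ∧ EqOn f₁ f (Icc 0 1) := by
  have hu : UniqueDiffOn ℝ (Icc (0 : ℝ) 1) := uniqueDiffOn_Icc zero_lt_one
  have h1 : ContinuousOn (derivWithin f (Icc 0 1)) (Icc 0 1) :=
    hf.continuousOn_derivWithin hu le_rfl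
  set f₁' : ℝ → F := IccExtend zero_le_one ((Icc (0 : ℝ) 1).domRestrict (derivWithin f (Icc 0 1)))
  have hc : Continuous f₁' := (continuousOn_iff_continuous_domRestrict.1 h1).Icc_extend'
  have hd : ∀ t, HasDerivAt (fun t => f 0 + ∫ s in (0 : ℝ)..t, f₁' s) (f₁' t) t := fun t =>
    (hc.integral_hasStrictDerivAt 0 t).hasDerivAt.const_add _
  refine ⟨_, f₁', hc, hd, ?_⟩
  refine eq_of_has_deriv_right_eq (f' := f₁') (fun t ht => (hd t).hasDerivWithinAt) (fun t ht => ?_)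
    (fun t ht => (hd t).continuousAt.continuousWithinAt) hf.continuousOn (by simp)
  have h2 : f₁' t = derivWithin f (Icc 0 1) t := by
    rw [show f₁' t = _ from IccExtend_of_mem _ _ (Ico_subset_Icc_self ht)]; rfl
  rw [h2]
  have h3 := (hf.differentiableOn one_ne_zero t (Ico_subset_Icc_self ht)).hasDerivWithinAt
  exact h3.mono_of_mem_nhdsWithin
    (Filter.mem_of_superset (Icc_mem_nhdsGE ht.2) (Icc_subset_Icc_left ht.1))

end Rescale

/-! ### The index forms transported to a fixed Hilbert space -/

namespace MorseSturmData

variable {n : ℕ} (D : MorseSturmData n)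

/-- The bounded form `C₀` on `𝓗_1`. -/
def kineticForm : D.Hs 1 →L[ℝ] D.Hs 1 →L[ℝ] ℝ :=
  LinearMap.mkContinuous₂ D.C0 (2 * (‖LinearMap.toContinuousBilinearMap D.g‖ / 2)) (by
    refine D.C0.norm_le_of_le_sq_add_sq fun V W => ?_
    have h1 := (memLp_two_iff_integrable_sq_norm V.memLp_deriv.1).1 V.memLp_deriv
    have h2 := (memLp_two_iff_integrable_sq_norm W.memLp_deriv.1).1 W.memLp_deriv
    have h3 := (h1.add h2).const_mul (‖LinearMap.toContinuousBilinearMap D.g‖ / 2)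
    change ‖∫ s in Icc 0 1, D.g (deriv V.fn s) (deriv W.fn s)‖ ≤ _
    refine (norm_integral_le_of_norm_le h3 (Filter.Eventually.of_forall fun s => ?_)).trans ?_
    · refine (H1P.abs_bilin_le D.g _ _).trans ?_
      have h4 := two_mul_le_add_sq ‖deriv V.fn s‖ ‖deriv W.fn s‖
      have h5 := mul_le_mul_of_nonneg_left h4 (norm_nonneg (LinearMap.toContinuousBilinearMap D.g))
      simp only [Pi.add_apply]
      linarith
    · rw [integral_const_mul]
      gcongr
      simp only [Pi.add_apply]
      rw [integral_add h1 h2]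
      exact add_le_add V.integral_deriv_sq_le W.integral_deriv_sq_le)

/-- The bounded form `g(S (V 0), W 0)` on `𝓗_1`. -/
def boundaryForm : D.Hs 1 →L[ℝ] D.Hs 1 →L[ℝ] ℝ :=
  LinearMap.mkContinuous₂ (D.boundary 1)
    (‖LinearMap.toContinuousBilinearMap D.g‖ * ‖LinearMap.toContinuousLinearMap D.S‖) fun V W => by
    refine (H1P.abs_bilin_le D.g _ _).trans ?_
    have h0 : (0 : ℝ) ∈ Icc (0 : ℝ) 1 := left_mem_Icc.2 zero_le_one
    have h1 : ‖(D.S (D.initial 1 V) : Rn n)‖ ≤ ‖LinearMap.toContinuousLinearMap D.S‖ * ‖V‖ := by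
      refine ((LinearMap.toContinuousLinearMap D.S).le_opNorm (D.initial 1 V)).trans ?_
      gcongr
      exact V.norm_fn_le le_rfl h0
    have h2 : ‖(D.initial 1 W : Rn n)‖ ≤ ‖W‖ := W.norm_fn_le le_rfl h0
    calc _ ≤ ‖LinearMap.toContinuousBilinearMap D.g‖ *
          (‖LinearMap.toContinuousLinearMap D.S‖ * ‖V‖) * ‖W‖ := by
          exact mul_le_mul (mul_le_mul_of_nonneg_left h1
            (norm_nonneg (LinearMap.toContinuousBilinearMap D.g))) h2 (norm_nonneg (W.fn 0))
            (by positivity)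
      _ = _ := by ring

variable {Q Q' : ℝ → Rn n →L[ℝ] Rn n}

/-- The form `t I_t(φ_t V, φ_t W)` on `𝓗_1`; it extends to `t = 0` by `C₀`. Here `Q` is a
continuous extension of `R` to `ℝ`. -/
def rescaledForm (hQ : Continuous Q) (t : ℝ) : D.Hs 1 →L[ℝ] D.Hs 1 →L[ℝ] ℝ :=
  D.kineticForm + t ^ 2 • H1P.potentialCLM D.P D.g (rescaledCurve hQ t) - t • D.boundaryForm

/-- The derivative with respect to `t` of `rescaledForm`. -/
def rescaledFormDeriv (hQ : Continuous Q) (hQ' : Continuous Q') (t : ℝ) :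
    D.Hs 1 →L[ℝ] D.Hs 1 →L[ℝ] ℝ :=
  t ^ 2 • H1P.potentialCLM D.P D.g (rescaledDeriv hQ' t) +
    (2 * t) • H1P.potentialCLM D.P D.g (rescaledCurve hQ t) - D.boundaryForm

theorem hasDerivAt_rescaledForm (hQ : Continuous Q) (hQ' : Continuous Q')
    (h : ∀ t, HasDerivAt Q (Q' t) t) (t : ℝ) :
    HasDerivAt (D.rescaledForm hQ) (D.rescaledFormDeriv hQ hQ' t) t := by
  have h1 : HasDerivAt (fun t => H1P.potentialCLM D.P D.g (rescaledCurve hQ t))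
      (H1P.potentialCLM D.P D.g (rescaledDeriv hQ' t)) t :=
    ContinuousLinearMap.hasDerivAt_comp (E := C(Icc (0 : ℝ) 1, Rn n →L[ℝ] Rn n))
      (F := D.Hs 1 →L[ℝ] D.Hs 1 →L[ℝ] ℝ) (H1P.potentialCLM D.P D.g)
      (hasDerivAt_rescaledCurve hQ' h hQ t)
  exact hasDerivAt_quadratic (F := D.Hs 1 →L[ℝ] D.Hs 1 →L[ℝ] ℝ) D.kineticForm D.boundaryForm h1

theorem potentialCLM_rescaledCurve (hQ : Continuous Q) (t : ℝ) (V W : D.Hs 1) :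
    H1P.potentialCLM D.P D.g (rescaledCurve hQ t) V W =
      ∫ u in Icc 0 1, D.g (Q (t * u) (V.fn u)) (W.fn u) := by
  rw [H1P.potentialCLM_apply]
  refine setIntegral_congr_fun measurableSet_Icc fun u hu => ?_
  simp only [IccExtend_of_mem _ _ hu]
  rfl

theorem potentialCLM_rescaledDeriv (hQ' : Continuous Q') (t : ℝ) (V W : D.Hs 1) :
    H1P.potentialCLM D.P D.g (rescaledDeriv hQ' t) V W =
      ∫ u in Icc 0 1, D.g (u • Q' (t * u) (V.fn u)) (W.fn u) := by
  rw [H1P.potentialCLM_apply]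
  refine setIntegral_congr_fun measurableSet_Icc fun u hu => ?_
  simp only [IccExtend_of_mem _ _ hu]
  rfl

theorem rescaledForm_apply (hQ : Continuous Q) (t : ℝ) (V W : D.Hs 1) :
    D.rescaledForm hQ t V W = (∫ u in Icc 0 1, D.g (deriv V.fn u) (deriv W.fn u)) +
      t ^ 2 * (∫ u in Icc 0 1, D.g (Q (t * u) (V.fn u)) (W.fn u)) -
      t * D.g (D.S ⟨V.fn 0, V.fn_zero_mem⟩) (W.fn 0) := by
  rw [← D.potentialCLM_rescaledCurve hQ]
  rfl

theorem rescaledFormDeriv_apply (hQ : Continuous Q) (hQ' : Continuous Q') (t : ℝ) (V W : D.Hs 1) :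
    D.rescaledFormDeriv hQ hQ' t V W =
      t ^ 2 * (∫ u in Icc 0 1, D.g (u • Q' (t * u) (V.fn u)) (W.fn u)) +
      2 * t * (∫ u in Icc 0 1, D.g (Q (t * u) (V.fn u)) (W.fn u)) -
      D.g (D.S ⟨V.fn 0, V.fn_zero_mem⟩) (W.fn 0) := by
  rw [← D.potentialCLM_rescaledCurve hQ, ← D.potentialCLM_rescaledDeriv hQ']
  rfl

theorem rescaledForm_zero (hQ : Continuous Q) : (D.rescaledForm hQ 0).toBilinForm = D.C0 := by
  ext V W
  rw [ContinuousLinearMap.toBilinForm_apply, rescaledForm_apply]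
  simp only [zero_mul, ne_eq, OfNat.ofNat_ne_zero, not_false_eq_true, zero_pow, add_zero, sub_zero]
  rfl

theorem mul_mem_Icc {t u : ℝ} (ht : t ∈ Icc (0 : ℝ) 1) (hu : u ∈ Icc (0 : ℝ) 1) :
    t * u ∈ Icc (0 : ℝ) 1 :=
  ⟨mul_nonneg ht.1 hu.1, mul_le_one₀ ht.2 hu.1 hu.2⟩

theorem rescaledForm_symm (hQ : Continuous Q) (hQR : EqOn Q D.R (Icc 0 1)) {t : ℝ}
    (ht : t ∈ Icc (0 : ℝ) 1) (V W : D.Hs 1) :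
    D.rescaledForm hQ t V W = D.rescaledForm hQ t W V := by
  have h1 : ∫ u in Icc 0 1, D.g (deriv V.fn u) (deriv W.fn u) =
      ∫ u in Icc 0 1, D.g (deriv W.fn u) (deriv V.fn u) := by
    exact integral_congr_ae (Filter.Eventually.of_forall fun u => D.g_symm _ _)
  have h2 : ∫ u in Icc 0 1, D.g (Q (t * u) (V.fn u)) (W.fn u) =
      ∫ u in Icc 0 1, D.g (Q (t * u) (W.fn u)) (V.fn u) := by
    refine setIntegral_congr_fun measurableSet_Icc fun u hu => ?_
    rw [hQR (mul_mem_Icc ht hu), D.R_symm _ (mul_mem_Icc ht hu), D.g_symm]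
  have h3 : D.g (D.S ⟨V.fn 0, V.fn_zero_mem⟩) (W.fn 0) =
      D.g (D.S ⟨W.fn 0, W.fn_zero_mem⟩) (V.fn 0) :=
    (D.S_symm ⟨V.fn 0, V.fn_zero_mem⟩ ⟨W.fn 0, W.fn_zero_mem⟩).trans (D.g_symm _ _)
  rw [rescaledForm_apply, rescaledForm_apply, h1, h2, h3]

theorem rescaledForm_eq_indexForm (hQ : Continuous Q) (hQR : EqOn Q D.R (Icc 0 1))
    (t : Ioc (0 : ℝ) 1) (V W : D.Hs 1) :
    D.rescaledForm hQ t V W = t * D.indexForm t (H1P.phi D.P t V) (H1P.phi D.P t W) := by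
  have ht : 0 < (t : ℝ) := t.2.1
  have h1 : D.kinetic t (H1P.phi D.P t V) (H1P.phi D.P t W) =
      (t : ℝ)⁻¹ * ∫ u in Icc 0 1, D.g (deriv V.fn u) (deriv W.fn u) := by
    have := H1P.integral_rescale
      (fun u => D.g ((t : ℝ)⁻¹ • deriv V.fn u) ((t : ℝ)⁻¹ • deriv W.fn u)) ht
    change ∫ s in Icc 0 (t : ℝ), D.g (deriv (H1P.phi D.P t V).fn s)
      (deriv (H1P.phi D.P t W).fn s) = _
    simp only [H1P.deriv_phi_fn]
    rw [this]
    simp only [map_smul, LinearMap.smul_apply, smul_eq_mul, integral_const_mul]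
    field_simp
  have h2 : D.potential t t.2.2 (H1P.phi D.P t V) (H1P.phi D.P t W) =
      t * ∫ u in Icc 0 1, D.g (Q (t * u) (V.fn u)) (W.fn u) := by
    rw [← smul_eq_mul, ← H1P.integral_rescale _ ht]
    change ∫ s in Icc 0 (t : ℝ), D.g (D.R s (V.fn (s / t))) (W.fn (s / t)) = _
    refine setIntegral_congr_fun measurableSet_Icc fun s hs => ?_
    rw [mul_div_cancel₀ _ ht.ne', hQR ⟨hs.1, hs.2.trans t.2.2⟩]
  have h3 : D.boundary t (H1P.phi D.P t V) (H1P.phi D.P t W) =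
      D.g (D.S ⟨V.fn 0, V.fn_zero_mem⟩) (W.fn 0) := by
    change D.g (D.S ⟨V.fn (0 / t), _⟩) (W.fn (0 / t)) = _
    simp only [zero_div]
  rw [rescaledForm_apply, indexForm, LinearMap.sub_apply, LinearMap.sub_apply, LinearMap.add_apply,
    LinearMap.add_apply, h1, h2, h3]
  field_simp

end MorseSturmData

end Forms

/-! ### The kernel of the index form -/

section Kernel

attribute [local instance] H1P.addCommGroupOfNormed H1P.moduleOfNormed

theorem integral_eq_sub_of_hasDerivWithinAt_Icc {F : Type*} [NormedAddCommGroup F]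
    [NormedSpace ℝ F] [CompleteSpace F] {f f' : ℝ → F}
    (h : ∀ u ∈ Icc (0 : ℝ) 1, HasDerivWithinAt f (f' u) (Icc 0 1) u)
    (hc : ContinuousOn f' (Icc 0 1)) {x y : ℝ} (hx : x ∈ Icc (0 : ℝ) 1) (hy : y ∈ Icc (0 : ℝ) 1)
    (hxy : x ≤ y) : ∫ u in x..y, f' u = f y - f x := by
  have hs : Icc x y ⊆ Icc (0 : ℝ) 1 := Icc_subset_Icc hx.1 hy.2
  refine intervalIntegral.integral_eq_sub_of_hasDerivAt_of_le hxy
    (fun u hu => (h u (hs hu)).continuousWithinAt.mono hs) (fun u hu => ?_)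
    ((hc.mono (by rwa [uIcc_of_le hxy])).intervalIntegrable)
  exact (h u (hs (Ioo_subset_Icc_self hu))).hasDerivAt
    (Filter.mem_of_superset (Icc_mem_nhds hu.1 hu.2) hs)

theorem setIntegral_Icc_eq {F : Type*} [NormedAddCommGroup F] [NormedSpace ℝ F] (f : ℝ → F) :
    ∫ u in Icc (0 : ℝ) 1, f u = ∫ u in (0 : ℝ)..1, f u := by
  rw [intervalIntegral.integral_of_le zero_le_one, integral_Icc_eq_integral_Ioc]

theorem memLp_two_of_continuousOn {n : ℕ} {f : ℝ → Rn n} (hc : ContinuousOn f (Icc 0 1)) :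
    MemLp f 2 (volume.restrict (Icc 0 1)) := by
  obtain ⟨C, hC⟩ := isCompact_Icc.exists_bound_of_continuousOn hc
  refine MemLp.of_bound (hc.aestronglyMeasurable measurableSet_Icc) C ?_
  rw [ae_restrict_iff' measurableSet_Icc]
  exact Filter.Eventually.of_forall hC

namespace H1P

variable {n : ℕ} {P : Submodule ℝ (Rn n)}

theorem norm_fn_sub_le (W : H1P P 1) {x y : ℝ} (hx : x ∈ Icc (0 : ℝ) 1) (hy : y ∈ Icc (0 : ℝ) 1)
    (hxy : x ≤ y) : ‖W.fn y - W.fn x‖ ≤ ∫ u in x..y, ‖deriv W.fn u‖ := by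
  rw [← W.integral_deriv_fn hx hy]
  exact intervalIntegral.norm_integral_le_integral_norm hxy

/-- The pairing of a `C¹` curve with an element of `H¹_P([0,1], ℝⁿ)` is absolutely continuous. -/
theorem absolutelyContinuousOnInterval_bilin (b : LinearMap.BilinForm ℝ (Rn n)) {z r : ℝ → Rn n}
    (hz : ∀ u ∈ Icc (0 : ℝ) 1, HasDerivWithinAt z (r u) (Icc 0 1) u)
    (hr : ContinuousOn r (Icc 0 1)) (W : H1P P 1) :
    AbsolutelyContinuousOnInterval (fun u => b (z u) (W.fn u)) 0 1 := by
  obtain ⟨C, hC⟩ := isCompact_Icc.exists_bound_of_continuousOn hr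
  have hzc : ContinuousOn z (Icc 0 1) := fun u hu => (hz u hu).continuousWithinAt
  obtain ⟨Z, hZ⟩ := isCompact_Icc.exists_bound_of_continuousOn hzc
  have hC0 : 0 ≤ C := (norm_nonneg _).trans (hC 0 (left_mem_Icc.2 zero_le_one))
  set β := ‖LinearMap.toContinuousBilinearMap b‖
  have hβ : 0 ≤ β := norm_nonneg (LinearMap.toContinuousBilinearMap b)
  -- the increments of `b(z, W)` are bounded by those of a primitive of `k`
  set k : ℝ → ℝ := fun u => β * C * ‖W‖ + β * Z * ‖deriv W.fn u‖
  have hW : IntervalIntegrable (fun u => ‖deriv W.fn u‖) volume 0 1 :=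
    (intervalIntegrable_of_memLp zero_le_one W.memLp_deriv).norm
  have hk : IntervalIntegrable k volume 0 1 :=
    (intervalIntegrable_const).add (hW.const_mul _)
  have hu01 : uIcc (0 : ℝ) 1 = Icc 0 1 := uIcc_of_le zero_le_one
  have key : ∀ x ∈ Icc (0 : ℝ) 1, ∀ y ∈ Icc (0 : ℝ) 1, x ≤ y →
      dist (b (z x) (W.fn x)) (b (z y) (W.fn y)) ≤
        dist (∫ v in (0 : ℝ)..x, k v) (∫ v in (0 : ℝ)..y, k v) := fun x hx y hy hxy => by
    have hsub : ∀ a ∈ Icc (0 : ℝ) 1, ∀ c ∈ Icc (0 : ℝ) 1, uIcc a c ⊆ uIcc (0 : ℝ) 1 :=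
      fun a ha c hc => uIcc_subset_uIcc (by rwa [hu01]) (by rwa [hu01])
    have h0 : (0 : ℝ) ∈ Icc (0 : ℝ) 1 := left_mem_Icc.2 zero_le_one
    rw [dist_comm, dist_comm (∫ v in (0 : ℝ)..x, k v), dist_eq_norm, dist_eq_norm,
      intervalIntegral.integral_interval_sub_left (hk.mono_set (hsub 0 h0 y hy))
        (hk.mono_set (hsub 0 h0 x hx))]
    have h1 : b (z y) (W.fn y) - b (z x) (W.fn x) =
        b (z y - z x) (W.fn y) + b (z x) (W.fn y - W.fn x) := by
      simp only [map_sub, LinearMap.sub_apply]; ring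
    have h2 : ‖z y - z x‖ ≤ C * (y - x) := by
      have := (convex_Icc (0 : ℝ) 1).norm_image_sub_le_of_norm_hasDerivWithin_le hz hC hx hy
      rwa [Real.norm_eq_abs, abs_of_nonneg (sub_nonneg.2 hxy)] at this
    have h3 := W.norm_fn_sub_le hx hy hxy
    have h4 : ∫ v in x..y, k v = β * C * ‖W‖ * (y - x) + β * Z * ∫ v in x..y, ‖deriv W.fn v‖ := by
      rw [intervalIntegral.integral_add intervalIntegrable_const
        ((hW.mono_set (hsub x hx y hy)).const_mul _), intervalIntegral.integral_const,
        intervalIntegral.integral_const_mul, smul_eq_mul]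
      ring
    have h5 : ‖b (z y - z x) (W.fn y)‖ ≤ β * (C * (y - x)) * ‖W‖ := by
      refine (abs_bilin_le b _ _).trans ?_
      have := W.norm_fn_le le_rfl hy
      have := sub_nonneg.2 hxy
      gcongr
    have h6 : ‖b (z x) (W.fn y - W.fn x)‖ ≤ β * Z * ∫ v in x..y, ‖deriv W.fn v‖ := by
      refine (abs_bilin_le b _ _).trans ?_
      have := hZ x hx
      have : 0 ≤ Z := (norm_nonneg _).trans this
      gcongr
    rw [h1, h4]
    refine (norm_add_le _ _).trans (le_trans ?_ (Real.le_norm_self _))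
    linarith
  refine (hk.absolutelyContinuousOnInterval_integral (c := 0) left_mem_uIcc).of_dist_le
    fun x hx y hy => ?_
  rw [hu01] at hx hy
  rcases le_total x y with h | h
  · exact key x hx y hy h
  · rw [dist_comm, dist_comm (∫ v in (0 : ℝ)..x, k v)]
    exact key y hy x hx h

/-- Integration by parts of a `C¹` curve against an element of `H¹_P([0,1], ℝⁿ)`. -/
theorem integral_by_parts (b : LinearMap.BilinForm ℝ (Rn n)) {z r : ℝ → Rn n}
    (hz : ∀ u ∈ Icc (0 : ℝ) 1, HasDerivWithinAt z (r u) (Icc 0 1) u)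
    (hr : ContinuousOn r (Icc 0 1)) (W : H1P P 1) :
    (∫ u in Icc 0 1, b (r u) (W.fn u)) + ∫ u in Icc 0 1, b (z u) (deriv W.fn u) =
      -b (z 0) (W.fn 0) := by
  have hac := absolutelyContinuousOnInterval_bilin b hz hr W
  have hzc : ContinuousOn z (Icc 0 1) := fun u hu => (hz u hu).continuousWithinAt
  have h1 := AbsolutelyContinuousOnInterval.integral_deriv_eq_sub hac
  rw [W.fn_end, map_zero, zero_sub] at h1
  rw [← integral_add (integrable_bilin b (memLp_two_of_continuousOn hr) W.memLp_fn)
    (integrable_bilin b (memLp_two_of_continuousOn hzc) W.memLp_deriv), ← h1,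
    ← setIntegral_Icc_eq]
  refine integral_congr_ae ?_
  filter_upwards [ac_ae_differentiableAt W.ac, ae_restrict_mem measurableSet_Icc,
    ae_restrict_of_ae (Measure.ae_ne volume (0 : ℝ)),
    ae_restrict_of_ae (Measure.ae_ne volume (1 : ℝ))] with u hu hu' h0 h1
  have hz' : HasDerivAt z (r u) u := (hz u hu').hasDerivAt
    (Icc_mem_nhds (lt_of_le_of_ne hu'.1 (Ne.symm h0)) (lt_of_le_of_ne hu'.2 h1))
  have := (MorseSturmData.hasDerivWithinAt_bilin b (hz'.hasDerivWithinAt (s := univ))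
    hu.hasDerivAt.hasDerivWithinAt).hasDerivAt Filter.univ_mem
  rw [this.deriv, add_comm]

/-- The lemma of du Bois-Reymond: an `L²` curve which is `g`-orthogonal to the derivatives of all
elements of `H¹_P([0,1], ℝⁿ)` is a constant in `P^⊥`. -/
theorem exists_const_of_integral_eq_zero {g : LinearMap.BilinForm ℝ (Rn n)} (hg : g.Nondegenerate)
    (hgs : ∀ x y, g x y = g y x)
    {h : ℝ → Rn n} (hh : MemLp h 2 (volume.restrict (Icc 0 1)))
    (h0 : ∀ W : H1P P 1, ∫ u in Icc 0 1, g (h u) (deriv W.fn u) = 0) :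
    ∃ c ∈ g.orthogonal P, ∀ᵐ u ∂(volume.restrict (Icc (0 : ℝ) 1)), h u = c := by
  have hf : ∀ f : ℝ → Rn n, MemLp f 2 (volume.restrict (Icc 0 1)) → ∫ u in (0 : ℝ)..1, f u ∈ P →
      ∫ u in Icc 0 1, g (h u) (f u) = 0 := fun f hf hP => by
    refine Eq.trans (integral_congr_ae ?_) (h0 (ofDeriv zero_le_one hf hP))
    filter_upwards [deriv_ofDeriv_ae zero_le_one hf hP] with u hu
    rw [hu]
  let T : Rn n →L[ℝ] Rn n :=
    InnerProductSpace.continuousLinearMapOfBilin (𝕜 := ℝ) (LinearMap.toContinuousBilinearMap g)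
  have hT : ∀ x y, inner ℝ (T x) y = g x y := fun x y =>
    InnerProductSpace.continuousLinearMapOfBilin_apply _ x y
  have hTinj : ∀ x y, T x = T y → x = y := fun x y hxy => by
    rw [← sub_eq_zero]
    refine hg.1 _ fun w => ?_
    rw [← hT, map_sub, hxy, sub_self, inner_zero_left]
  have hk : MemLp (fun u => T (h u)) 2 (volume.restrict (Icc 0 1)) := T.comp_memLp' hh
  set m := ∫ u in (0 : ℝ)..1, T (h u)
  have hi : IntervalIntegrable (fun u => T (h u)) volume 0 1 :=
    intervalIntegrable_of_memLp zero_le_one hk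
  have hkm : MemLp (fun u => T (h u) - m) 2 (volume.restrict (Icc 0 1)) :=
    hk.sub (memLp_const m)
  have hm0 : ∫ u in (0 : ℝ)..1, (T (h u) - m) = 0 := by
    rw [intervalIntegral.integral_sub hi intervalIntegrable_const]
    simp [m]
  -- test against `T h` minus its mean value
  have h1 : ∫ u in Icc (0 : ℝ) 1, ‖T (h u) - m‖ ^ 2 = 0 := by
    have h2 := hf _ hkm (by rw [hm0]; exact P.zero_mem)
    have h3 : ∫ u in Icc (0 : ℝ) 1, inner ℝ m (T (h u) - m) = 0 := by
      rw [integral_inner (hkm.integrable one_le_two), setIntegral_Icc_eq, hm0, inner_zero_right]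
    have h4 := integral_sub (integrable_bilin g hh hkm) (integrable_inner' (memLp_const m) hkm)
    rw [h2, h3, sub_zero] at h4
    refine Eq.trans ?_ h4
    congr 1
    funext u
    rw [← hT, ← inner_sub_left, real_inner_self_eq_norm_sq]
  have h2 : ∀ᵐ u ∂(volume.restrict (Icc (0 : ℝ) 1)), T (h u) = m := by
    have h3 := (integral_eq_zero_iff_of_nonneg (fun u => sq_nonneg _)
      ((memLp_two_iff_integrable_sq_norm hkm.1).1 hkm)).1 h1
    filter_upwards [h3] with u hu
    simpa [sub_eq_zero] using hu
  have : (ae (volume.restrict (Icc (0 : ℝ) 1))).NeBot := by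
    rw [ae_neBot, Ne, Measure.restrict_eq_zero]; simp
  obtain ⟨u₀, hu₀⟩ := h2.exists
  have h3 : ∀ᵐ u ∂(volume.restrict (Icc (0 : ℝ) 1)), h u = h u₀ := by
    filter_upwards [h2] with u hu
    exact hTinj _ _ (hu.trans hu₀.symm)
  refine ⟨h u₀, fun p hp => ?_, h3⟩
  have h4 := hf (fun _ => p) (memLp_const p) (by simpa using hp)
  have h5 : ∫ u in Icc (0 : ℝ) 1, g (h u) p = ∫ u in Icc (0 : ℝ) 1, g (h u₀) p := by
    refine integral_congr_ae ?_
    filter_upwards [h3] with u hu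
    rw [hu]
  rw [h5] at h4
  rw [hgs]
  simpa using h4

end H1P

namespace MorseSturmData

variable {n : ℕ} (D : MorseSturmData n)

/-- The problem obtained from the change of variables `s = t u`. -/
def rescale {t : ℝ} (ht : t ∈ Icc (0 : ℝ) 1) : MorseSturmData n :=
  { D with
    R := fun u => t ^ 2 • D.R (t * u)
    R_cont := (D.R_cont.comp (continuous_const_mul t).continuousOn
      fun _ hu => mul_mem_Icc ht hu).const_smul (t ^ 2)
    R_symm := fun u hu x y => by
      have := D.R_symm _ (mul_mem_Icc ht hu) x y
      simp [this] }

variable {D} {Q Q' : ℝ → Rn n →L[ℝ] Rn n} {t : ℝ}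

theorem hasDerivWithinAt_comp_mul {J J' : ℝ → Rn n}
    (h : ∀ s ∈ Icc (0 : ℝ) 1, HasDerivWithinAt J (J' s) (Icc 0 1) s) (ht : t ∈ Icc (0 : ℝ) 1) :
    ∀ u ∈ Icc (0 : ℝ) 1, HasDerivWithinAt (fun u => J (t * u)) (t • J' (t * u)) (Icc 0 1) u :=
  fun u hu => by
    have h1 : HasDerivWithinAt (fun u => t * u) t (Icc 0 1) u := by
      simpa using (hasDerivWithinAt_id u (Icc (0 : ℝ) 1)).const_mul t
    exact (h (t * u) (mul_mem_Icc ht hu)).scomp u h1 fun v hv => mul_mem_Icc ht hv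

theorem IsJacobi.rescale {J J' : ℝ → Rn n} (h : D.IsJacobi J J') (ht : t ∈ Icc (0 : ℝ) 1) :
    (D.rescale ht).IsJacobi (fun u => J (t * u)) (fun u => t • J' (t * u)) := by
  refine ⟨hasDerivWithinAt_comp_mul h.1 ht, fun u hu => ?_⟩
  have h2 := (hasDerivWithinAt_comp_mul h.2 ht u hu).const_smul t
  refine h2.congr_deriv ?_
  rw [smul_smul, ← sq]
  rfl

theorem IsJacobi.continuousOn {J J' : ℝ → Rn n} (h : D.IsJacobi J J') :
    ContinuousOn J (Icc 0 1) ∧ ContinuousOn J' (Icc 0 1) :=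
  ⟨fun u hu => (h.1 u hu).continuousWithinAt, fun u hu => (h.2 u hu).continuousWithinAt⟩

/-- An element of the kernel of the rescaled index form is smooth, and is the rescaling of a
`(P,S)`-solution. -/
theorem exists_isSolution_of_mem_ker (hQ : Continuous Q) (hQR : EqOn Q D.R (Icc 0 1))
    (ht : t ∈ Ioc (0 : ℝ) 1) {V : D.Hs 1} (hV : ∀ W, D.rescaledForm hQ t V W = 0) :
    ∃ J J', D.IsSolution J J' ∧ J t = 0 ∧ ∀ u ∈ Icc (0 : ℝ) 1, V.fn u = J (t * u) := by
  have htI : t ∈ Icc (0 : ℝ) 1 := ⟨ht.1.le, ht.2⟩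
  have h0I : (0 : ℝ) ∈ Icc (0 : ℝ) 1 := left_mem_Icc.2 zero_le_one
  have h1I : (1 : ℝ) ∈ Icc (0 : ℝ) 1 := right_mem_Icc.2 zero_le_one
  set r : ℝ → Rn n := fun u => t ^ 2 • Q (t * u) (V.fn u)
  have hr : ContinuousOn r (Icc 0 1) := by
    have : ContinuousOn (fun u => Q (t * u)) (Icc 0 1) := by fun_prop
    exact (this.clm_apply V.continuousOn).const_smul (t ^ 2)
  set r₁ : ℝ → Rn n := IccExtend zero_le_one ((Icc (0 : ℝ) 1).domRestrict r)
  have hr₁ : Continuous r₁ := (continuousOn_iff_continuous_domRestrict.1 hr).Icc_extend'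
  have hr₁r : ∀ u ∈ Icc (0 : ℝ) 1, r₁ u = r u := fun u hu => IccExtend_of_mem _ _ hu
  set b : ℝ → Rn n := fun u => ∫ v in (0 : ℝ)..u, r₁ v
  have hb : ∀ u ∈ Icc (0 : ℝ) 1, HasDerivWithinAt b (r u) (Icc 0 1) u := fun u hu => by
    rw [← hr₁r u hu]
    exact (hr₁.integral_hasStrictDerivAt 0 u).hasDerivAt.hasDerivWithinAt
  have hbc : ContinuousOn b (Icc 0 1) := fun u hu => (hb u hu).continuousWithinAt
  set a : Rn n := t • (D.S ⟨V.fn 0, V.fn_zero_mem⟩ : Rn n)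
  have hh : MemLp (fun u => deriv V.fn u - b u + a) 2 (volume.restrict (Icc 0 1)) :=
    (V.memLp_deriv.sub (memLp_two_of_continuousOn hbc)).add (memLp_const a)
  -- after integration by parts of the term in `R`, the form pairs `V' - b + a` with `W'`
  obtain ⟨c, hc, hae⟩ := H1P.exists_const_of_integral_eq_zero (P := D.P) D.g_nondeg D.g_symm hh
    fun W => by
      have h1 := hV W
      have h2 := H1P.integral_by_parts D.g hb hr W
      have h3 : ∫ u in Icc (0 : ℝ) 1, D.g (r u) (W.fn u) =
          t ^ 2 * ∫ u in Icc 0 1, D.g (Q (t * u) (V.fn u)) (W.fn u) := by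
        rw [← integral_const_mul]
        simp [r]
      have h4 : ∫ u in Icc (0 : ℝ) 1, D.g a (deriv W.fn u) = -D.g a (W.fn 0) := by
        have := H1P.integral_by_parts D.g (z := fun _ => a) (r := fun _ => 0)
          (fun u _ => hasDerivWithinAt_const u _ a) continuousOn_const W
        simpa using this
      have h5 : D.g a (W.fn 0) = t * D.g (D.S ⟨V.fn 0, V.fn_zero_mem⟩) (W.fn 0) := by simp [a]
      have h6 : b 0 = 0 := intervalIntegral.integral_same
      have e1 := H1P.integrable_bilin D.g V.memLp_deriv W.memLp_deriv
      have e2 := H1P.integrable_bilin D.g (memLp_two_of_continuousOn hbc) W.memLp_deriv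
      have e3 := H1P.integrable_bilin D.g (memLp_const (μ := volume.restrict (Icc (0 : ℝ) 1)) a)
        W.memLp_deriv
      have h7 : ∫ u in Icc (0 : ℝ) 1, D.g (deriv V.fn u - b u + a) (deriv W.fn u) =
          (∫ u in Icc (0 : ℝ) 1, D.g (deriv V.fn u) (deriv W.fn u)) -
            (∫ u in Icc (0 : ℝ) 1, D.g (b u) (deriv W.fn u)) +
            ∫ u in Icc (0 : ℝ) 1, D.g a (deriv W.fn u) := by
        have e12 : Integrable (fun s => D.g (deriv V.fn s) (deriv W.fn s) -
          D.g (b s) (deriv W.fn s)) (volume.restrict (Icc 0 1)) := e1.sub e2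
        rw [← integral_sub e1 e2, ← integral_add e12 e3]
        simp
      rw [rescaledForm_apply] at h1
      rw [h6, map_zero, LinearMap.zero_apply, neg_zero] at h2
      rw [h7, h4, h5]
      linarith
  set z : ℝ → Rn n := fun u => b u - a + c
  have hz : ∀ u ∈ Icc (0 : ℝ) 1, HasDerivWithinAt z (r u) (Icc 0 1) u := fun u hu =>
    ((hb u hu).sub_const a).add_const c
  have hb' : Continuous b := continuous_iff_continuousAt.2 fun u =>
    (hr₁.integral_hasStrictDerivAt 0 u).hasDerivAt.continuousAt
  have hzc : Continuous z := (hb'.sub continuous_const).add continuous_const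
  have hVz : ∀ u ∈ Icc (0 : ℝ) 1, V.fn u = V.fn 0 + ∫ v in (0 : ℝ)..u, z v := fun u hu => by
    have h1 := V.integral_deriv_fn h0I hu
    have h2 : ∫ v in (0 : ℝ)..u, deriv V.fn v = ∫ v in (0 : ℝ)..u, z v := by
      refine intervalIntegral.integral_congr_ae ?_
      rw [ae_restrict_iff' measurableSet_Icc] at hae
      filter_upwards [hae] with v hv hvu
      rw [uIoc_of_le hu.1] at hvu
      have := hv ⟨hvu.1.le, hvu.2.trans hu.2⟩
      simp only [z]
      rw [← this]; abel
    rw [← h2, h1]; abel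
  have hVd : ∀ u ∈ Icc (0 : ℝ) 1, HasDerivWithinAt V.fn (z u) (Icc 0 1) u := fun u hu =>
    HasDerivWithinAt.congr_of_mem
      ((hzc.integral_hasStrictDerivAt 0 u).hasDerivAt.const_add (V.fn 0)).hasDerivWithinAt hVz hu
  have hVJ : (D.rescale htI).IsJacobi V.fn z := ⟨hVd, fun u hu => by
    refine (hz u hu).congr_deriv ?_
    simp only [r]
    rw [hQR (mul_mem_Icc htI hu)]
    rfl⟩
  obtain ⟨J, J', hJ, hJ0, hJ'0⟩ := D.exists_isJacobi h0I (V.fn 0) (t⁻¹ • z 0)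
  have huniq : ∀ u ∈ Icc (0 : ℝ) 1, V.fn u = J (t * u) := fun u hu =>
    (hVJ.unique (hJ.rescale htI) h0I (by simp [hJ0])
      (by simp [hJ'0, smul_smul, mul_inv_cancel₀ ht.1.ne']) hu).1
  refine ⟨J, J', ⟨hJ.1, hJ.2, by rw [hJ0]; exact V.fn_zero_mem, ?_⟩, ?_, huniq⟩
  · have : z 0 = c - a := by simp only [z, b, intervalIntegral.integral_same]; abel
    simp only [hJ0, hJ'0, this]
    have h1 : t⁻¹ • (c - a) + (D.S ⟨V.fn 0, V.fn_zero_mem⟩ : Rn n) = t⁻¹ • c := by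
      simp only [a, smul_sub, smul_smul, inv_mul_cancel₀ ht.1.ne', one_smul]; abel
    rw [h1]
    exact Submodule.smul_mem _ _ hc
  · have := huniq 1 h1I
    rw [V.fn_end, mul_one] at this
    exact this.symm

/-- A `(P,S)`-solution vanishing at `t` is, after rescaling, an element of `𝓗_1`. -/
theorem exists_fn_eq {J J' : ℝ → Rn n} (hJ : D.IsSolution J J') (ht : t ∈ Icc (0 : ℝ) 1)
    (hJt : J t = 0) : ∃ V : D.Hs 1, ∀ u ∈ Icc (0 : ℝ) 1, V.fn u = J (t * u) := by
  have h1I : (1 : ℝ) ∈ Icc (0 : ℝ) 1 := right_mem_Icc.2 zero_le_one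
  have hd := hasDerivWithinAt_comp_mul hJ.1 ht
  have hc : ContinuousOn (fun u => t • J' (t * u)) (Icc 0 1) :=
    (hJ.isJacobi.rescale ht).continuousOn.2
  have hint : ∀ u ∈ Icc (0 : ℝ) 1, ∫ v in u..1, t • J' (t * v) = -J (t * u) := fun u hu => by
    rw [integral_eq_sub_of_hasDerivWithinAt_Icc hd hc hu h1I hu.2]
    simp only [mul_one, hJt, zero_sub]
  have hP : ∫ v in (0 : ℝ)..1, t • J' (t * v) ∈ D.P := by
    rw [hint 0 (left_mem_Icc.2 zero_le_one), mul_zero]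
    exact D.P.neg_mem hJ.2.2.1
  exact ⟨H1P.ofDeriv zero_le_one (memLp_two_of_continuousOn hc) hP, fun u hu => by
    rw [H1P.ofDeriv_fn zero_le_one _ hP hu, hint u hu, neg_neg]⟩

theorem deriv_fn_ae {J J' : ℝ → Rn n} (hJ : D.IsJacobi J J') (ht : t ∈ Icc (0 : ℝ) 1)
    {V : D.Hs 1} (hV : ∀ u ∈ Icc (0 : ℝ) 1, V.fn u = J (t * u)) :
    deriv V.fn =ᵐ[volume.restrict (Icc 0 1)] fun u => t • J' (t * u) := by
  filter_upwards [ae_restrict_mem measurableSet_Icc,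
    ae_restrict_of_ae (Measure.ae_ne volume (0 : ℝ)),
    ae_restrict_of_ae (Measure.ae_ne volume (1 : ℝ))] with u hu h0 h1
  have := ((hasDerivWithinAt_comp_mul hJ.1 ht u hu).congr_of_mem hV hu).hasDerivAt
    (Icc_mem_nhds (lt_of_le_of_ne hu.1 (Ne.symm h0)) (lt_of_le_of_ne hu.2 h1))
  exact this.deriv

/-- The rescaling of a `(P,S)`-solution is in the kernel of the rescaled index form. -/
theorem rescaledForm_eq_zero (hQ : Continuous Q) (hQR : EqOn Q D.R (Icc 0 1))
    (ht : t ∈ Icc (0 : ℝ) 1) {J J' : ℝ → Rn n} (hJ : D.IsSolution J J') {V : D.Hs 1}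
    (hV : ∀ u ∈ Icc (0 : ℝ) 1, V.fn u = J (t * u)) (W : D.Hs 1) :
    D.rescaledForm hQ t V W = 0 := by
  have hres := hJ.isJacobi.rescale ht
  have hc : ContinuousOn (fun u => t ^ 2 • D.R (t * u) (J (t * u))) (Icc 0 1) :=
    (D.rescale ht).R_cont.clm_apply hres.continuousOn.1
  have h1 := H1P.integral_by_parts D.g hres.2 hc W
  have h2 : ∫ u in Icc (0 : ℝ) 1, D.g (t • J' (t * u)) (deriv W.fn u) =
      ∫ u in Icc 0 1, D.g (deriv V.fn u) (deriv W.fn u) := by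
    refine integral_congr_ae ?_
    filter_upwards [deriv_fn_ae hJ.isJacobi ht hV] with u hu
    rw [hu]
  have h3 : ∫ u in Icc (0 : ℝ) 1, D.g (t ^ 2 • D.R (t * u) (J (t * u))) (W.fn u) =
      t ^ 2 * ∫ u in Icc 0 1, D.g (Q (t * u) (V.fn u)) (W.fn u) := by
    rw [← integral_const_mul]
    refine setIntegral_congr_fun measurableSet_Icc fun u hu => ?_
    rw [hQR (mul_mem_Icc ht hu), hV u hu, map_smul, LinearMap.smul_apply, smul_eq_mul]
  obtain ⟨hJ0, hJ'0⟩ := hJ.2.2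
  have h0 : V.fn 0 = J 0 := by
    rw [hV 0 (left_mem_Icc.2 zero_le_one), mul_zero]
  have h4 : D.g (W.fn 0) (J' 0 + D.S ⟨J 0, hJ0⟩) = 0 := hJ'0 _ W.fn_zero_mem
  rw [map_add, D.g_symm, D.g_symm (W.fn 0)] at h4
  rw [rescaledForm_apply]
  simp only [h0]
  have h5 : (∫ u in Icc (0 : ℝ) 1, D.g (t ^ 2 • D.R (t * u) (J (t * u))) (W.fn u)) +
    ∫ u in Icc (0 : ℝ) 1, D.g (t • J' (t * u)) (deriv W.fn u) = -D.g (t • J' (t * 0)) (W.fn 0) := h1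
  rw [h2, h3, mul_zero, map_smul, LinearMap.smul_apply, smul_eq_mul] at h5
  linear_combination h5 - t * h4

/-- On the kernel of the rescaled index form, the derivative of the form with respect to the
parameter is a negative multiple of `g` evaluated on the derivatives of the solutions at `t`. -/
theorem rescaledFormDeriv_eq (hQ : Continuous Q) (hQ' : Continuous Q')
    (hQQ' : ∀ t, HasDerivAt Q (Q' t) t) (hQR : EqOn Q D.R (Icc 0 1))
    (ht : t ∈ Ioc (0 : ℝ) 1) {J J' K K' : ℝ → Rn n} (hJ : D.IsSolution J J')
    (hK : D.IsSolution K K') {V W : D.Hs 1}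
    (hV : ∀ u ∈ Icc (0 : ℝ) 1, V.fn u = J (t * u)) (hW : ∀ u ∈ Icc (0 : ℝ) 1, W.fn u = K (t * u)) :
    D.rescaledFormDeriv hQ hQ' t V W = -(t * D.g (J' t) (K' t)) := by
  have htI : t ∈ Icc (0 : ℝ) 1 := ⟨ht.1.le, ht.2⟩
  have h0I : (0 : ℝ) ∈ Icc (0 : ℝ) 1 := left_mem_Icc.2 zero_le_one
  have h1I : (1 : ℝ) ∈ Icc (0 : ℝ) 1 := right_mem_Icc.2 zero_le_one
  have hJr := hJ.isJacobi.rescale htI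
  have hKr := hK.isJacobi.rescale htI
  have hQtc : Continuous fun u => Q (t * u) := by fun_prop
  have hQtc' : Continuous fun u => Q' (t * u) := by fun_prop
  -- the energy `g(V', W') - t² g(R V, W)`
  set p : ℝ → ℝ := fun u => D.g (t • J' (t * u)) (t • K' (t * u))
  set q : ℝ → ℝ := fun u => D.g (Q (t * u) (J (t * u))) (K (t * u))
  set e : ℝ → ℝ := fun u => D.g (u • Q' (t * u) (J (t * u))) (K (t * u))
  have hpc : ContinuousOn p (Icc 0 1) := fun u hu =>
    (hasDerivWithinAt_bilin D.g (hJr.2 u hu) (hKr.2 u hu)).continuousWithinAt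
  have hqc : ContinuousOn q (Icc 0 1) :=
    ((LinearMap.toContinuousBilinearMap D.g).continuous.comp_continuousOn
      (hQtc.continuousOn.clm_apply hJr.continuousOn.1)).clm_apply hKr.continuousOn.1
  have hec : ContinuousOn e (Icc 0 1) :=
    ((LinearMap.toContinuousBilinearMap D.g).continuous.comp_continuousOn
      (continuousOn_id.smul (hQtc'.continuousOn.clm_apply hJr.continuousOn.1))).clm_apply
        hKr.continuousOn.1
  -- its derivative is `-t³ g(R'(t u) V, W)`; integrating `(u E)' = E + u E'` gives the claim
  have hder : ∀ u ∈ Icc (0 : ℝ) 1, HasDerivWithinAt (fun u => u * (p u - t ^ 2 * q u))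
      (p u - t ^ 2 * q u - t ^ 3 * e u) (Icc 0 1) u := fun u hu => by
    have d1 := hasDerivWithinAt_bilin D.g (hJr.2 u hu) (hKr.2 u hu)
    have d2 : HasDerivWithinAt (fun u => Q (t * u)) (t • Q' (t * u)) (Icc 0 1) u := by
      have h1 : HasDerivAt (fun u => t * u) t u := by
        simpa using (hasDerivAt_id u).const_mul t
      exact ((hQQ' (t * u)).scomp u h1).hasDerivWithinAt
    have d3 := hasDerivWithinAt_bilin D.g (d2.clm_apply (hJr.1 u hu)) (hKr.1 u hu)
    have d4 := (hasDerivWithinAt_id u (Icc (0 : ℝ) 1)).mul (d1.sub (d3.const_mul (t ^ 2)))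
    refine d4.congr_deriv ?_
    have hs := D.R_symm _ (mul_mem_Icc htI hu) (J' (t * u)) (K (t * u))
    change 1 * (p u - t ^ 2 * q u) + u * (D.g (t • J' (t * u)) (t ^ 2 • D.R (t * u) (K (t * u))) +
      D.g (t ^ 2 • D.R (t * u) (J (t * u))) (t • K' (t * u)) -
      t ^ 2 * (D.g (Q (t * u) (J (t * u))) (t • K' (t * u)) +
        D.g (t • Q' (t * u) (J (t * u)) + Q (t * u) (t • J' (t * u))) (K (t * u)))) = _
    simp only [hQR (mul_mem_Icc htI hu), map_add, map_smul, LinearMap.smul_apply, smul_eq_mul,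
      LinearMap.add_apply, e, hs]
    ring
  have hip : IntegrableOn p (Icc 0 1) := hpc.integrableOn_compact isCompact_Icc
  have hiq : IntegrableOn q (Icc 0 1) := hqc.integrableOn_compact isCompact_Icc
  have hie : IntegrableOn e (Icc 0 1) := hec.integrableOn_compact isCompact_Icc
  have h1 := integral_eq_sub_of_hasDerivWithinAt_Icc hder
    ((hpc.sub (hqc.const_mul _)).sub (hec.const_mul _)) h0I h1I zero_le_one
  have hiq' : IntegrableOn (fun u => t ^ 2 * q u) (Icc 0 1) := hiq.const_mul _
  have hipq : IntegrableOn (fun u => p u - t ^ 2 * q u) (Icc 0 1) := hip.sub hiq'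
  rw [← setIntegral_Icc_eq, integral_sub hipq (hie.const_mul _), integral_sub hip hiq',
    integral_const_mul, integral_const_mul] at h1
  have h2 := rescaledForm_eq_zero hQ hQR htI hJ hV W
  rw [rescaledForm_apply] at h2
  rw [rescaledFormDeriv_apply]
  have e1 : ∫ u in Icc (0 : ℝ) 1, D.g (deriv V.fn u) (deriv W.fn u) = ∫ u in Icc 0 1, p u := by
    refine integral_congr_ae ?_
    filter_upwards [deriv_fn_ae hJ.isJacobi htI hV, deriv_fn_ae hK.isJacobi htI hW] with u hu hu'
    rw [hu, hu']
  have e2 : ∫ u in Icc (0 : ℝ) 1, D.g (Q (t * u) (V.fn u)) (W.fn u) = ∫ u in Icc 0 1, q u :=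
    setIntegral_congr_fun measurableSet_Icc fun u hu => by simp only [q, hV u hu, hW u hu]
  have e3 : ∫ u in Icc (0 : ℝ) 1, D.g (u • Q' (t * u) (V.fn u)) (W.fn u) = ∫ u in Icc 0 1, e u :=
    setIntegral_congr_fun measurableSet_Icc fun u hu => by simp only [e, hV u hu, hW u hu]
  have hK1 : K t = 0 := by
    have := hW 1 h1I
    rw [W.fn_end, mul_one] at this
    exact this.symm
  have e4 : p 1 - t ^ 2 * q 1 = t ^ 2 * D.g (J' t) (K' t) := by
    simp only [p, q, mul_one, hK1, map_smul, LinearMap.smul_apply, smul_eq_mul, map_zero]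
    ring
  rw [e4] at h1
  rw [e1, e2] at h2
  rw [e2, e3]
  set sv := D.g (D.S ⟨V.fn 0, V.fn_zero_mem⟩) (W.fn 0)
  refine mul_left_cancel₀ ht.1.ne' ?_
  linear_combination h2 - h1

end MorseSturmData

end Kernel

/-! ### Counting jumps -/

theorem negIndex_eq_zero_of_subsingleton {V : Type*} [AddCommGroup V] [Module ℝ V] [Subsingleton V]
    (B : LinearMap.BilinForm ℝ V) : negIndex B = 0 := by
  rw [negIndex, ← nonpos_iff_eq_zero]
  exact iSup₂_le fun W _ => by rw [rank_subsingleton']; simp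

/-- A subset of `[0,1]` without accumulation points in `[0,1]` is finite. -/
theorem finite_of_forall_eventually_notMem {F : Set ℝ} (hF : F ⊆ Icc 0 1)
    (h : ∀ t₀ ∈ Icc (0 : ℝ) 1, ∀ᶠ t in nhdsWithin t₀ (Icc 0 1), t ≠ t₀ → t ∉ F) : F.Finite := by
  by_contra hinf
  obtain ⟨x, hx, hacc⟩ := Set.Infinite.exists_accPt_of_subset_isCompact hinf isCompact_Icc hF
  rw [accPt_iff_frequently] at hacc
  refine hacc ?_
  have := h x hx
  rw [eventually_nhdsWithin_iff] at this
  filter_upwards [this] with t ht hcon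
  exact ht (hF hcon.2) hcon.1 hcon.2

/-- The sum of the jumps of an integer valued function on `[0,1]`. At each `t₀` the function takes
the values `f t₀ + p t₀` to the right and `f t₀ + q t₀` to the left. -/
theorem eq_add_finsum_jumps {f p q : ℝ → ℤ} {F : Set ℝ} (hF : F.Finite) (hF0 : F ⊆ Ioc 0 1)
    (hpF : ∀ t ∉ F, p t = 0) (hqF : ∀ t ∉ F, q t = 0)
    (h : ∀ t₀ ∈ Icc (0 : ℝ) 1, ∀ᶠ t in nhdsWithin t₀ (Icc 0 1),
      (t₀ < t → f t = f t₀ + p t₀) ∧ (t < t₀ → f t = f t₀ + q t₀)) :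
    f 1 + q 1 = f 0 + ∑ᶠ t ∈ Ioo (0 : ℝ) 1, (p t - q t) := by
  classical
  set E : Finset ℝ := hF.toFinset
  have hE : ∀ t, t ∈ E ↔ t ∈ F := fun t => hF.mem_toFinset
  -- `G` is locally constant: the jumps of `f` are compensated by those of `q` and of the sum
  set G : ℝ → ℤ := fun x => f x + q x - ∑ s ∈ E with s < x, (p s - q s)
  have hG : ContinuousOn G (Icc 0 1) := fun t₀ ht₀ => by
    have h1 : ∀ᶠ t in nhds t₀, ∀ s ∈ E, s ≠ t₀ → (s < t ↔ s < t₀) ∧ t ≠ s := by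
      refine (Filter.eventually_all_finset E).2 fun s _ => ?_
      rcases lt_trichotomy s t₀ with hs | hs | hs
      · filter_upwards [lt_mem_nhds hs] with t ht _
        exact ⟨⟨fun _ => hs, fun _ => ht⟩, ht.ne'⟩
      · exact Filter.Eventually.of_forall fun t hne => absurd hs hne
      · filter_upwards [gt_mem_nhds hs] with t ht _
        exact ⟨⟨fun h => absurd h ht.not_gt, fun h => absurd h hs.not_gt⟩, ht.ne⟩
    refine tendsto_const_nhds.congr' ?_
    filter_upwards [h t₀ ht₀, mem_nhdsWithin_of_mem_nhds h1] with t ht hsep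
    rcases lt_trichotomy t t₀ with hlt | rfl | hlt
    · have hq : q t = 0 := by
        refine hqF t fun hmem => ?_
        exact (hsep t ((hE t).2 hmem) hlt.ne).2 rfl
      have hsum : (E.filter fun s => s < t) = E.filter fun s => s < t₀ := by
        refine Finset.filter_congr fun s hs => ?_
        rcases eq_or_ne s t₀ with rfl | hne
        · exact ⟨fun h => absurd h hlt.not_gt, fun h => absurd h (lt_irrefl _)⟩
        · exact (hsep s hs hne).1
      simp only [G, hsum, hq, ht.2 hlt, add_zero]
    · rfl
    · have hq : q t = 0 := by
        refine hqF t fun hmem => ?_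
        exact (hsep t ((hE t).2 hmem) hlt.ne').2 rfl
      have hsum : ∑ s ∈ E with s < t, (p s - q s) =
          (p t₀ - q t₀) + ∑ s ∈ E with s < t₀, (p s - q s) := by
        by_cases hmem : t₀ ∈ E
        · have : (E.filter fun s => s < t) = insert t₀ (E.filter fun s => s < t₀) := by
            ext s
            simp only [Finset.mem_filter, Finset.mem_insert]
            constructor
            · rintro ⟨hs, hst⟩
              rcases eq_or_ne s t₀ with rfl | hne
              · exact Or.inl rfl
              · exact Or.inr ⟨hs, (hsep s hs hne).1.1 hst⟩
            · rintro (rfl | ⟨hs, hst⟩)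
              · exact ⟨hmem, hlt⟩
              · exact ⟨hs, hst.trans hlt⟩
          rw [this, Finset.sum_insert (by simp)]
        · rw [hpF t₀ (mt (hE t₀).2 hmem), hqF t₀ (mt (hE t₀).2 hmem), sub_zero, zero_add]
          refine Finset.sum_congr (Finset.filter_congr fun s hs => ?_) fun _ _ => rfl
          exact (hsep s hs fun h => hmem (h ▸ hs)).1
      simp only [G, hsum, hq, ht.1 hlt]
      ring
  have h1 := isPreconnected_Icc.constant hG (right_mem_Icc.2 zero_le_one)
    (left_mem_Icc.2 zero_le_one)
  have h2 : ∑ s ∈ E with s < 0, (p s - q s) = 0 := by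
    refine Finset.sum_eq_zero fun s hs => ?_
    rw [Finset.mem_filter, hE] at hs
    exact absurd hs.2 (hF0 hs.1).1.not_gt
  have h3 : q 0 = 0 := hqF 0 fun h => lt_irrefl _ (hF0 h).1
  have h4 : ∑ᶠ t ∈ Ioo (0 : ℝ) 1, (p t - q t) = ∑ s ∈ E with s < 1, (p s - q s) := by
    refine finsum_mem_eq_sum_of_inter_support_eq _ ?_
    ext s
    simp only [mem_inter_iff, Function.mem_support, Finset.coe_filter, mem_ofPred_eq, hE]
    constructor
    · rintro ⟨⟨_, hs⟩, hne⟩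
      refine ⟨⟨?_, hs⟩, hne⟩
      by_contra hmem
      exact hne (by rw [hpF s hmem, hqF s hmem, sub_zero])
    · rintro ⟨⟨hs, hs1⟩, hne⟩
      exact ⟨⟨(hF0 hs).1, hs1⟩, hne⟩
  simp only [G, h2, h3] at h1
  rw [h4]
  linarith

/-! ### The index function of an admissible family -/

section IndexFunction

attribute [local instance] H1P.addCommGroupOfNormed H1P.moduleOfNormed

namespace MorseSturmData

variable {n : ℕ} {D : MorseSturmData n} {Q Q' : ℝ → Rn n →L[ℝ] Rn n} {t : ℝ}

theorem hasDerivWithinAt_fn_one (ht : t ∈ Icc (0 : ℝ) 1) {J J' : ℝ → Rn n} (hJ : D.IsSolution J J')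
    {V : D.Hs 1} (hV : ∀ u ∈ Icc (0 : ℝ) 1, V.fn u = J (t * u)) :
    HasDerivWithinAt V.fn (t • J' t) (Icc 0 1) 1 := by
  have h1 : (1 : ℝ) ∈ Icc (0 : ℝ) 1 := right_mem_Icc.2 zero_le_one
  have := (hasDerivWithinAt_comp_mul hJ.1 ht 1 h1).congr_of_mem hV h1
  rwa [mul_one] at this

/-- The kernel of the rescaled index form is identified with `𝕁[t]^⊥` by the derivative at the
final instant. -/
theorem exists_kerEquiv (hQ : Continuous Q) (hQ' : Continuous Q')
    (hQQ' : ∀ t, HasDerivAt Q (Q' t) t) (hQR : EqOn Q D.R (Icc 0 1)) (ht : t ∈ Ioc (0 : ℝ) 1) :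
    ∃ e : LinearMap.ker (D.rescaledForm hQ t).toBilinForm ≃ₗ[ℝ] D.jPerp t, ∀ V W,
      D.g (e V) (e W) = -(t * D.rescaledFormDeriv hQ hQ' t V W) := by
  have htI : t ∈ Icc (0 : ℝ) 1 := ⟨ht.1.le, ht.2⟩
  have hu := uniqueDiffOn_Icc (zero_lt_one' ℝ) 1 (right_mem_Icc.2 zero_le_one)
  set N := LinearMap.ker (D.rescaledForm hQ t).toBilinForm
  have hN : ∀ V : N, ∃ J J', D.IsSolution J J' ∧ J t = 0 ∧
      ∀ u ∈ Icc (0 : ℝ) 1, (V : D.Hs 1).fn u = J (t * u) := fun V =>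
    exists_isSolution_of_mem_ker hQ hQR ht fun W =>
      LinearMap.congr_fun (LinearMap.mem_ker.1 V.2) W
  choose J J' hJ hJt hV using hN
  have hd : ∀ V : N, HasDerivWithinAt (V : D.Hs 1).fn (t • J' V t) (Icc 0 1) 1 := fun V =>
    hasDerivWithinAt_fn_one htI (hJ V) (hV V)
  let e₀ : N →ₗ[ℝ] D.jPerp t :=
    { toFun := fun V => ⟨t • J' V t, (D.jPerp t).smul_mem t
        ((mem_jPerp_iff htI).2 ⟨_, _, hJ V, hJt V, rfl⟩)⟩
      map_add' := fun V W => Subtype.ext (hu.eq_deriv _ (hd (V + W)) ((hd V).add (hd W)))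
      map_smul' := fun c V => Subtype.ext (hu.eq_deriv _ (hd (c • V)) ((hd V).const_smul c)) }
  have hinj : Function.Injective e₀ := by
    rw [← LinearMap.ker_eq_bot, eq_bot_iff]
    intro V hVe
    have h1 : t • J' V t = 0 := congrArg Subtype.val (LinearMap.mem_ker.1 hVe)
    have h2 : J' V t = 0 := (smul_eq_zero.1 h1).resolve_left ht.1.ne'
    rw [Submodule.mem_bot]
    refine Subtype.ext (H1P.ext_fn fun u hu => ?_)
    rw [hV V u hu]
    exact ((hJ V).isJacobi.unique IsJacobi.zero htI (hJt V) h2 (mul_mem_Icc htI hu)).1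
  have hsurj : Function.Surjective e₀ := by
    rintro ⟨ξ, hξ⟩
    obtain ⟨K, K', hK, hKt, hK't⟩ := (mem_jPerp_iff htI).1 ((D.jPerp t).smul_mem t⁻¹ hξ)
    obtain ⟨V, hVK⟩ := exists_fn_eq hK htI hKt
    have hVN : V ∈ N := LinearMap.mem_ker.2 <| by
      ext W
      exact rescaledForm_eq_zero hQ hQR htI hK hVK W
    refine ⟨⟨V, hVN⟩, Subtype.ext ?_⟩
    have h1 := hu.eq_deriv _ (hd ⟨V, hVN⟩) (hasDerivWithinAt_fn_one htI hK hVK)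
    change t • J' ⟨V, hVN⟩ t = ξ
    rw [h1, hK't, smul_smul, mul_inv_cancel₀ ht.1.ne', one_smul]
  refine ⟨LinearEquiv.ofBijective e₀ ⟨hinj, hsurj⟩, fun V W => ?_⟩
  change D.g (t • J' V t) (t • J' W t) = _
  rw [rescaledFormDeriv_eq hQ hQ' hQQ' hQR ht (hJ V) (hJ W) (hV V) (hV W)]
  simp only [map_smul, LinearMap.smul_apply, smul_eq_mul]
  ring

theorem jPerp_eq_bot_of_ker (hQ : Continuous Q) (hQR : EqOn Q D.R (Icc 0 1))
    (ht : t ∈ Ioc (0 : ℝ) 1) (h : ∀ V : D.Hs 1, (∀ W, D.rescaledForm hQ t V W = 0) → V = 0) :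
    D.jPerp t = ⊥ := by
  have htI : t ∈ Icc (0 : ℝ) 1 := ⟨ht.1.le, ht.2⟩
  have hu := uniqueDiffOn_Icc (zero_lt_one' ℝ) 1 (right_mem_Icc.2 zero_le_one)
  rw [eq_bot_iff]
  intro ξ hξ
  obtain ⟨K, K', hK, hKt, rfl⟩ := (mem_jPerp_iff htI).1 hξ
  obtain ⟨V, hVK⟩ := exists_fn_eq hK htI hKt
  have h0 : V = 0 := h V (rescaledForm_eq_zero hQ hQR htI hK hVK)
  have h1 := hasDerivWithinAt_fn_one htI hK hVK
  rw [h0] at h1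
  have h2 := hu.eq_deriv _ h1 (hasDerivWithinAt_const 1 _ (0 : Rn n))
  exact (smul_eq_zero.1 h2).resolve_left ht.1.ne'

variable {K : ∀ t : Ioc (0 : ℝ) 1, Submodule ℝ (D.Hs t)} {K0 : Submodule ℝ (D.Hs 1)}

theorem hatFamily_of_mem (ht : t ∈ Ioc (0 : ℝ) 1) :
    D.hatFamily K K0 t = (K ⟨t, ht⟩).comap (H1P.phi D.P ⟨t, ht⟩) := dif_pos ht

theorem hatFamily_zero : D.hatFamily K K0 0 = K0 := dif_neg fun h => lt_irrefl _ h.1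

/-- `φ_t` identifies `K̂_t` with `K_t`. -/
def hatEquiv (K : ∀ t : Ioc (0 : ℝ) 1, Submodule ℝ (D.Hs t)) (K0 : Submodule ℝ (D.Hs 1))
    (ht : t ∈ Ioc (0 : ℝ) 1) : D.hatFamily K K0 t ≃ₗ[ℝ] K ⟨t, ht⟩ :=
  LinearEquiv.ofBijective ((H1P.phi D.P ⟨t, ht⟩).restrict (p := D.hatFamily K K0 t)
    (q := K ⟨t, ht⟩) fun V hV => by rw [hatFamily_of_mem ht] at hV; exact hV)
    ⟨fun V W h => Subtype.ext (H1P.phi_injective ⟨t, ht⟩ (congrArg Subtype.val h)), fun W => by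
      obtain ⟨V, hV⟩ := H1P.phi_surjective ⟨t, ht⟩ (W : D.Hs t)
      refine ⟨⟨V, ?_⟩, Subtype.ext hV⟩
      rw [hatFamily_of_mem ht, Submodule.mem_comap, hV]
      exact W.2⟩

theorem rescaledForm_hatEquiv (hQ : Continuous Q) (hQR : EqOn Q D.R (Icc 0 1))
    (ht : t ∈ Ioc (0 : ℝ) 1) (V W : D.hatFamily K K0 t) :
    D.rescaledForm hQ t V W =
      t * (D.indexForm ⟨t, ht⟩).restrict (K ⟨t, ht⟩) (hatEquiv K K0 ht V) (hatEquiv K K0 ht W) :=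
  D.rescaledForm_eq_indexForm hQ hQR ⟨t, ht⟩ V W

theorem hasMorseSplitting_rescaledForm (hQ : Continuous Q) (hQR : EqOn Q D.R (Icc 0 1))
    (hK : D.IsAdmissible K K0) (ht : t ∈ Ioc (0 : ℝ) 1) :
    HasMorseSplitting ((D.rescaledForm hQ t).toBilinForm.restrict (D.hatFamily K K0 t)) := by
  have : CompleteSpace (D.Hs t) := H1P.completeSpace ht.1.le
  have : CompleteSpace (K ⟨t, ht⟩) := (hK.isClosed ⟨t, ht⟩).completeSpace_coe
  refine (hK.compactPerturbation ⟨t, ht⟩).hasMorseSplitting.of_surjective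
    (hatEquiv K K0 ht).symm.toLinearMap (hatEquiv K K0 ht).symm.surjective
    (M := Real.sqrt t⁻¹) (fun V => ?_) ht.1 fun V W => ?_
  · obtain ⟨V, rfl⟩ := (hatEquiv K K0 ht).surjective V
    rw [LinearEquiv.coe_coe, LinearEquiv.symm_apply_apply]
    have h1 := H1P.norm_sq_le_phi ⟨t, ht⟩ (V : D.Hs 1)
    have hti : 0 ≤ t⁻¹ := inv_nonneg.2 ht.1.le
    refine abs_le_of_sq_le_sq' ?_ (by positivity) |>.2
    rw [mul_pow, Real.sq_sqrt hti]
    exact h1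
  · obtain ⟨V, rfl⟩ := (hatEquiv K K0 ht).surjective V
    obtain ⟨W, rfl⟩ := (hatEquiv K K0 ht).surjective W
    rw [LinearEquiv.coe_coe, LinearEquiv.symm_apply_apply, LinearEquiv.symm_apply_apply]
    exact rescaledForm_hatEquiv hQ hQR ht V W

/-- The equality of the kernels of `I_t` on `K_t` and on `𝓗_t`, read on `𝓗_1`. -/
theorem mem_ker_rescaledForm_iff (hQ : Continuous Q) (hQR : EqOn Q D.R (Icc 0 1))
    (hK : D.IsAdmissible K K0) (ht : t ∈ Ioc (0 : ℝ) 1) (V : D.Hs 1) :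
    (∀ W, D.rescaledForm hQ t V W = 0) ↔ V ∈ D.hatFamily K K0 t ∧
      ∀ W ∈ D.hatFamily K K0 t, D.rescaledForm hQ t V W = 0 := by
  constructor
  · intro h
    refine ⟨?_, fun W _ => h W⟩
    have h1 : H1P.phi D.P ⟨t, ht⟩ V ∈ LinearMap.ker (D.indexForm ⟨t, ht⟩) := by
      rw [LinearMap.mem_ker]
      ext W
      obtain ⟨W, rfl⟩ := H1P.phi_surjective ⟨t, ht⟩ W
      have := h W
      rw [D.rescaledForm_eq_indexForm hQ hQR ⟨t, ht⟩] at this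
      exact (mul_eq_zero.1 this).resolve_left ht.1.ne'
    rw [← hK.kernel_eq] at h1
    obtain ⟨x, _, hx⟩ := h1
    rw [hatFamily_of_mem ht, Submodule.mem_comap, ← hx]
    exact x.2
  · rintro ⟨hV, h⟩ W
    have h1 : hatEquiv K K0 ht ⟨V, hV⟩ ∈
        LinearMap.ker ((D.indexForm ⟨t, ht⟩).restrict (K ⟨t, ht⟩)) := by
      rw [LinearMap.mem_ker]
      ext W
      obtain ⟨W, rfl⟩ := (hatEquiv K K0 ht).surjective W
      have := h W W.2
      rw [show D.rescaledForm hQ t V W = _ from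
        rescaledForm_hatEquiv hQ hQR ht (⟨V, hV⟩ : D.hatFamily K K0 t) W] at this
      exact (mul_eq_zero.1 this).resolve_left ht.1.ne'
    have h2 : H1P.phi D.P ⟨t, ht⟩ V ∈ LinearMap.ker (D.indexForm ⟨t, ht⟩) := by
      rw [← hK.kernel_eq]
      exact ⟨_, h1, rfl⟩
    rw [D.rescaledForm_eq_indexForm hQ hQR ⟨t, ht⟩, LinearMap.mem_ker.1 h2]
    simp

end MorseSturmData

end IndexFunction

/-! ### The jumps of the index of an admissible family -/

section IndexJump

attribute [local instance] H1P.addCommGroupOfNormed H1P.moduleOfNormed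

namespace MorseSturmData

variable {n : ℕ} {D : MorseSturmData n} {Q Q' : ℝ → Rn n →L[ℝ] Rn n} {t : ℝ}
  {K : ∀ t : Ioc (0 : ℝ) 1, Submodule ℝ (D.Hs t)} {K0 : Submodule ℝ (D.Hs 1)}

/-- The index of `I_t` on `K_t`, or of `C₀` on `K̂_0` for `t = 0`, computed on the fixed Hilbert
space `𝓗_1`. -/
def hatIndex (hQ : Continuous Q) (K : ∀ t : Ioc (0 : ℝ) 1, Submodule ℝ (D.Hs t))
    (K0 : Submodule ℝ (D.Hs 1)) (t : ℝ) : ℕ∞ :=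
  negIndex ((D.rescaledForm hQ t).toBilinForm.restrict (D.hatFamily K K0 t))

theorem hatIndex_of_mem (hQ : Continuous Q) (hQR : EqOn Q D.R (Icc 0 1))
    (ht : t ∈ Ioc (0 : ℝ) 1) :
    hatIndex hQ K K0 t = negIndex ((D.indexForm ⟨t, ht⟩).restrict (K ⟨t, ht⟩)) :=
  negIndex_eq_of_linearEquiv (hatEquiv K K0 ht) (inv_pos.2 ht.1) fun V => by
    have h1 : (D.rescaledForm hQ t).toBilinForm.restrict (D.hatFamily K K0 t) V V =
      t * (D.indexForm ⟨t, ht⟩).restrict (K ⟨t, ht⟩) (hatEquiv K K0 ht V) (hatEquiv K K0 ht V) :=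
      rescaledForm_hatEquiv hQ hQR ht V V
    rw [h1, inv_mul_cancel_left₀ ht.1.ne']

theorem restrict_rescaledForm_zero (hQ : Continuous Q) :
    (D.rescaledForm hQ 0).toBilinForm.restrict K0 = D.C0.restrict K0 :=
  congrArg (fun B : LinearMap.BilinForm ℝ (D.Hs 1) => B.restrict K0) (D.rescaledForm_zero hQ)

theorem hatIndex_zero (hQ : Continuous Q) :
    hatIndex hQ K K0 0 = negIndex (D.C0.restrict K0) := by
  rw [hatIndex, hatFamily_zero, restrict_rescaledForm_zero]

/-- The derivative of a family of symmetric forms is symmetric. -/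
theorem rescaledFormDeriv_symm (hQ : Continuous Q) (hQ' : Continuous Q')
    (hQQ' : ∀ t, HasDerivAt Q (Q' t) t) (hQR : EqOn Q D.R (Icc 0 1)) (ht : t ∈ Icc (0 : ℝ) 1)
    (V W : D.Hs 1) : D.rescaledFormDeriv hQ hQ' t V W = D.rescaledFormDeriv hQ hQ' t W V := by
  have h : ∀ V W : D.Hs 1, HasDerivWithinAt (fun t => D.rescaledForm hQ t V W)
      (D.rescaledFormDeriv hQ hQ' t V W) (Icc 0 1) t := fun V W => by
    have h1 := D.hasDerivAt_rescaledForm hQ hQ' hQQ' t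
    exact (((ContinuousLinearMap.hasDerivAt_comp (F := ℝ) (ContinuousLinearMap.apply ℝ ℝ W)
      (ContinuousLinearMap.hasDerivAt_comp (E := D.Hs 1 →L[ℝ] D.Hs 1 →L[ℝ] ℝ)
        (F := D.Hs 1 →L[ℝ] ℝ) (ContinuousLinearMap.apply ℝ _ V) h1))).hasDerivWithinAt)
  exact (uniqueDiffOn_Icc zero_lt_one t ht).eq_deriv _ (h V W)
    ((h W V).congr_of_mem (fun s hs => D.rescaledForm_symm hQ hQR hs V W) ht)

theorem hasDerivWithinAt_rescaledForm (hQ : Continuous Q) (hQ' : Continuous Q')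
    (hQQ' : ∀ t, HasDerivAt Q (Q' t) t) (t : ℝ) (I : Set ℝ) :
    HasDerivWithinAt (D.rescaledForm hQ) (D.rescaledFormDeriv hQ hQ' t) I t :=
  HasDerivAt.hasDerivWithinAt (𝕜 := ℝ) (F := D.Hs 1 →L[ℝ] D.Hs 1 →L[ℝ] ℝ)
    (D.hasDerivAt_rescaledForm hQ hQ' hQQ' t)

/-- The jump of the index at a positive instant. -/
theorem exists_hatIndex_jump (hQ : Continuous Q) (hQ' : Continuous Q')
    (hQQ' : ∀ t, HasDerivAt Q (Q' t) t) (hQR : EqOn Q D.R (Icc 0 1))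
    (hK : D.IsAdmissible K K0) (ht : t ∈ Ioc (0 : ℝ) 1)
    (hJ : (D.g.restrict (D.jSpace t)).Nondegenerate) :
    ∃ i p q : ℕ, hatIndex hQ K K0 t = i ∧ posIndex (D.g.restrict (D.jPerp t)) = p ∧
      negIndex (D.g.restrict (D.jPerp t)) = q ∧
      (∀ᶠ s in nhdsWithin t (Icc 0 1), t < s → hatIndex hQ K K0 s = (i + p : ℕ)) ∧
      (∀ᶠ s in nhdsWithin t (Icc 0 1), s < t → hatIndex hQ K K0 s = (i + q : ℕ)) ∧
      ∀ᶠ s in nhdsWithin t (Icc 0 1), s ≠ t → s ∈ Ioc 0 1 → D.jPerp s = ⊥ := by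
  have htI : t ∈ Icc (0 : ℝ) 1 := ⟨ht.1.le, ht.2⟩
  set N := LinearMap.ker (D.rescaledForm hQ t).toBilinForm
  obtain ⟨e, he⟩ : ∃ e : N ≃ₗ[ℝ] D.jPerp t, ∀ V W,
    D.g (e V) (e W) = -(t * D.rescaledFormDeriv hQ hQ' t V W) :=
    exists_kerEquiv hQ hQ' hQQ' hQR ht
  have hN : ∀ V, V ∈ N ↔ ∀ W, D.rescaledForm hQ t V W = 0 := fun V =>
    ⟨fun h W => LinearMap.congr_fun (LinearMap.mem_ker.1 h) W,
      fun h => LinearMap.mem_ker.2 (LinearMap.ext h)⟩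
  obtain ⟨i, p, q, hi, hp, hq, hr, hl, hnd⟩ := exists_index_jump (X := D.Hs 1)
    (C := D.rescaledForm hQ) (C' := D.rescaledFormDeriv hQ hQ' t) (I := Icc 0 1) htI
    (hasDerivWithinAt_rescaledForm hQ hQ' hQQ' t _)
    (fun s hs V W => D.rescaledForm_symm hQ hQR hs V W)
    (rescaledFormDeriv_symm hQ hQ' hQQ' hQR htI) hK.isC1Family
    (hasMorseSplitting_rescaledForm hQ hQR hK ht) (N := N)
    (fun V => (hN V).trans (mem_ker_rescaledForm_iff hQ hQR hK ht V))
    (fun V hV => (hN V).1 hV) (fun V hV h => by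
      have h1 : (e ⟨V, hV⟩ : Rn n) = 0 := eq_zero_of_mem_jPerp hJ (e ⟨V, hV⟩).2 fun η hη => by
        obtain ⟨W, hW⟩ := e.surjective ⟨η, hη⟩
        have h2 := he ⟨V, hV⟩ W
        rw [hW, h W W.2, mul_zero, neg_zero] at h2
        exact h2
      have h2 : e ⟨V, hV⟩ = 0 := Subtype.ext h1
      exact congrArg Subtype.val ((LinearEquiv.map_eq_zero_iff e).1 h2))
  refine ⟨i, p, q, hi, ?_, ?_, hr, hl, ?_⟩
  · rw [← hp, posIndex]
    refine (negIndex_eq_of_linearEquiv e ht.1 fun V => ?_).symm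
    change -(D.g (e V) (e V)) = t * D.rescaledFormDeriv hQ hQ' t V V
    rw [he, neg_neg]
  · rw [← hq, posIndex]
    refine (negIndex_eq_of_linearEquiv e ht.1 fun V => ?_).symm
    change D.g (e V) (e V) = t * -D.rescaledFormDeriv hQ hQ' t V V
    rw [he, mul_neg]
  · filter_upwards [hnd] with s hs hst hs01
    refine jPerp_eq_bot_of_ker hQ hQR hs01 fun V hV => ?_
    have h1 := (mem_ker_rescaledForm_iff hQ hQR hK hs01 V).1 hV
    exact hs hst V h1.1 h1.2

/-- Near `t = 0` the index is constant. -/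
theorem exists_hatIndex_zero (hQ : Continuous Q) (hQ' : Continuous Q')
    (hQQ' : ∀ t, HasDerivAt Q (Q' t) t) (hQR : EqOn Q D.R (Icc 0 1)) (hK : D.IsAdmissible K K0) :
    ∃ i : ℕ, hatIndex hQ K K0 0 = i ∧
      (∀ᶠ s in nhdsWithin 0 (Icc 0 1), 0 < s → hatIndex hQ K K0 s = i) ∧
      ∀ᶠ s in nhdsWithin 0 (Icc 0 1), s ≠ 0 → s ∈ Ioc (0 : ℝ) 1 → D.jPerp s = ⊥ := by
  have h0I : (0 : ℝ) ∈ Icc (0 : ℝ) 1 := left_mem_Icc.2 zero_le_one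
  have hK0 : IsClosed (K0 : Set (D.Hs 1)) := by
    have := hK.isC1Family.1 0 h0I
    rwa [hatFamily_zero] at this
  have : CompleteSpace K0 := hK0.completeSpace_coe
  have hC0 : ∀ V W, D.rescaledForm hQ 0 V W = D.C0 V W := fun V W =>
    LinearMap.congr_fun₂ (D.rescaledForm_zero hQ) V W
  obtain ⟨i, p, q, hi, hp, hq, hr, hl, hnd⟩ := exists_index_jump (X := D.Hs 1)
    (C := D.rescaledForm hQ) (C' := D.rescaledFormDeriv hQ hQ' 0) (I := Icc 0 1) h0I
    (hasDerivWithinAt_rescaledForm hQ hQ' hQQ' 0 _)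
    (fun s hs V W => D.rescaledForm_symm hQ hQR hs V W)
    (rescaledFormDeriv_symm hQ hQ' hQQ' hQR h0I) hK.isC1Family
    (by
      rw [hatFamily_zero, restrict_rescaledForm_zero]
      exact hK.C0_compactPerturbation.hasMorseSplitting) (N := ⊥)
    (fun V => by
      rw [hatFamily_zero, Submodule.mem_bot]
      constructor
      · rintro rfl
        exact ⟨K0.zero_mem, fun W _ => by simp⟩
      · rintro ⟨hV, h⟩
        exact congrArg Subtype.val (hK.C0_nondegenerate.1 ⟨V, hV⟩ fun W =>
          (hC0 V W).symm.trans (h W W.2)))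
    (fun V hV W => by rw [(Submodule.mem_bot ℝ).1 hV]; simp)
    (fun V hV _ => (Submodule.mem_bot ℝ).1 hV)
  rw [negIndex_eq_zero_of_subsingleton] at hp
  have hp0 : p = 0 := by exact_mod_cast hp.symm
  subst hp0
  refine ⟨i, hi, hr, ?_⟩
  filter_upwards [hnd] with s hs hst hs01
  refine jPerp_eq_bot_of_ker hQ hQR hs01 fun V hV => ?_
  have h1 := (mem_ker_rescaledForm_iff hQ hQR hK hs01 V).1 hV
  exact hs hst V h1.1 h1.2

end MorseSturmData

end IndexJump

end

theorem theorem4p2 (n : ℕ) (D : MorseSturmData n) (hR : ContDiffOn ℝ 1 D.R (Set.Icc 0 1))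
    (hJ : ∀ t ∈ Set.Ioc (0 : ℝ) 1, (D.g.restrict (D.jSpace t)).Nondegenerate)
    (K : ∀ t : Set.Ioc (0 : ℝ) 1, Submodule ℝ (D.Hs t)) (K0 : Submodule ℝ (D.Hs 1))
    (hK : D.IsAdmissible K K0) :
    {t : ℝ | D.IsFocal t}.Finite ∧
    ∃ i₁ i₀ m : ℕ,
      negIndex ((D.indexForm ⟨1, zero_lt_one, le_rfl⟩).restrict (K ⟨1, zero_lt_one, le_rfl⟩)) =
        (i₁ : ℕ∞) ∧
      negIndex (D.C0.restrict K0) = (i₀ : ℕ∞) ∧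
      negIndex (D.g.restrict (D.jPerp 1)) = (m : ℕ∞) ∧
      (i₁ : ℤ) = (i₀ : ℤ) + (∑ᶠ t ∈ Set.Ioo (0 : ℝ) 1, D.sgn t) - (m : ℤ) := by
  obtain ⟨Q, Q', hQ', hQQ', hQR⟩ := exists_extension_of_contDiffOn hR
  have hQ : Continuous Q := continuous_iff_continuousAt.2 fun t => (hQQ' t).continuousAt
  have h1I : (1 : ℝ) ∈ Ioc (0 : ℝ) 1 := ⟨zero_lt_one, le_rfl⟩
  obtain ⟨i₀, hi₀, hr₀, hnd₀⟩ := MorseSturmData.exists_hatIndex_zero hQ hQ' hQQ' hQR hK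
  have key := fun t (ht : t ∈ Ioc (0 : ℝ) 1) =>
    MorseSturmData.exists_hatIndex_jump hQ hQ' hQQ' hQR hK ht (hJ t ht)
  choose! i p q hi hp hq hr hl hnd using key
  set F : Set ℝ := {t : ℝ | D.IsFocal t}
  have hFmem : ∀ t, t ∈ F ↔ t ∈ Ioc (0 : ℝ) 1 ∧ D.jPerp t ≠ ⊥ := fun t =>
    MorseSturmData.isFocal_iff_jPerp_ne_bot
  have hF0 : F ⊆ Ioc 0 1 := fun t ht => ((hFmem t).1 ht).1
  have hsplit : ∀ t ∈ Icc (0 : ℝ) 1, t = 0 ∨ t ∈ Ioc (0 : ℝ) 1 := fun t ht =>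
    ht.1.eq_or_lt.imp Eq.symm fun h => ⟨h, ht.2⟩
  have hFfin : F.Finite := by
    refine finite_of_forall_eventually_notMem (hF0.trans Ioc_subset_Icc_self) fun t₀ ht₀ => ?_
    have h : ∀ᶠ s in nhdsWithin t₀ (Icc 0 1), s ≠ t₀ → s ∈ Ioc (0 : ℝ) 1 → D.jPerp s = ⊥ := by
      rcases hsplit t₀ ht₀ with rfl | h
      · exact hnd₀
      · exact hnd t₀ h
    filter_upwards [h] with s hs hne hsF
    exact ((hFmem s).1 hsF).2 (hs hne ((hFmem s).1 hsF).1)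
  refine ⟨hFfin, i 1, i₀, q 1, ?_, ?_, hq 1 h1I, ?_⟩
  · rw [← hi 1 h1I, MorseSturmData.hatIndex_of_mem hQ hQR h1I]
  · rw [← hi₀, MorseSturmData.hatIndex_zero]
  classical
  set f : ℝ → ℤ := fun t => ((MorseSturmData.hatIndex hQ K K0 t).toNat : ℤ)
  set p' : ℝ → ℤ := fun t => if t ∈ Ioc (0 : ℝ) 1 then (p t : ℤ) else 0
  set q' : ℝ → ℤ := fun t => if t ∈ Ioc (0 : ℝ) 1 then (q t : ℤ) else 0
  have hp' : ∀ t ∈ Ioc (0 : ℝ) 1, p' t = p t := fun t ht => if_pos ht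
  have hq' : ∀ t ∈ Ioc (0 : ℝ) 1, q' t = q t := fun t ht => if_pos ht
  have hbot : ∀ t ∈ Ioc (0 : ℝ) 1, t ∉ F → p t = 0 ∧ q t = 0 := fun t ht htF => by
    have h1 : D.jPerp t = ⊥ := by
      by_contra h
      exact htF ((hFmem t).2 ⟨ht, h⟩)
    have : Subsingleton (D.jPerp t) := by rw [h1]; infer_instance
    have h2 := hp t ht
    have h3 := hq t ht
    rw [posIndex, negIndex_eq_zero_of_subsingleton] at h2
    rw [negIndex_eq_zero_of_subsingleton] at h3
    exact ⟨by exact_mod_cast h2.symm, by exact_mod_cast h3.symm⟩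
  have hsum := eq_add_finsum_jumps (f := f) (p := p') (q := q') hFfin hF0
    (fun t htF => by
      by_cases ht : t ∈ Ioc (0 : ℝ) 1
      · rw [hp' t ht, (hbot t ht htF).1, Nat.cast_zero]
      · exact if_neg ht)
    (fun t htF => by
      by_cases ht : t ∈ Ioc (0 : ℝ) 1
      · rw [hq' t ht, (hbot t ht htF).2, Nat.cast_zero]
      · exact if_neg ht)
    (fun t₀ ht₀ => by
      rcases hsplit t₀ ht₀ with rfl | h
      · have hp0 : p' 0 = 0 := if_neg fun h => lt_irrefl _ h.1
        filter_upwards [hr₀, self_mem_nhdsWithin] with t ht htI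
        refine ⟨fun hlt => ?_, fun hlt => absurd htI.1 hlt.not_ge⟩
        simp only [f, ht hlt, hi₀, hp0, add_zero]
      · filter_upwards [hr t₀ h, hl t₀ h] with t ht ht'
        refine ⟨fun hlt => ?_, fun hlt => ?_⟩
        · simp only [f]
          rw [ht hlt, hi t₀ h, hp' t₀ h, ENat.toNat_natCast, ENat.toNat_natCast, Nat.cast_add]
        · simp only [f]
          rw [ht' hlt, hi t₀ h, hq' t₀ h, ENat.toNat_natCast, ENat.toNat_natCast, Nat.cast_add])
  have hsgn : ∑ᶠ t ∈ Ioo (0 : ℝ) 1, D.sgn t = ∑ᶠ t ∈ Ioo (0 : ℝ) 1, (p' t - q' t) := by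
    refine finsum_mem_congr rfl fun t ht => ?_
    have ht' : t ∈ Ioc (0 : ℝ) 1 := Ioo_subset_Ioc_self ht
    rw [MorseSturmData.sgn, signature, hp t ht', hq t ht', hp' t ht', hq' t ht', ENat.toNat_natCast,
      ENat.toNat_natCast]
  have hf1 : f 1 = i 1 := by simp only [f, hi 1 h1I, ENat.toNat_natCast]
  have hf0 : f 0 = i₀ := by simp only [f, hi₀, ENat.toNat_natCast]
  rw [hf1, hf0, hq' 1 h1I] at hsum
  rw [hsgn]
  linarith
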